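/- Let $X$ be a Dedekind scheme, i.e. a Noetherian, regular, irreducible scheme with $\dim X\le 1$, let $F$ be its function field (the local ring at the generic point $\eta$), and let $G$ be a finite group. By a coherent $\mathcal O_XG$-module we mean a coherent $\mathcal O_X$-module $\mathcal P$ together with an action of $G$ on $\mathcal P$ by $\mathcal O_X$-homomorphisms; it is called locally projective (resp. locally free) over $\mathcal O_XG$ if, for every $x\in X$, the stalk $\mathcal P_x$ is a projective (resp. free) module over the group ring $\mathcal O_{X,x}G$. Let $K_0(\mathcal O_XG)$ (resp. $K_0^{\rm lf}(\mathcal O_XG)$) be the Grothendieck group, with respect to short exact sequences, of all coherent $\mathcal O_XG$-modules that are locally projective (resp. locally free) over $\mathcal O_XG$, and let $K_0(FG)$ (resp. $K_0^{\rm lf}(FG)$) be the Grothendieck group of all finitely generated projective (resp. free) $FG$-modules. Passing to the stalk at $\eta$, $[\mathcal P]\mapsto[\mathcal P_\eta]$, defines canonical homomorphisms $K_0(\mathcal O_XG)\to K_0(FG)$ and $K_0^{\rm lf}(\mathcal O_XG)\to K_0^{\rm lf}(FG)$. The locally free classgroup is $$\mathrm{Cl}(\mathcal O_XG):=\ker\bigl(K_0^{\rm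 lf}(\mathcal O_XG)\to K_0^{\rm lf}(FG)\bigr).$$ Then the canonical homomorphism $K_0^{\rm lf}(\mathcal O_XG)\to K_0(\mathcal O_XG)$, $[\mathcal P]\mapsto[\mathcal P]$, induces an isomorphism $$\mathrm{Cl}(\mathcal O_XG)\;\xrightarrow{\ \sim\ }\;\ker\bigl(K_0(\mathcal O_XG)\to K_0(FG)\bigr).$$ -/

import Mathlib

open CategoryTheory AlgebraicGeometry Limits Opposite TopologicalSpace
universe u
namespace GaloisModule

lemma epi_toSheaf_map {C : Type u} [SmallCategory C] {J : GrothendieckTopology C}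
    {R : Sheaf J RingCat.{u}} {M N : SheafOfModules.{u} R} (f : M ⟶ N) [Epi f] :
    Epi ((SheafOfModules.toSheaf R).map f) := by
  let a := PresheafOfModules.sheafification.{u} (𝟙 R.obj)
  let r := SheafOfModules.forget.{u} R ⋙ PresheafOfModules.restrictScalars (𝟙 R.obj)
  let T := SheafOfModules.toSheaf.{u} R
  let ε : r ⋙ a ≅ 𝟭 _ := asIso (PresheafOfModules.sheafificationAdjunction.{u} (𝟙 R.obj)).counit
  let e : r.obj M ⟶ image (r.map f) := factorThruImage (r.map f)
  let m : image (r.map f) ⟶ r.obj N := image.ι (r.map f)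
  have hem : a.map e ≫ a.map m = a.map (r.map f) := by
    rw [← a.map_comp, image.fac]
  have hf : a.map (r.map f) = ε.hom.app M ≫ f ≫ ε.inv.app N := by
    have := ε.hom.naturality f
    simp only [Functor.comp_map, Functor.id_map] at this
    rw [← Category.assoc, ← this, Category.assoc, Iso.hom_inv_id_app]
    exact (Category.comp_id _).symm
  have h1 : Epi (a.map (r.map f)) := by
    rw [hf]
    have h7 : Epi (ε.hom.app M) := inferInstance
    have h8 : Epi (ε.inv.app N) := inferInstance
    exact @epi_comp _ _ _ _ _ _ h7 _ (@epi_comp _ _ _ _ _ _ ‹Epi f› _ h8)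
  have h2 : Epi (a.map m) := by
    rw [← hem] at h1
    exact epi_of_epi (a.map e) (a.map m)
  have h3 : Mono (a.map m) := inferInstance
  have h4 : IsIso (a.map m) := isIso_of_mono_of_epi _
  have h5 : Epi (T.map (a.map e)) := by
    change Epi ((presheafToSheaf J AddCommGrpCat.{u}).map
      ((PresheafOfModules.toPresheaf.{u} R.obj).map e))
    have : Epi e := inferInstanceAs (Epi (factorThruImage (r.map f)))
    have : Epi ((PresheafOfModules.toPresheaf.{u} R.obj).map e) := inferInstance
    exact Functor.map_epi (presheafToSheaf J AddCommGrpCat.{u}) _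
  have h6 : T.map f = T.map (ε.inv.app M) ≫ (T.map (a.map e) ≫ T.map (a.map m)) ≫
      T.map (ε.hom.app N) := by
    rw [← T.map_comp, hem, hf]
    simp only [← T.map_comp]
    simp
  change Epi (T.map f)
  rw [h6]
  infer_instance

lemma isLocallySurjective_of_epi {C : Type u} [SmallCategory C] {J : GrothendieckTopology C}
    {R : Sheaf J RingCat.{u}} {M N : SheafOfModules.{u} R} (f : M ⟶ N) [hf : Epi f] :
    Presheaf.IsLocallySurjective J ((SheafOfModules.toSheaf R).map f).hom := by
  have := epi_toSheaf_map f
  exact (Sheaf.isLocallySurjective_iff_epi' _ ((SheafOfModules.toSheaf R).map f)).2 inferInstance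


lemma unitHomEquiv_symm_app_apply {C : Type u} [SmallCategory C] {J : GrothendieckTopology C}
    {R : Sheaf J RingCat.{u}} {M : SheafOfModules.{u} R} (m : M.sections) (W : Cᵒᵖ)
    (r : R.obj.obj W) (mW : M.val.obj W) (hm : mW = m.val W) :
    ((M.unitHomEquiv.symm m).val.app W).hom r = r • mW := by
  have h1 : ((M.unitHomEquiv.symm m).val.app W).hom (1 : R.obj.obj W) = mW := by
    rw [hm]
    conv_rhs => rw [← M.unitHomEquiv.apply_symm_apply m]
    rfl
  have h2 := ((M.unitHomEquiv.symm m).val.app W).hom.map_smul r (1 : R.obj.obj W)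
  rw [h1] at h2
  rw [← h2]
  exact congrArg _ (mul_one r).symm

lemma exists_sum_of_generatingSections {C : Type u} [SmallCategory C] {J : GrothendieckTopology C}
    {R : Sheaf J RingCat.{u}} {M : SheafOfModules.{u} R} (σ : M.GeneratingSections) [Fintype σ.I]
    (V : C) (s : M.val.obj (op V)) :
    ∃ S ∈ J V, ∀ ⦃W : C⦄ (f : W ⟶ V), S f → ∀ m : σ.I → M.val.obj (op W),
      (∀ i, m i = (σ.s i).val (op W)) → ∃ r : σ.I → R.obj.obj (op W),
        M.val.presheaf.map f.op s = ∑ i, r i • m i := by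
  classical
  have hsurj := isLocallySurjective_of_epi σ.π
  refine ⟨_, Presheaf.imageSieve_mem J ((SheafOfModules.toSheaf R).map σ.π).hom s, ?_⟩
  rintro W f ⟨t, ht⟩ m hm
  let pr (i : σ.I) : SheafOfModules.free (R := R) σ.I ⟶ SheafOfModules.unit R :=
    Cofan.IsColimit.desc (SheafOfModules.isColimitFreeCofan σ.I)
      (fun j => if j = i then 𝟙 _ else 0)
  have hpr (i j : σ.I) : SheafOfModules.ιFree (R := R) j ≫ pr i = if j = i then 𝟙 _ else 0 :=
    Cofan.IsColimit.fac (SheafOfModules.isColimitFreeCofan σ.I) _ j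
  have hid : 𝟙 (SheafOfModules.free (R := R) σ.I) =
      ∑ i, pr i ≫ SheafOfModules.ιFree (R := R) i := by
    refine Cofan.IsColimit.hom_ext (SheafOfModules.isColimitFreeCofan σ.I) _ _ (fun j => ?_)
    change SheafOfModules.ιFree j ≫ _ = SheafOfModules.ιFree j ≫ _
    rw [Preadditive.comp_sum, Finset.sum_eq_single j]
    · rw [← Category.assoc, hpr, if_pos rfl, Category.id_comp, Category.comp_id]
    · intro b _ hb
      rw [← Category.assoc, hpr, if_neg hb.symm, zero_comp]
    · simp
  have hπ : σ.π = ∑ i, pr i ≫ M.unitHomEquiv.symm (σ.s i) := by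
    rw [← Category.id_comp σ.π, hid, Preadditive.sum_comp]
    refine Finset.sum_congr rfl (fun i _ => ?_)
    rw [Category.assoc]
    congr 1
    apply M.unitHomEquiv.injective
    rw [Equiv.apply_symm_apply]
    exact congrFun (M.freeHomEquiv.apply_symm_apply σ.s) i
  refine ⟨fun i => ((pr i).val.app (op W)).hom t, ?_⟩
  let ev : (SheafOfModules.free (R := R) σ.I ⟶ M) →+ M.val.obj (op W) :=
    { toFun := fun g => (g.val.app (op W)).hom t
      map_zero' := rfl
      map_add' := fun _ _ => rfl }
  have h2 : ev σ.π = M.val.presheaf.map f.op s := ht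
  rw [← h2, hπ, map_sum]
  exact Finset.sum_congr rfl (fun i _ => unitHomEquiv_symm_app_apply _ _ _ _ (hm i))

lemma exists_sum_of_generatingSections_over {C : Type u} [SmallCategory C]
    {J : GrothendieckTopology C} {R : Sheaf J RingCat.{u}} (M : SheafOfModules.{u} R) (U : C)
    (σ : (M.over U).GeneratingSections) [Fintype σ.I] :
    ∃ g : σ.I → M.val.obj (op U), ∀ (V : C) (p : V ⟶ U) (s : M.val.obj (op V)),
      ∃ S ∈ J V, ∀ ⦃W : C⦄ (f : W ⟶ V), S f → ∃ r : σ.I → R.obj.obj (op W),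
        M.val.presheaf.map f.op s =
          ∑ i, r i • (M.val.presheaf.map (f ≫ p).op (g i) : M.val.obj (op W)) := by
  refine ⟨fun i => (σ.s i).val (op (Over.mk (𝟙 U))), fun V p s => ?_⟩
  obtain ⟨S, hS, h⟩ := exists_sum_of_generatingSections σ (Over.mk p) s
  rw [GrothendieckTopology.mem_over_iff] at hS
  refine ⟨_, hS, fun W f hf => ?_⟩
  rw [Sieve.overEquiv_iff] at hf
  exact h _ hf _ (fun j => (σ.s j).property
    (Over.homMk (f ≫ p) : Over.mk (f ≫ p) ⟶ Over.mk (𝟙 U)).op)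

lemma exists_sum_of_isFiniteType {T : Type u} [TopologicalSpace T]
    {R : Sheaf (Opens.grothendieckTopology T) RingCat.{u}} (M : SheafOfModules.{u} R)
    (hM : M.IsFiniteType) (x : T) :
    ∃ (U : Opens T) (_ : x ∈ U) (ι : Type u) (_ : Fintype ι) (g : ι → M.val.obj (op U)),
      ∀ (V : Opens T) (p : V ⟶ U) (s : M.val.obj (op V)), x ∈ V →
        ∃ (W : Opens T) (f : W ⟶ V) (_ : x ∈ W) (r : ι → R.obj.obj (op W)),
          M.val.presheaf.map f.op s =
            ∑ i, r i • (M.val.presheaf.map (f ≫ p).op (g i) : M.val.obj (op W)) := by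
  obtain ⟨⟨I, Y, hY, gen⟩, ⟨hgen⟩⟩ := hM.exists_localGeneratorsData
  obtain ⟨i, hi⟩ := ((Opens.coversTop_iff _ _).1 hY).exists_mem x
  have h1 : (gen i).IsFiniteType := hgen i
  have h2 : Finite (gen i).I := h1.finite
  have h3 : Fintype (gen i).I := Fintype.ofFinite _
  clear hgen hY hM h1 h2
  generalize gen i = σ at h3
  generalize Y i = U at σ hi
  obtain ⟨g, hg⟩ := exists_sum_of_generatingSections_over M U σ
  refine ⟨U, hi, σ.I, h3, g, fun V p s hxV => ?_⟩
  obtain ⟨S, hS, h⟩ := hg V p s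
  obtain ⟨W, f, hf, hxW⟩ := hS x hxV
  obtain ⟨r, hr⟩ := h f hf
  exact ⟨W, f, hxW, r, hr⟩

section Stalks

variable {X : Scheme.{u}}

/-- The stalk `M_x` of an `𝒪_X`-module is a module over the local ring `𝒪_{X,x}`. -/
noncomputable instance stalkModule (M : X.Modules) (x : X) :
    Module (X.presheaf.stalk x) (M.presheaf.stalk x) :=
  let M' : PresheafOfModules (X.presheaf ⋙ forget₂ CommRingCat RingCat) := M.val
  inferInstanceAs (Module (X.presheaf.stalk x) (TopCat.Presheaf.stalk (C := Ab.{u}) (X := X.carrier) M'.presheaf x))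

lemma germ_smul (M : X.Modules) (x : X) (U : X.Opens) (hx : x ∈ U) (r : Γ(X, U)) (m : Γ(M, U)) :
    M.presheaf.germ U x hx (r • m) = X.presheaf.germ U x hx r • M.presheaf.germ U x hx m :=
  PresheafOfModules.germ_smul (R := X.presheaf) M.val x U hx r m

/-- The `𝒪_{X,x}`-linear map on stalks induced by a morphism of `𝒪_X`-modules. -/
noncomputable def stalkMap {M N : X.Modules} (f : M ⟶ N) (x : X) :
    M.presheaf.stalk x →ₗ[X.presheaf.stalk x] N.presheaf.stalk x where
  toFun := (TopCat.Presheaf.stalkFunctor Ab.{u} x).map f.mapPresheaf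
  map_add' := map_add _
  map_smul' r m := by
    obtain ⟨U, hU, r, rfl⟩ := X.presheaf.exists_germ_eq r
    obtain ⟨V, hVU, hV, m, rfl⟩ := M.presheaf.exists_le_germ_eq m hU
    rw [← X.presheaf.germ_res_apply (homOfLE hVU) x hV r]
    dsimp only [RingHom.id_apply]
    erw [← germ_smul, TopCat.Presheaf.stalkFunctor_map_germ_apply,
      TopCat.Presheaf.stalkFunctor_map_germ_apply]
    rw [← germ_smul]
    congr 1
    exact f.app_smul _ _

lemma stalkMap_apply {M N : X.Modules} (f : M ⟶ N) (x : X) (m : M.presheaf.stalk x) :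
    stalkMap f x m = (TopCat.Presheaf.stalkFunctor Ab.{u} x).map f.mapPresheaf m := rfl

lemma stalkMap_id (M : X.Modules) (x : X) : stalkMap (𝟙 M) x = LinearMap.id := by
  ext m
  have : (𝟙 M : M ⟶ M).mapPresheaf = 𝟙 M.presheaf := (Scheme.Modules.toPresheaf X).map_id M
  rw [stalkMap_apply, this, CategoryTheory.Functor.map_id]
  rfl

lemma stalkMap_comp {M N K : X.Modules} (f : M ⟶ N) (g : N ⟶ K) (x : X) :
    stalkMap (f ≫ g) x = stalkMap g x ∘ₗ stalkMap f x := by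
  ext m
  have : (f ≫ g).mapPresheaf = f.mapPresheaf ≫ g.mapPresheaf :=
    (Scheme.Modules.toPresheaf X).map_comp f g
  rw [stalkMap_apply, this, CategoryTheory.Functor.map_comp]
  rfl

lemma stalkMap_surjective {M N : X.Modules} (f : M ⟶ N) [Epi f] (x : X) :
    Function.Surjective (stalkMap f x) := by
  have h : TopCat.Presheaf.IsLocallySurjective f.mapPresheaf :=
    isLocallySurjective_of_epi (R := X.ringCatSheaf) (M := M) (N := N) (f := f) (hf := ‹Epi f›)
  exact (TopCat.Presheaf.locally_surjective_iff_surjective_on_stalks _).1 h x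

/-- The underlying sheaf of abelian groups of an `𝒪_X`-module. -/
noncomputable def toAbSheaf (X : Scheme.{u}) : X.Modules ⥤ TopCat.Sheaf Ab.{u} X.carrier :=
  SheafOfModules.toSheaf X.ringCatSheaf

/-- The stalk at `x` as a functor to abelian groups. -/
noncomputable def stalkAb (x : X) : X.Modules ⥤ Ab.{u} :=
  toAbSheaf X ⋙ (TopCat.Sheaf.forget Ab.{u} X.carrier ⋙ TopCat.Presheaf.stalkFunctor Ab.{u} x)

lemma preservesFiniteLimits_stalkAb (x : X) : PreservesFiniteLimits (stalkAb x) := by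
  have h1 : PreservesFiniteLimits (toAbSheaf X) :=
    inferInstanceAs (PreservesFiniteLimits (SheafOfModules.toSheaf X.ringCatSheaf))
  exact comp_preservesFiniteLimits _ _

lemma stalkMap_exact (S : ShortComplex X.Modules) (hS : S.ShortExact) (x : X) :
    Function.Injective (stalkMap S.f x) ∧ Function.Exact (stalkMap S.f x) (stalkMap S.g x) ∧
      Function.Surjective (stalkMap S.g x) := by
  have := hS.epi_g
  have h2 := preservesFiniteLimits_stalkAb x
  have h3 : (stalkAb x).Additive :=
    have := preservesBinaryBiproducts_of_preservesBinaryProducts (stalkAb x)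
    Functor.additive_of_preservesBinaryBiproducts _
  have h4 : PreservesFiniteLimits (stalkAb x) → ∀ S : ShortComplex X.Modules, S.ShortExact →
      (S.map (stalkAb x)).Exact ∧ Mono ((stalkAb x).map S.f) :=
    ((stalkAb x).preservesFiniteLimits_tfae.out 3 0).1
  obtain ⟨he, hm⟩ := h4 h2 S hS
  exact ⟨(AddCommGrpCat.mono_iff_injective _).1 hm,
    (ShortComplex.ab_exact_iff_function_exact _).1 he, stalkMap_surjective S.g x⟩

lemma finite_stalk_of_sections (M : X.Modules) (x : X) (U : X.Opens) (hx : x ∈ U)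
    {ι : Type u} [Fintype ι] (g : ι → Γ(M, U))
    (h : ∀ (V : X.Opens) (p : V ⟶ U) (s : Γ(M, V)), x ∈ V → ∃ (W : X.Opens) (f : W ⟶ V)
      (_ : x ∈ W) (r : ι → Γ(X, W)),
        M.presheaf.map f.op s = ∑ i, r i • M.presheaf.map (f ≫ p).op (g i)) :
    Module.Finite (X.presheaf.stalk x) (M.presheaf.stalk x) := by
  refine ⟨Submodule.fg_def.2 ⟨Set.range (fun j => M.presheaf.germ U x hx (g j)),
    Set.finite_range _, ?_⟩⟩
  rw [eq_top_iff]
  rintro m -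
  obtain ⟨V, hVU, hxV, s, rfl⟩ := M.presheaf.exists_le_germ_eq m hx
  obtain ⟨W, f, hxW, r, hr⟩ := h V (homOfLE hVU) s hxV
  have h3 : M.presheaf.germ V x hxV s =
      ∑ j, X.presheaf.germ W x hxW (r j) • M.presheaf.germ U x hx (g j) := by
    rw [← M.presheaf.germ_res_apply f x hxW s, hr, map_sum]
    refine Finset.sum_congr rfl (fun j _ => ?_)
    rw [germ_smul]
    congr 1
    exact M.presheaf.germ_res_apply (f ≫ homOfLE hVU) x hxW (g j)
  rw [h3]
  exact Submodule.sum_mem _ (fun j _ => Submodule.smul_mem _ _ (Submodule.subset_span ⟨j, rfl⟩))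

lemma finite_stalk (M : X.Modules) (hM : SheafOfModules.IsFiniteType.{u} (R := X.ringCatSheaf) M)
    (x : X) : Module.Finite (X.presheaf.stalk x) (M.presheaf.stalk x) := by
  obtain ⟨U, hx, ι, _, g, h⟩ := exists_sum_of_isFiniteType (R := X.ringCatSheaf) M hM x
  exact finite_stalk_of_sections M x U hx g h

end Stalks


section GrothendieckGroup

variable {C : Type*} [Category* C] [Preadditive C]

/-- The subgroup of the free abelian group on the objects satisfying `P` generated by all
`[B] - [A] - [D]`, for `0 ⟶ A ⟶ B ⟶ D ⟶ 0` a short exact sequence in the ambient category whose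
three terms satisfy `P`. -/
def K0Relations (P : ObjectProperty C) : AddSubgroup (FreeAbelianGroup P.FullSubcategory) :=
  AddSubgroup.closure {z | ∃ (S : ShortComplex C) (_ : S.ShortExact) (h₁ : P S.X₁) (h₂ : P S.X₂)
    (h₃ : P S.X₃), z = FreeAbelianGroup.of ⟨S.X₂, h₂⟩ - FreeAbelianGroup.of ⟨S.X₁, h₁⟩ -
      FreeAbelianGroup.of ⟨S.X₃, h₃⟩}

/-- The Grothendieck group of the full subcategory of objects satisfying `P`, with respect to the
short exact sequences of the ambient category whose terms satisfy `P`. -/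
def K0 (P : ObjectProperty C) : Type _ :=
  FreeAbelianGroup P.FullSubcategory ⧸ K0Relations P

noncomputable instance (P : ObjectProperty C) : AddCommGroup (K0 P) :=
  inferInstanceAs (AddCommGroup (FreeAbelianGroup P.FullSubcategory ⧸ K0Relations P))

/-- The class `[A]` in the Grothendieck group. -/
def K0.of {P : ObjectProperty C} (A : C) (hA : P A) : K0 P :=
  QuotientAddGroup.mk (FreeAbelianGroup.of ⟨A, hA⟩)

/-- The homomorphism of Grothendieck groups `[A] ↦ [F A]` induced by a functor `F` which maps
objects satisfying `P` to objects satisfying `Q`, and which is exact. -/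
noncomputable def K0.map {D : Type*} [Category* D] [Preadditive D] {P : ObjectProperty C}
    {Q : ObjectProperty D}
    (F : C ⥤ D) [F.PreservesZeroMorphisms] (hF : ∀ A, P A → Q (F.obj A))
    (hex : ∀ S : ShortComplex C, S.ShortExact → (S.map F).ShortExact) : K0 P →+ K0 Q :=
  QuotientAddGroup.lift (K0Relations P)
    (FreeAbelianGroup.lift (fun A => K0.of (F.obj A.obj) (hF A.obj A.property))) <| by
      rw [K0Relations, AddSubgroup.closure_le]
      rintro _ ⟨S, hS, h₁, h₂, h₃, rfl⟩
      rw [SetLike.mem_coe, AddMonoidHom.mem_ker, map_sub, map_sub, FreeAbelianGroup.lift_apply_of,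
        FreeAbelianGroup.lift_apply_of, FreeAbelianGroup.lift_apply_of]
      refine (QuotientAddGroup.eq_zero_iff _).2 (AddSubgroup.subset_closure ?_)
      exact ⟨S.map F, hex S hS, hF _ h₁, hF _ h₂, hF _ h₃, rfl⟩

lemma K0.map_of {D : Type*} [Category* D] [Preadditive D] {P : ObjectProperty C}
    {Q : ObjectProperty D} (F : C ⥤ D) [F.PreservesZeroMorphisms] (hF : ∀ A, P A → Q (F.obj A))
    (hex : ∀ S : ShortComplex C, S.ShortExact → (S.map F).ShortExact) (A : C) (hA : P A) :
    K0.map F hF hex (K0.of A hA) = K0.of (F.obj A) (hF A hA) :=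
  FreeAbelianGroup.lift_apply_of _ _

end GrothendieckGroup

section GroupRingModules

variable (X : Scheme.{u}) (G : Type u) [Group G]

/-- The category of `𝒪_X G`-modules: `𝒪_X`-modules with an action of `G` by
`𝒪_X`-homomorphisms. -/
abbrev GModules := Action X.Modules G

variable {X G}

/-- The action of `G` on the stalk at `x` of an `𝒪_X G`-module. -/
noncomputable def stalkRep (P : GModules X G) (x : X) :
    Representation (X.presheaf.stalk x) G (P.V.presheaf.stalk x) where
  toFun g := stalkMap (P.ρ g) x
  map_one' := by
    rw [map_one]
    exact stalkMap_id _ x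
  map_mul' g h := by
    rw [map_mul]
    exact stalkMap_comp _ _ x

/-- The group ring `𝒪_{X,x} G`. -/
abbrev StalkGroupRing (X : Scheme.{u}) (G : Type u) (x : X) : Type u :=
  MonoidAlgebra (X.presheaf.stalk x) G

lemma stalkMap_comm {P Q : GModules X G} (f : P ⟶ Q) (x : X) (g : G) (m : P.V.presheaf.stalk x) :
    stalkMap f.hom x (stalkRep P x g m) = stalkRep Q x g (stalkMap f.hom x m) := by
  have h := congrArg (fun φ => stalkMap φ x m) (f.comm g)
  simp only [stalkMap_comp] at h
  exact h

/-- The `𝒪_{X,x} G`-linear map on stalks induced by a morphism of `𝒪_X G`-modules. -/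
noncomputable def stalkGMap {P Q : GModules X G} (f : P ⟶ Q) (x : X) :
    (stalkRep P x).asModule →ₗ[StalkGroupRing X G x] (stalkRep Q x).asModule where
  toFun m := (stalkRep Q x).asModuleEquiv.symm
    (stalkMap f.hom x ((stalkRep P x).asModuleEquiv m))
  map_add' a b := by simp
  map_smul' r m := by
    induction r using MonoidAlgebra.induction_linear with
    | zero => simp
    | add r s hr hs =>
      simp only [RingHom.id_apply] at hr hs ⊢
      simp only [add_smul, map_add, hr, hs]
    | single g t =>
      apply (stalkRep Q x).asModuleEquiv.injective
      simp only [RingHom.id_apply, Representation.asModuleEquiv_map_smul,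
        Representation.asAlgebraHom_single, LinearMap.smul_apply, map_smul,
        LinearEquiv.apply_symm_apply, stalkMap_comm]

/-- The functor mapping an `𝒪_X G`-module to its stalk at `x`, an `𝒪_{X,x} G`-module. -/
noncomputable def stalkGFunctor (x : X) :
    GModules X G ⥤ ModuleCat.{u} (StalkGroupRing X G x) where
  obj P := ModuleCat.of _ (stalkRep P x).asModule
  map f := ModuleCat.ofHom (stalkGMap f x)
  map_id P := by
    ext m
    exact LinearMap.congr_fun (stalkMap_id P.V x) m
  map_comp f g := by
    ext m
    exact LinearMap.congr_fun (stalkMap_comp f.hom g.hom x) m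

instance (x : X) : (stalkGFunctor (G := G) x).PreservesZeroMorphisms where
  map_zero P Q := by
    ext m
    have h : stalkMap (0 : P.V ⟶ Q.V) x = 0 := by
      ext t
      obtain ⟨U, hU, s, rfl⟩ := P.V.presheaf.exists_germ_eq t
      rw [stalkMap_apply, TopCat.Presheaf.stalkFunctor_map_germ_apply]
      exact map_zero (Q.V.presheaf.germ U x hU).hom
    exact LinearMap.congr_fun h m

lemma stalkGFunctor_shortExact (x : X) (S : ShortComplex (GModules X G)) (hS : S.ShortExact) :
    (S.map (stalkGFunctor x)).ShortExact := by
  have hS' : (S.map (Action.forget X.Modules G)).ShortExact := hS.map_of_exact _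
  obtain ⟨h1, h2, h3⟩ := stalkMap_exact _ hS' x
  exact ModuleCat.shortComplex_shortExact _ h2 h1 h3

/-- Coherent modules on a locally Noetherian scheme: quasi-coherent and of finite type. -/
def IsCoherent (M : X.Modules) : Prop :=
  SheafOfModules.IsQuasicoherent.{u} (R := X.ringCatSheaf) M ∧
    SheafOfModules.IsFiniteType.{u} (R := X.ringCatSheaf) M

variable (X G)

/-- The coherent `𝒪_X G`-modules which are locally projective over `𝒪_X G`. -/
def locallyProjective : ObjectProperty (GModules X G) := fun P =>
  IsCoherent P.V ∧ ∀ x : X, Module.Projective (StalkGroupRing X G x) ((stalkGFunctor x).obj P)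

/-- The coherent `𝒪_X G`-modules which are locally free over `𝒪_X G`. -/
def locallyFree : ObjectProperty (GModules X G) := fun P =>
  IsCoherent P.V ∧ ∀ x : X, Module.Free (StalkGroupRing X G x) ((stalkGFunctor x).obj P)

/-- The finitely generated projective modules over a ring. -/
def fgProjective (R : Type u) [Ring R] : ObjectProperty (ModuleCat.{u} R) := fun M =>
  Module.Finite R M ∧ Module.Projective R M

/-- The finitely generated free modules over a ring. -/
def fgFree (R : Type u) [Ring R] : ObjectProperty (ModuleCat.{u} R) := fun M =>
  Module.Finite R M ∧ Module.Free R M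

variable {X G}

lemma finite_stalkG (P : GModules X G) (hP : IsCoherent P.V) (x : X) :
    Module.Finite (StalkGroupRing X G x) ((stalkGFunctor x).obj P) := by
  have := finite_stalk P.V hP.2 x
  exact Module.Finite.of_restrictScalars_finite (X.presheaf.stalk x) (StalkGroupRing X G x)
    (stalkRep P x).asModule

lemma locallyProjective_of_locallyFree (P : GModules X G) (hP : locallyFree X G P) :
    locallyProjective X G P :=
  ⟨hP.1, fun x => have := hP.2 x; Module.Projective.of_free⟩

variable (X G)

/-- The canonical homomorphism `K₀^lf(𝒪_X G) ⟶ K₀(𝒪_X G)`, `[P] ↦ [P]`. -/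
noncomputable def lfToK0 : K0 (locallyFree X G) →+ K0 (locallyProjective X G) :=
  K0.map (𝟭 _) locallyProjective_of_locallyFree (fun _ hS => hS)

variable [IrreducibleSpace X]

/-- The group ring `F G` over the function field `F` of `X`, i.e. the stalk of `𝒪_X` at the generic
point. -/
abbrev FunctionFieldGroupRing : Type u := MonoidAlgebra X.functionField G

/-- The canonical homomorphism `K₀(𝒪_X G) ⟶ K₀(F G)` which maps `[P]` to the class of the stalk of
`P` at the generic point. -/
noncomputable def K0ToFunctionField :
    K0 (locallyProjective X G) →+ K0 (fgProjective (FunctionFieldGroupRing X G)) :=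
  K0.map (stalkGFunctor (genericPoint X))
    (fun P hP => ⟨finite_stalkG P hP.1 _, hP.2 _⟩) (stalkGFunctor_shortExact _)

/-- The canonical homomorphism `K₀^lf(𝒪_X G) ⟶ K₀^lf(F G)` which maps `[P]` to the class of the
stalk of `P` at the generic point. -/
noncomputable def lfToFunctionField :
    K0 (locallyFree X G) →+ K0 (fgFree (FunctionFieldGroupRing X G)) :=
  K0.map (stalkGFunctor (genericPoint X))
    (fun P hP => ⟨finite_stalkG P hP.1 _, hP.2 _⟩) (stalkGFunctor_shortExact _)

/-- The locally free classgroup `Cl(𝒪_X G)`. -/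
noncomputable def locallyFreeClassGroup : AddSubgroup (K0 (locallyFree X G)) :=
  (lfToFunctionField X G).ker

end GroupRingModules

/-- A Dedekind scheme: Noetherian, regular, irreducible and of dimension at most one. -/
class IsDedekindScheme (X : Scheme.{u}) : Prop where
  isNoetherian : IsNoetherian X
  irreducibleSpace : IrreducibleSpace X
  isRegularLocalRing_stalk : ∀ x : X, IsRegularLocalRing (X.presheaf.stalk x)
  topologicalKrullDim_le_one : topologicalKrullDim X ≤ 1

attribute [instance] IsDedekindScheme.irreducibleSpace

end GaloisModule

open GaloisModule

/-! Injectivity is a cofinality argument. A locally projective `A` is a quotient of the module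
induced from its underlying `𝒪_X`-module, and that induced module is locally free. The kernel `B` is
again locally projective, and because the sequence splits on every stalk, `A ⊞ B` is locally free
(`exists_locallyFree_biprod`). By Heller's description of equality in a Grothendieck group
(`K0.exists_of_eq`), an identity between classes of locally free modules is witnessed by two
extensions with common ends. Adding complements of the ends moves the witness into the locally free
modules (`K0.map_id_injective`). So `lfToK0` is injective on all of `K₀^lf`.

For surjectivity, a class which vanishes generically is written `[M] - [L]` with `L` locally free.
Cancellation over the finite dimensional algebra `FG` turns the equality of generic classes into an
isomorphism of generic stalks (`nonempty_linearEquiv_of_K0_eq`). Swan's theorem then gives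
isomorphisms of the stalks of `M` and `L` at every point, so `M` is locally free, and `[M] - [L]`
already lives in the classgroup.

Swan's theorem (`nonempty_linearEquiv_of_commensurable`) carries the weight. Over a local principal
ideal domain `R`, a finitely generated projective `RG`-module `P` is determined by the lengths of
`Hom_{RG}(P, S)`, with `S` finite over `R` and killed by the maximal ideal. This module is the
invariant part of `W = Hom_R(P, S)`, and projectivity of `P` makes the identity of `W` a trace
(`HasTraceOne`). Let the residue characteristic `p` divide `|G|`. Three facts reduce the length of
the invariants to data that depend only on the generic module: (1) Artin induction gives an
isomorphism of rational permutation modules. Their integral forms are commensurable, and maps into a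
`W` with trace one and killed by `p` do not distinguish commensurable lattices
(`equivariantLength_eq`). Hence the length of the `G`-invariants is determined by those of cyclic
subgroups. (2) If `p ^ n` divides the order of `σ`, the invariants of `σ ^ p ^ n` are `p ^ n` times
as long as those of `σ`, so cyclic subgroups of order prime to `p` suffice. (3) For these the order
is invertible in `R`, and the commensurability argument applies to the lattices `P` and `Q`
themselves.

On the geometric side, coherent modules with free stalks are handled through local bases
(`HasLocalBases`), which spread from a point to a neighbourhood and exhibit each stalk as a lattice
in the generic stalk. -/

namespace GaloisModule

/-! ### Reductions of commensurable lattices have the same additive invariants. -/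

section ReductionInvariance

universe v
variable {R : Type*} [CommRing R] {A : Type*} [Ring A] [Algebra R A]

/-- A function on modules over an `R`-algebra `A`, with values in `ℕ∞`, which is invariant under
isomorphisms, and additive on the short exact sequences of modules killed by `π : R`. -/
structure IsAdditiveInvariant (A : Type*) [Ring A] [Algebra R A] (π : R)
    (ψ : ∀ (M : Type v) [AddCommGroup M] [Module R M] [Module A M] [IsScalarTower R A M], ℕ∞) :
    Prop where
  congr : ∀ (M N : Type v) [AddCommGroup M] [Module R M] [Module A M] [IsScalarTower R A M]
    [AddCommGroup N] [Module R N] [Module A N] [IsScalarTower R A N], (M ≃ₗ[A] N) → ψ M = ψ N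
  add : ∀ (M N K : Type v) [AddCommGroup M] [Module R M] [Module A M] [IsScalarTower R A M]
    [AddCommGroup N] [Module R N] [Module A N] [IsScalarTower R A N]
    [AddCommGroup K] [Module R K] [Module A K] [IsScalarTower R A K]
    (f : M →ₗ[A] N) (g : N →ₗ[A] K), (∀ n : N, π • n = 0) → Function.Injective f →
    Function.Exact f g → Function.Surjective g → ψ N = ψ M + ψ K

variable {M N : Type v} [AddCommGroup M] [Module R M] [Module A M] [IsScalarTower R A M]
  [AddCommGroup N] [Module R N] [Module A N] [IsScalarTower R A N]

variable (A M) in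
/-- Multiplication by `π : R`, as an `A`-linear endomorphism. -/
def smulHom (π : R) : M →ₗ[A] M where
  toFun m := π • m
  map_add' := smul_add π
  map_smul' a m := by
    rw [RingHom.id_apply, ← algebraMap_smul A π m, ← algebraMap_smul A π (a • m), smul_smul,
      smul_smul, Algebra.commutes]

@[simp]
lemma smulHom_apply (π : R) (m : M) : smulHom A M π m = π • m := rfl

variable (A M) in
/-- The reduction `M / π M`. -/
abbrev Reduction (π : R) : Type v := M ⧸ LinearMap.range (smulHom A M π)

lemma Reduction.smul_eq_zero (π : R) (x : Reduction A M π) : π • x = 0 := by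
  obtain ⟨m, rfl⟩ := Submodule.Quotient.mk_surjective _ x
  rw [← Submodule.Quotient.mk_smul, Submodule.Quotient.mk_eq_zero]
  exact ⟨m, rfl⟩

/-- The map on reductions induced by a linear map. -/
def Reduction.map (π : R) (f : M →ₗ[A] N) : Reduction A M π →ₗ[A] Reduction A N π :=
  Submodule.mapQ _ _ f <| by
    rintro _ ⟨m, rfl⟩
    refine ⟨f m, ?_⟩
    rw [smulHom_apply, smulHom_apply, ← algebraMap_smul A π m, map_smul, algebraMap_smul]

@[simp]
lemma Reduction.map_mk (π : R) (f : M →ₗ[A] N) (m : M) :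
    Reduction.map π f (Submodule.Quotient.mk m) = Submodule.Quotient.mk (f m) := rfl

variable {ψ : ∀ (M : Type v) [AddCommGroup M] [Module R M] [Module A M] [IsScalarTower R A M], ℕ∞}
  {π : R}

lemma IsAdditiveInvariant.ker_add_range (hψ : IsAdditiveInvariant A π ψ) (f : M →ₗ[A] N)
    (hM : ∀ m : M, π • m = 0) :
    ψ M = ψ (LinearMap.ker f) + ψ (LinearMap.range f) :=
  hψ.add _ _ _ (LinearMap.ker f).subtype f.rangeRestrict hM (Submodule.subtype_injective _)
    (by
      intro m
      rw [← LinearMap.mem_ker, LinearMap.ker_rangeRestrict]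
      simp) f.surjective_rangeRestrict

/-- After reduction modulo `π` the maps induced by `i` and `j` form an exact circle: the kernel of
each is the range of the other. Additivity then writes both values as the sum of the same two terms,
in opposite order. -/
lemma IsAdditiveInvariant.reduction_eq_of_factorization (hψ : IsAdditiveInvariant A π ψ)
    (i : N →ₗ[A] M) (j : M →ₗ[A] N) (hij : ∀ m, i (j m) = π • m) (hji : ∀ n, j (i n) = π • n)
    (hi : Function.Injective i) (hj : Function.Injective j) :
    ψ (Reduction A N π) = ψ (Reduction A M π) := by
  have key : ∀ {M N : Type v} [AddCommGroup M] [Module R M] [Module A M] [IsScalarTower R A M]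
      [AddCommGroup N] [Module R N] [Module A N] [IsScalarTower R A N]
      (i : N →ₗ[A] M) (j : M →ₗ[A] N) (_ : ∀ m, i (j m) = π • m) (_ : ∀ n, j (i n) = π • n)
      (_ : Function.Injective j),
      LinearMap.ker (Reduction.map π j) = LinearMap.range (Reduction.map π i) := by
    intro M N _ _ _ _ _ _ _ _ i j hij hji hj
    ext x
    obtain ⟨m, rfl⟩ := Submodule.Quotient.mk_surjective _ x
    rw [LinearMap.mem_ker, Reduction.map_mk, Submodule.Quotient.mk_eq_zero]
    constructor
    · rintro ⟨n, hn⟩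
      refine ⟨Submodule.Quotient.mk n, ?_⟩
      rw [Reduction.map_mk]
      congr 1
      apply hj
      rw [hji, ← hn, smulHom_apply]
    · rintro ⟨y, hy⟩
      obtain ⟨n, rfl⟩ := Submodule.Quotient.mk_surjective _ y
      rw [Reduction.map_mk, Submodule.Quotient.eq] at hy
      obtain ⟨m', hm'⟩ := hy
      refine ⟨n - j m', ?_⟩
      have : m = i (n - j m') := by
        rw [map_sub, hij, ← smulHom_apply (A := A), hm', sub_sub_cancel]
      rw [this, hji, smulHom_apply]
  rw [hψ.ker_add_range (Reduction.map π i) (Reduction.smul_eq_zero π),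
    hψ.ker_add_range (Reduction.map π j) (Reduction.smul_eq_zero π), key i j hij hji hj,
    key j i hji hij hi, add_comm]

lemma exists_comp_eq_smul (i : N →ₗ[A] M) (hi : Function.Injective i) (d : R)
    (h : ∀ m : M, ∃ n, i n = d • m) :
    ∃ j : M →ₗ[A] N, (∀ m, i (j m) = d • m) ∧ ∀ n, j (i n) = d • n := by
  choose j hj using h
  refine ⟨⟨⟨j, fun a b => hi ?_⟩, fun a b => hi ?_⟩, hj, fun n => hi ?_⟩
  · rw [hj, map_add, hj, hj, smul_add]
  · rw [RingHom.id_apply, map_smul, hj, hj]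
    exact (smulHom A M d).map_smul a b
  · change i (j (i n)) = _
    rw [hj, ← algebraMap_smul A d n, map_smul, algebraMap_smul]

/-- Induction on the exponent through `M' = i(N) + πM`. It contains `πM`, so the factorization lemma
compares it with `M`, and `π ^ m` carries it into `i(N)`, so the induction hypothesis compares it
with `N`. -/
lemma IsAdditiveInvariant.reduction_eq_of_pow (hψ : IsAdditiveInvariant A π ψ) (m : ℕ) :
    ∀ {M N : Type v} [AddCommGroup M] [Module R M] [Module A M] [IsScalarTower R A M]
      [AddCommGroup N] [Module R N] [Module A N] [IsScalarTower R A N]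
      (_ : ∀ m : M, π • m = 0 → m = 0) (i : N →ₗ[A] M) (_ : Function.Injective i)
      (_ : ∀ x : M, ∃ n, i n = π ^ m • x), ψ (Reduction A N π) = ψ (Reduction A M π) := by
  induction m with
  | zero =>
    intro M N _ _ _ _ _ _ _ _ _ i hi h
    have hi' : Function.Bijective i := ⟨hi, fun x => by simpa using h x⟩
    let e := LinearEquiv.ofBijective i hi'
    refine hψ.congr _ _ (Submodule.Quotient.equiv _ _ e ?_)
    ext x
    constructor
    · rintro ⟨_, ⟨y, rfl⟩, rfl⟩
      refine ⟨e y, ?_⟩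
      rw [smulHom_apply, smulHom_apply, ← algebraMap_smul A π y]
      change _ = e _
      rw [map_smul, algebraMap_smul]
    · rintro ⟨y, rfl⟩
      refine ⟨π • e.symm y, ⟨_, rfl⟩, ?_⟩
      change e _ = _
      rw [← algebraMap_smul A π (e.symm y), map_smul, algebraMap_smul, e.apply_symm_apply,
        smulHom_apply]
  | succ m ih =>
    intro M N _ _ _ _ _ _ _ _ hM i hi h
    let M' : Submodule A M := LinearMap.range i ⊔ LinearMap.range (smulHom A M π)
    have hM' : ∀ m : M', π • m = 0 → m = 0 := fun m hm => by
      ext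
      exact hM m.1 (by simpa using congrArg Subtype.val hm)
    have hregN : ∀ n : N, π • n = 0 → n = 0 := fun n hn => by
      apply hi
      rw [map_zero]
      apply hM
      rw [← algebraMap_smul A π (i n), ← map_smul, algebraMap_smul, hn, map_zero]
    have e1 : ψ (Reduction A M' π) = ψ (Reduction A M π) := by
      obtain ⟨j, hj1, hj2⟩ := exists_comp_eq_smul M'.subtype (Submodule.subtype_injective _) π
        (fun x => ⟨⟨π • x, Submodule.mem_sup_right ⟨x, rfl⟩⟩, rfl⟩)
      refine hψ.reduction_eq_of_factorization M'.subtype j hj1 hj2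
        (Submodule.subtype_injective _) ((injective_iff_map_eq_zero j).2 fun x hx => hM x ?_)
      rw [← hj1, hx, map_zero]
    rw [← e1]
    let i' : N →ₗ[A] M' := i.codRestrict M' (fun n => Submodule.mem_sup_left ⟨n, rfl⟩)
    refine ih hM' i' (fun a b hab => hi (congrArg Subtype.val hab)) ?_
    rintro ⟨x, hx⟩
    obtain ⟨_, ⟨n, rfl⟩, _, ⟨y, rfl⟩, rfl⟩ := Submodule.mem_sup.1 hx
    obtain ⟨n', hn'⟩ := h y
    refine ⟨π ^ m • n + n', ?_⟩
    ext
    change i _ = π ^ m • (i n + π • y)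
    rw [map_add, hn', smul_add, smul_smul, pow_succ, ← algebraMap_smul A (π ^ m) n, map_smul,
      algebraMap_smul]

/-- Since `d` is invertible modulo `π`, the map `i` already induces an isomorphism of reductions. -/
lemma IsAdditiveInvariant.reduction_eq_of_isCoprime (hψ : IsAdditiveInvariant A π ψ)
    (d : R) (hd : IsCoprime d π) (i : N →ₗ[A] M)
    (hi : Function.Injective i)
    (h : ∀ x : M, ∃ n, i n = d • x) : ψ (Reduction A N π) = ψ (Reduction A M π) := by
  obtain ⟨j, hij, hji⟩ := exists_comp_eq_smul i hi d h
  obtain ⟨a, b, hab⟩ := hd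
  have hs : ∀ {K L : Type v} [AddCommGroup K] [Module R K] [Module A K] [IsScalarTower R A K]
      [AddCommGroup L] [Module R L] [Module A L] [IsScalarTower R A L] (f : K →ₗ[A] L) (r : R)
      (x : K), f (r • x) = r • f x := by
    intro K L _ _ _ _ _ _ _ _ f r x
    rw [← algebraMap_smul A r x, map_smul, algebraMap_smul]
  refine hψ.congr _ _ (LinearEquiv.ofBijective (Reduction.map π i) ⟨?_, ?_⟩)
  · rw [injective_iff_map_eq_zero]
    intro x hx
    obtain ⟨n, rfl⟩ := Submodule.Quotient.mk_surjective _ x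
    rw [Reduction.map_mk, Submodule.Quotient.mk_eq_zero] at hx
    obtain ⟨m, hm⟩ := hx
    rw [Submodule.Quotient.mk_eq_zero]
    refine ⟨a • j m + b • n, ?_⟩
    have h1 : d • n = π • j m := by
      rw [← hji, ← hm, smulHom_apply, hs]
    rw [smulHom_apply, smul_add, smul_comm, ← h1, smul_comm π b, ← smul_assoc, ← smul_assoc,
      ← add_smul, smul_eq_mul, smul_eq_mul, hab, one_smul]
  · intro x
    obtain ⟨m, rfl⟩ := Submodule.Quotient.mk_surjective _ x
    refine ⟨Submodule.Quotient.mk (a • j m), ?_⟩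
    rw [Reduction.map_mk, Submodule.Quotient.eq]
    refine ⟨- (b • m), ?_⟩
    rw [smulHom_apply, hs, hij]
    have : (a * d + b * π) • m = m := by rw [hab, one_smul]
    nth_rewrite 3 [← this]
    module

/-- An additive invariant takes the same value on the reductions modulo `π` of `M` and of a
submodule `N` such that `M / N` is killed by a product of a power of `π` and of an element
coprime to `π`. -/
lemma IsAdditiveInvariant.reduction_eq (hψ : IsAdditiveInvariant A π ψ)
    (m : ℕ) (d : R) (hd : IsCoprime d π) (hM : ∀ (x : M), π • x = 0 → x = 0)
    (i : N →ₗ[A] M) (hi : Function.Injective i)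
    (h : ∀ x : M, ∃ n, i n = (π ^ m * d) • x) : ψ (Reduction A N π) = ψ (Reduction A M π) := by
  -- This intermediate lattice separates the two parts of the index: `M / M'` is killed by `π ^ m`,
  -- and `M' / i(N)` by `d`.
  let M' : Submodule A M := LinearMap.range i ⊔ LinearMap.range (smulHom A M (π ^ m))
  have h1 : ψ (Reduction A M' π) = ψ (Reduction A M π) :=
    hψ.reduction_eq_of_pow m hM M'.subtype (Submodule.subtype_injective _)
      (fun x => ⟨⟨π ^ m • x, Submodule.mem_sup_right ⟨x, rfl⟩⟩, rfl⟩)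
  rw [← h1]
  let i' : N →ₗ[A] M' := i.codRestrict M' (fun n => Submodule.mem_sup_left ⟨n, rfl⟩)
  refine hψ.reduction_eq_of_isCoprime d hd i' (fun a b hab => hi (congrArg Subtype.val hab)) ?_
  · rintro ⟨x, hx⟩
    obtain ⟨_, ⟨n, rfl⟩, _, ⟨y, rfl⟩, rfl⟩ := Submodule.mem_sup.1 hx
    obtain ⟨n', hn'⟩ := h y
    refine ⟨d • n + n', ?_⟩
    ext
    change i _ = d • (i n + π ^ m • y)
    rw [map_add, hn', smul_add, smul_smul, mul_comm d, ← algebraMap_smul A d n, map_smul,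
      algebraMap_smul]

end ReductionInvariance


/-! ### Recognizing semisimple and projective modules by lengths of Hom. -/

section HomLengths

universe v
variable {R : Type*} [CommRing R] {A : Type*} [Ring A] [Algebra R A]

variable (R A) in
/-- The `R`-length of the module of `A`-linear maps. -/
noncomputable abbrev homLength (M N : Type*) [AddCommGroup M] [Module A M] [AddCommGroup N]
    [Module R N] [Module A N] [IsScalarTower R A N] : ℕ∞ := Module.length R (M →ₗ[A] N)

lemma length_linearMap_ne_top {M N : Type*} [AddCommGroup M] [Module R M]
    [AddCommGroup N] [Module R N] [Module.Finite R M] (hN : Module.length R N ≠ ⊤) :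
    Module.length R (M →ₗ[R] N) ≠ ⊤ := by
  obtain ⟨n, f, hf⟩ := Module.Finite.exists_fin' R M
  let e : (M →ₗ[R] N) →ₗ[R] (Fin n → N) :=
    LinearMap.pi fun i => LinearMap.applyₗ (f (Pi.single i 1))
  have he : Function.Injective e := by
    rw [injective_iff_map_eq_zero]
    intro φ hφ
    have : φ ∘ₗ f = 0 := by
      ext i
      exact congrFun hφ i
    ext m
    obtain ⟨x, rfl⟩ := hf m
    exact LinearMap.congr_fun this x
  refine ne_top_of_le_ne_top ?_ (Module.length_le_of_injective e he)
  rw [Module.length_pi]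
  exact WithTop.mul_ne_top (by rw [ENat.card_eq_coe_fintype_card]; exact ENat.natCast_ne_top _) hN

section

variable {M N S : Type*} [AddCommGroup M] [Module A M] [AddCommGroup N] [Module A N]
  [AddCommGroup S] [Module R S] [Module A S] [IsScalarTower R A S]

lemma homLength_ne_top [Module R M] [IsScalarTower R A M] [Module.Finite R M]
    (hS : Module.length R S ≠ ⊤) : homLength R A M S ≠ ⊤ := by
  refine ne_top_of_le_ne_top (length_linearMap_ne_top (M := M) hS)
    (Module.length_le_of_injective (LinearMap.restrictScalarsₗ R A M S R) ?_)
  exact LinearMap.restrictScalars_injective R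

lemma homLength_congr_left (e : M ≃ₗ[A] N) : homLength R A M S = homLength R A N S :=
  LinearEquiv.length_eq
    { toFun := fun f => f ∘ₗ e.symm.toLinearMap
      invFun := fun f => f ∘ₗ e.toLinearMap
      map_add' := fun _ _ => rfl
      map_smul' := fun _ _ => rfl
      left_inv := fun f => by ext; simp
      right_inv := fun f => by ext; simp }

lemma homLength_prod : homLength R A (M × N) S = homLength R A M S + homLength R A N S := by
  rw [homLength, ← (LinearMap.coprodEquiv R (R := A) (M := M) (M₂ := N) (M₃ := S)).length_eq,
    Module.length_prod]

lemma exists_ne_zero_of_isSemisimpleModule [IsSemisimpleModule A M] [Nontrivial M] :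
    ∃ (S : Submodule A M) (_ : IsSimpleModule A S) (f : M →ₗ[A] S), f ≠ 0 := by
  obtain ⟨S, hS⟩ := IsSemisimpleModule.exists_simple_submodule A M
  obtain ⟨K, hK⟩ := exists_isCompl S
  refine ⟨S, hS, S.projectionOnto K hK, fun h => ?_⟩
  have := IsSimpleModule.nontrivial A S
  obtain ⟨x, hx⟩ := exists_ne (0 : S)
  apply hx
  rw [← Submodule.projectionOnto_apply_left hK x, h, LinearMap.zero_apply]

omit [Module R S] [IsScalarTower R A S] [Algebra R A] in
lemma exists_equiv_prod_of_ne_zero [IsSemisimpleModule A M] [IsSimpleModule A S] (f : M →ₗ[A] S)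
    (hf : f ≠ 0) : ∃ K : Submodule A M, Nonempty (M ≃ₗ[A] S × K) := by
  have hs := f.surjective_or_eq_zero.resolve_right hf
  obtain ⟨K, hK⟩ := exists_isCompl (LinearMap.ker f)
  exact ⟨LinearMap.ker f, ⟨(Submodule.prodEquivOfIsCompl _ _ hK.symm).symm.trans
    (LinearEquiv.prodCongr ((Submodule.quotientEquivOfIsCompl _ _ hK).symm.trans
      (f.quotKerEquivOfSurjective hs)) (LinearEquiv.refl _ _))⟩⟩

end

/-- Semisimple modules of finite length are determined by the lengths of the modules of
homomorphisms to simple modules. -/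
lemma nonempty_linearEquiv_of_isSemisimpleModule (n : ℕ∞) (hn : n ≠ ⊤) :
    ∀ (M N : Type v) [AddCommGroup M] [Module R M] [Module A M] [IsScalarTower R A M]
      [AddCommGroup N] [Module R N] [Module A N] [IsScalarTower R A N] [IsSemisimpleModule A M]
      [IsSemisimpleModule A N] [IsNoetherian R M] [IsNoetherian R N]
      (_ : Module.length R M = n) (_ : Module.length R N ≠ ⊤)
      (_ : ∀ (S : Type v) [AddCommGroup S] [Module R S] [Module A S] [IsScalarTower R A S]
        [IsSimpleModule A S], Module.length R S ≠ ⊤ → homLength R A M S = homLength R A N S),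
      Nonempty (M ≃ₗ[A] N) := by
  lift n to ℕ using hn
  induction n using Nat.strong_induction_on with
  | _ n ih =>
  intro M N _ _ _ _ _ _ _ _ _ _ _ _ hM hN h
  rcases subsingleton_or_nontrivial M with hM0 | hM0
  · have : Subsingleton N := by
      by_contra hN0
      rw [not_subsingleton_iff_nontrivial] at hN0
      obtain ⟨S, hS, f, hf⟩ := exists_ne_zero_of_isSemisimpleModule (A := A) (M := N)
      have hS' : Module.length R S ≠ ⊤ :=
        ne_top_of_le_ne_top hN (Module.length_le_of_injective (S.subtype.restrictScalars R)
          (Submodule.subtype_injective _))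
      have h1 := h S hS'
      rw [homLength, homLength, Module.length_eq_zero_iff.2 inferInstance, eq_comm,
        Module.length_eq_zero_iff] at h1
      exact hf (Subsingleton.elim _ _)
    exact ⟨⟨0, 0, fun x => Subsingleton.elim _ _, fun x => Subsingleton.elim _ _⟩⟩
  · obtain ⟨S, hS, f, hf⟩ := exists_ne_zero_of_isSemisimpleModule (A := A) (M := M)
    have hMt : Module.length R M ≠ ⊤ := by simp [hM]
    have hS' : Module.length R S ≠ ⊤ :=
      ne_top_of_le_ne_top hMt (Module.length_le_of_injective (S.subtype.restrictScalars R)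
        (Submodule.subtype_injective _))
    obtain ⟨g, hg⟩ : ∃ g : N →ₗ[A] S, g ≠ 0 := by
      by_contra! hg
      have h1 := h S hS'
      have : Subsingleton (N →ₗ[A] S) := ⟨fun a b => by rw [hg a, hg b]⟩
      rw [homLength, homLength, Module.length_eq_zero (M := N →ₗ[A] S),
        Module.length_eq_zero_iff] at h1
      exact hf (Subsingleton.elim _ _)
    -- The same simple module splits off from `M` and from `N`. All Hom lengths drop by the same
    -- finite amount, so the induction hypothesis applies to the complements.
    obtain ⟨K, ⟨e⟩⟩ := exists_equiv_prod_of_ne_zero f hf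
    obtain ⟨L, ⟨e'⟩⟩ := exists_equiv_prod_of_ne_zero g hg
    have : IsNoetherian R S := isNoetherian_submodule' (S.restrictScalars R)
    have hS0 : 0 < Module.length R S := by
      have := IsSimpleModule.nontrivial A S
      exact Module.length_pos
    have hl : Module.length R M = Module.length R S + Module.length R K := by
      rw [← Module.length_prod]
      exact (e.restrictScalars R).length_eq
    have hK : Module.length R K ≠ ⊤ := ne_top_of_le_ne_top hMt (by rw [hl]; exact le_add_self)
    have hL : Module.length R L ≠ ⊤ := 
      ne_top_of_le_ne_top hN (Module.length_le_of_injective (L.subtype.restrictScalars R)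
        (Submodule.subtype_injective _))
    have hlt : Module.length R K < n := by
      rw [← hM, hl]
      exact ENat.lt_add_left hK hS0
    obtain ⟨m, hm⟩ := ENat.ne_top_iff_exists.1 hK
    rw [← hm] at hlt
    have : IsNoetherian R K := isNoetherian_submodule' (K.restrictScalars R)
    have : IsNoetherian R L := isNoetherian_submodule' (L.restrictScalars R)
    obtain ⟨e''⟩ := ih m (by exact_mod_cast hlt) K L hm.symm hL (fun T _ _ _ _ _ hT => by
      have h1 := h T hT
      rw [homLength_congr_left e, homLength_congr_left e', homLength_prod, homLength_prod] at h1
      exact WithTop.add_left_cancel (homLength_ne_top hT) h1)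
    exact ⟨e.trans ((LinearEquiv.prodCongr (LinearEquiv.refl _ _) e'').trans e'.symm)⟩

lemma isSemisimpleModule_of_isTorsionBy {M : Type*} [AddCommGroup M] [Module R M]
    (I : Ideal R) [I.IsMaximal] (h : Module.IsTorsionBySet R M I) : IsSemisimpleModule R M := by
  let := h.module
  let : Field (R ⧸ I) := Ideal.Quotient.field _
  rw [← h.isSemisimpleModule_iff]
  infer_instance

section LocalBase

open IsLocalRing

variable [IsLocalRing R]

lemma length_ne_top_of_isTorsionBy {M : Type*} [AddCommGroup M] [Module R M] [Module.Finite R M]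
    (h : Module.IsTorsionBySet R M (maximalIdeal R)) : Module.length R M ≠ ⊤ := by
  let := h.module
  have := h.isScalarTower (S := R)
  have : Module.Finite (R ⧸ maximalIdeal R) M := Module.Finite.of_restrictScalars_finite R _ _
  let : Field (R ⧸ maximalIdeal R) := Ideal.Quotient.field _
  have h1 : Module.length (R ⧸ maximalIdeal R) M ≠ ⊤ := Module.length_ne_top
  rwa [← Module.length_eq_of_surjective (R := R ⧸ maximalIdeal R) (S := R) (M := M)
    Ideal.Quotient.mk_surjective] at h1

variable {M : Type*} [AddCommGroup M] [Module R M] [Module A M] [IsScalarTower R A M]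

/-- Multiplication by a scalar is `A`-linear, so its range is zero or everything; in the second case
Nakayama over `R` makes the module vanish. -/
lemma isTorsionBy_of_isSimpleModule [Module.Finite R M] [IsSimpleModule A M] :
    Module.IsTorsionBySet R M (maximalIdeal R) := by
  rintro m ⟨r, hr⟩
  rcases eq_bot_or_eq_top (LinearMap.range (smulHom A M r)) with h | h
  · have : smulHom A M r m ∈ LinearMap.range (smulHom A M r) := ⟨m, rfl⟩
    rwa [h, Submodule.mem_bot] at this
  · have h1 : (⊤ : Submodule R M) ≤ maximalIdeal R • ⊤ := by
      rintro x -
      obtain ⟨y, rfl⟩ := (LinearMap.range_eq_top.1 h) x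
      exact Submodule.smul_mem_smul hr trivial
    have h2 := Submodule.eq_bot_of_le_smul_of_le_jacobson_bot _ _ Module.Finite.fg_top h1
      (IsLocalRing.maximalIdeal_le_jacobson _)
    have : m ∈ (⊤ : Submodule R M) := trivial
    rw [h2, Submodule.mem_bot] at this
    change r • m = 0
    rw [this, smul_zero]

lemma isTorsionBy_quotient_jacobson [Module.Finite R M] :
    Module.IsTorsionBySet R (M ⧸ Module.jacobson A M) (maximalIdeal R) := by
  rintro x ⟨r, hr⟩
  obtain ⟨m, rfl⟩ := Submodule.Quotient.mk_surjective _ x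
  change r • _ = _
  rw [← Submodule.Quotient.mk_smul, Submodule.Quotient.mk_eq_zero, Module.jacobson,
    Submodule.mem_sInf]
  intro N hN
  have : IsSimpleModule A (M ⧸ N) := isSimpleModule_iff_isCoatom.2 hN
  rw [← Submodule.Quotient.mk_eq_zero, Submodule.Quotient.mk_smul]
  exact isTorsionBy_of_isSimpleModule (A := A) (R := R) (M := M ⧸ N) (a := ⟨r, hr⟩)

/-- The top of the module is finite dimensional over the residue field, hence Artinian, and an
Artinian module with zero radical is semisimple. -/
lemma isSemisimpleModule_quotient_jacobson [Module.Finite R M] :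
    IsSemisimpleModule A (M ⧸ Module.jacobson A M) := by
  have h := length_ne_top_of_isTorsionBy (isTorsionBy_quotient_jacobson (R := R) (A := A) (M := M))
  have h1 := (isFiniteLength_iff_isNoetherian_isArtinian.1 (Module.length_ne_top_iff.1 h)).2
  have : IsArtinian A (M ⧸ Module.jacobson A M) := isArtinian_of_tower R h1
  rw [IsArtinian.isSemisimpleModule_iff_jacobson]
  exact Module.jacobson_quotient_jacobson A M

lemma eq_top_of_sup_jacobson_eq_top [Module.Finite A M] (N : Submodule A M)
    (h : N ⊔ Module.jacobson A M = ⊤) : N = ⊤ := by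
  rcases eq_top_or_exists_le_coatom N with h1 | ⟨K, hK, hNK⟩
  · exact h1
  · exact absurd (top_le_iff.1 (h ▸ sup_le hNK (sInf_le hK))) hK.1

/-- Finitely generated projective modules over an algebra which is finite over a local ring are
determined by the lengths of the modules of homomorphisms to simple modules. -/
lemma nonempty_linearEquiv_of_projective [IsNoetherianRing R] [Module.Finite R A]
    {P Q : Type v} [AddCommGroup P]
    [Module R P] [Module A P] [IsScalarTower R A P] [AddCommGroup Q] [Module R Q] [Module A Q]
    [IsScalarTower R A Q] [Module.Finite A P] [Module.Finite A Q] [Module.Projective A P]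
    [Module.Projective A Q]
    (h : ∀ (S : Type v) [AddCommGroup S] [Module R S] [Module A S] [IsScalarTower R A S],
      Module.IsTorsionBySet R S (maximalIdeal R) → Module.Finite R S →
      homLength R A P S = homLength R A Q S) : Nonempty (P ≃ₗ[A] Q) := by
  have : Module.Finite R P := Module.Finite.trans A P
  have : Module.Finite R Q := Module.Finite.trans A Q
  -- A map to a simple module kills the radical, so the test lengths see only the semisimple top.
  have hl : ∀ (M S : Type v) [AddCommGroup M] [Module R M] [Module A M] [IsScalarTower R A M]
      [AddCommGroup S] [Module R S] [Module A S] [IsScalarTower R A S] [IsSimpleModule A S],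
      homLength R A (M ⧸ Module.jacobson A M) S = homLength R A M S := by
    intro M S _ _ _ _ _ _ _ _ _
    refine LinearEquiv.length_eq
      { toFun := fun f => f ∘ₗ (Module.jacobson A M).mkQ
        invFun := fun f => (Module.jacobson A M).liftQ f
          ((Module.le_comap_jacobson f).trans ?_)
        map_add' := fun _ _ => rfl
        map_smul' := fun _ _ => rfl
        left_inv := fun f => by ext; simp
        right_inv := fun f => by ext; simp }
    rw [IsSemisimpleModule.jacobson_eq_bot A S]
    exact le_rfl
  have := isSemisimpleModule_quotient_jacobson (R := R) (A := A) (M := P)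
  have := isSemisimpleModule_quotient_jacobson (R := R) (A := A) (M := Q)
  obtain ⟨e⟩ := nonempty_linearEquiv_of_isSemisimpleModule (R := R) (A := A) _
    (length_ne_top_of_isTorsionBy (isTorsionBy_quotient_jacobson (A := A) (M := P)))
    (P ⧸ Module.jacobson A P) (Q ⧸ Module.jacobson A Q) rfl
    (length_ne_top_of_isTorsionBy (isTorsionBy_quotient_jacobson (A := A) (M := Q)))
    (fun S _ _ _ _ _ hS => by
      have hn := (isFiniteLength_iff_isNoetherian_isArtinian.1 (Module.length_ne_top_iff.1 hS)).1
      rw [hl, hl]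
      exact h S (isTorsionBy_of_isSimpleModule (A := A)) inferInstance)
  -- Projective covers: an isomorphism of tops lifts to a map of the modules, which is onto because
  -- its range together with the radical is everything.
  have key : ∀ {M N : Type v} [AddCommGroup M] [Module R M] [Module A M] [IsScalarTower R A M]
      [AddCommGroup N] [Module R N] [Module A N] [IsScalarTower R A N] [Module.Projective A M]
      [Module.Finite A N] (_ : (M ⧸ Module.jacobson A M) ≃ₗ[A] (N ⧸ Module.jacobson A N)),
      ∃ f : M →ₗ[A] N, Function.Surjective f := by
    intro M N _ _ _ _ _ _ _ _ _ _ e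
    obtain ⟨f, hf⟩ := Module.projective_lifting_property (Module.jacobson A N).mkQ
      (e.toLinearMap ∘ₗ (Module.jacobson A M).mkQ) (Submodule.mkQ_surjective _)
    refine ⟨f, LinearMap.range_eq_top.1 (eq_top_of_sup_jacobson_eq_top _ ?_)⟩
    rw [eq_top_iff]
    rintro n -
    obtain ⟨x, hx⟩ := e.surjective ((Module.jacobson A N).mkQ n)
    obtain ⟨m, rfl⟩ := Submodule.mkQ_surjective _ x
    have h1 : (Module.jacobson A N).mkQ (f m) = (Module.jacobson A N).mkQ n := by
      rw [← hx, ← LinearMap.comp_apply, hf]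
      rfl
    rw [← sub_add_cancel n (f m), add_comm]
    refine Submodule.add_mem_sup ⟨m, rfl⟩ ?_
    rw [← Submodule.Quotient.mk_eq_zero]
    exact (map_sub (Module.jacobson A N).mkQ n (f m)).trans (by rw [h1, sub_self])
  obtain ⟨f, hf⟩ := key e
  obtain ⟨g, hg⟩ := key e.symm
  have : IsNoetherian R P := isNoetherian_of_isNoetherianRing_of_finite R P
  have : IsNoetherian A P := isNoetherian_of_tower R this
  -- The composite of the two surjections is a surjective endomorphism of a Noetherian module.
  have hi : Function.Injective (g ∘ₗ f) :=
    IsNoetherian.injective_of_surjective_endomorphism _ (hg.comp hf)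
  exact ⟨LinearEquiv.ofBijective f ⟨Function.Injective.of_comp hi, hf⟩⟩

end LocalBase

end HomLengths


/-! ### Invariants of cyclic groups in characteristic `p`. -/

section FixedParts

variable {R : Type*} [CommRing R] {G : Type*} [Group G] {W : Type*} [AddCommGroup W] [Module R W]

/-- The submodule of vectors fixed by a subgroup. -/
def fixedPart (ρ : Representation R G W) (H : Subgroup G) : Submodule R W where
  carrier := {w | ∀ h ∈ H, ρ h w = w}
  add_mem' ha hb h hh := by rw [map_add, ha h hh, hb h hh]
  zero_mem' h _ := map_zero _
  smul_mem' r w hw h hh := by rw [map_smul, hw h hh]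

/-- Higman's criterion for relative projectivity: the identity is a trace. -/
def HasTraceOne [Fintype G] (ρ : Representation R G W) : Prop :=
  ∃ θ : W →ₗ[R] W, ∀ w, ∑ g, ρ g (θ (ρ g⁻¹ w)) = w

/-- As far as length is concerned, `T` looks free over `R[τ]/(τ ^ q)`. The map `τ ^ i` sends the
kernel of `τ ^ (i + 1)` onto the kernel of `τ`, because elements of the latter are divisible by `τ ^
(q - 1)`; each of the `q` steps of the filtration therefore contributes equally. -/
lemma length_eq_mul_length_ker {T : Type*} [AddCommGroup T] [Module R T] (τ : Module.End R T)
    (q : ℕ) (hτ : τ ^ q = 0) (h : LinearMap.ker τ ≤ LinearMap.range (τ ^ (q - 1))) :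
    Module.length R T = q * Module.length R (LinearMap.ker τ) := by
  have key : ∀ i ≤ q, Module.length R (LinearMap.ker (τ ^ i)) =
      i * Module.length R (LinearMap.ker τ) := by
    intro i
    induction i with
    | zero =>
      intro _
      rw [pow_zero, Module.End.one_eq_id, LinearMap.ker_id]
      simp
    | succ i ih =>
      intro hi
      let f : LinearMap.ker (τ ^ i) →ₗ[R] LinearMap.ker (τ ^ (i + 1)) :=
        Submodule.inclusion fun x hx => by
          rw [LinearMap.mem_ker] at hx ⊢
          rw [pow_succ', Module.End.mul_apply, hx, map_zero]
      let g : LinearMap.ker (τ ^ (i + 1)) →ₗ[R] LinearMap.ker τ :=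
        (τ ^ i).restrict fun x hx => by
          rw [LinearMap.mem_ker] at hx ⊢
          rwa [pow_succ', Module.End.mul_apply] at hx
      rw [Module.length_eq_add_of_exact f g (Submodule.inclusion_injective _), ih (by omega),
        Nat.cast_add, add_mul, Nat.cast_one, one_mul]
      · rintro ⟨y, hy⟩
        obtain ⟨z, hz⟩ := h hy
        have hq : q - 1 = i + (q - 1 - i) := by omega
        rw [hq, pow_add, Module.End.mul_apply] at hz
        refine ⟨⟨(τ ^ (q - 1 - i)) z, ?_⟩, Subtype.ext hz⟩
        rw [LinearMap.mem_ker, pow_succ', Module.End.mul_apply, hz]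
        exact hy
      · intro x
        constructor
        · intro hx
          exact ⟨⟨x.1, congrArg Subtype.val hx⟩, rfl⟩
        · rintro ⟨y, rfl⟩
          exact Subtype.ext y.2
  have h1 := key q le_rfl
  rw [hτ, LinearMap.ker_zero, Module.length_top] at h1
  exact h1

/-- Both sides times `X - 1` equal `X ^ p ^ a - 1`, by Frobenius. With `X` acting as `σ`, this
identifies a norm with a power of `σ - 1`. -/
lemma polynomial_geom_sum_eq (p : ℕ) [Fact p.Prime] (a : ℕ) :
    ∑ j ∈ Finset.range (p ^ a), (Polynomial.X : Polynomial (ZMod p)) ^ j =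
      (Polynomial.X - 1) ^ (p ^ a - 1) := by
  have hne : (Polynomial.X - 1 : Polynomial (ZMod p)) ≠ 0 := Polynomial.X_sub_C_ne_zero 1
  apply mul_left_cancel₀ hne
  rw [mul_geom_sum, ← pow_succ', Nat.sub_add_cancel (Nat.one_le_pow _ _ (Fact.out : p.Prime).pos),
    sub_pow_char_pow, one_pow]

variable {p : ℕ} [Fact p.Prime]

lemma sub_one_pow_prime_pow_sub_one_zmod {T : Type*} [AddCommGroup T] [Module (ZMod p) T]
    (b : Module.End (ZMod p) T) (n : ℕ) (t : T) :
    ((b - 1) ^ (p ^ n - 1)) t = ∑ j ∈ Finset.range (p ^ n), (b ^ j) t := by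
  have h := congrArg (fun f => Polynomial.aeval b f t) (polynomial_geom_sum_eq p n)
  simp only [map_sum, map_pow, Polynomial.aeval_X, map_sub, map_one, LinearMap.sum_apply] at h
  exact h.symm

lemma sub_one_pow_prime_pow_sub_one {T : Type*} [AddCommGroup T] [Module R T]
    (hp : ∀ t : T, (p : ℤ) • t = 0) (a : Module.End R T) (n : ℕ) (t : T) :
    ((a - 1) ^ (p ^ n - 1)) t = ∑ j ∈ Finset.range (p ^ n), (a ^ j) t := by
  -- Only `T` is killed by `p`, not `R`; the identity is checked on elements, so `a` may be treated
  -- as a mere additive map.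
  let _ : Module (ZMod p) T := AddCommGroup.zmodModule fun t => by simpa using hp t
  have h := sub_one_pow_prime_pow_sub_one_zmod (p := p) (a.toAddMonoidHom.toZModLinearMap p) n t
  simp only [Module.End.pow_apply] at h ⊢
  exact h

lemma sub_one_pow_prime_pow {T : Type*} [AddCommGroup T] [Module R T]
    (hp : ∀ t : T, (p : ℤ) • t = 0) (a : Module.End R T) (n : ℕ) :
    (a - 1) ^ p ^ n = a ^ p ^ n - 1 := by
  rw [← mul_geom_sum]
  ext t
  have h1 : p ^ n = (p ^ n - 1) + 1 := by
    have := Nat.one_le_pow n p (Fact.out : p.Prime).pos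
    omega
  rw [h1, pow_succ', ← h1, Module.End.mul_apply, Module.End.mul_apply,
    sub_one_pow_prime_pow_sub_one hp]
  simp

lemma mem_fixedPart_zpowers {ρ : Representation R G W} {x : G} {w : W} :
    w ∈ fixedPart ρ (Subgroup.zpowers x) ↔ ρ x w = w := by
  refine ⟨fun h => h x (Subgroup.mem_zpowers x), fun h => ?_⟩
  let S : Subgroup G :=
    { carrier := {g | ρ g w = w}
      mul_mem' := fun {a b} ha hb => by
        change ρ (a * b) w = w
        rw [map_mul, Module.End.mul_apply, hb, ha]
      one_mem' := by
        change ρ 1 w = w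
        rw [map_one, Module.End.one_apply]
      inv_mem' := fun {a} ha => by
        change ρ a⁻¹ w = w
        nth_rewrite 1 [← (show ρ a w = w from ha)]
        rw [← Module.End.mul_apply, ← map_mul, inv_mul_cancel, map_one, Module.End.one_apply] }
  have hS : Subgroup.zpowers x ≤ S := by
    rw [Subgroup.zpowers_le]
    exact h
  exact fun y hy => hS hy

lemma bijective_out_mul (H : Subgroup G) :
    Function.Bijective fun x : (G ⧸ H) × H => x.1.out * (x.2 : G) := by
  have h1 : ∀ x : (G ⧸ H) × H, ((x.1.out * (x.2 : G) : G) : G ⧸ H) = x.1 := fun x => by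
    rw [QuotientGroup.mk_mul_of_mem _ x.2.2, QuotientGroup.out_eq']
  constructor
  · rintro ⟨x, c⟩ ⟨y, d⟩ h
    have hx : x = y := (h1 (x, c)).symm.trans ((congrArg _ h).trans (h1 (y, d)))
    subst hx
    exact Prod.ext rfl (Subtype.ext (mul_left_cancel h))
  · intro g
    refine ⟨((g : G ⧸ H), ⟨(g : G ⧸ H).out⁻¹ * g, ?_⟩), mul_inv_cancel_left _ _⟩
    rw [← QuotientGroup.eq, QuotientGroup.out_eq']

/-- Grouping the trace over `G` by right cosets of `⟨σ⟩` writes `w` as the norm over `⟨σ⟩` of a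
vector `u`. The norm is taken in two stages: `v` is the sum of the translates of `u` under `⟨σ ^
q⟩`. -/
lemma exists_sum_pow_eq_of_hasTraceOne [Fintype G] (ρ : Representation R G W)
    (hρ : HasTraceOne ρ) (σ : G) (q : ℕ) (hn : q ∣ orderOf σ) (w : W)
    (hw : ρ σ w = w) :
    ∃ v, ρ (σ ^ q) v = v ∧ ∑ j ∈ Finset.range q, ρ (σ ^ j) v = w := by
  classical
  obtain ⟨θ, hθ⟩ := hρ
  obtain ⟨m, hm⟩ := hn
  have hw' : ∀ c ∈ Subgroup.zpowers σ, ρ c w = w := mem_fixedPart_zpowers.2 hw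
  let F : G → W := fun g => ρ g (θ (ρ g⁻¹ w))
  have hF : ∀ c ∈ Subgroup.zpowers σ, ∀ g, F (c * g) = ρ c (F g) := fun c hc g => by
    have h1 : ρ (c * g)⁻¹ w = ρ g⁻¹ w := by
      rw [mul_inv_rev, map_mul, Module.End.mul_apply, hw' _ (inv_mem hc)]
    change ρ (c * g) (θ (ρ (c * g)⁻¹ w)) = _
    rw [h1, map_mul, Module.End.mul_apply]
  -- Inversion turns representatives of left cosets into representatives of right cosets, the side
  -- on which `F` is equivariant.
  let e : (G ⧸ Subgroup.zpowers σ) × Subgroup.zpowers σ ≃ G :=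
    (Equiv.ofBijective _ (bijective_out_mul (Subgroup.zpowers σ))).trans (Equiv.inv G)
  have he : ∀ x, e x = (x.2 : G)⁻¹ * (x.1.out)⁻¹ := fun x => by
    rw [← mul_inv_rev]
    rfl
  let u : W := ∑ x : G ⧸ Subgroup.zpowers σ, F (x.out)⁻¹
  have hu : ∑ c : Subgroup.zpowers σ, ρ c u = w := by
    rw [← hθ w]
    change _ = ∑ g, F g
    rw [← Equiv.sum_comp e, Fintype.sum_prod_type_right, ← Equiv.sum_comp (Equiv.inv _)]
    refine Finset.sum_congr rfl fun c _ => ?_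
    rw [map_sum]
    refine Finset.sum_congr rfl fun x _ => ?_
    rw [he, hF _ (inv_mem c.2)]
    rfl
  have hu' : ∑ j ∈ Finset.range (orderOf σ), ρ (σ ^ j) u = w := by
    rw [← hu, ← Equiv.sum_comp (finEquivZPowers (isOfFinOrder_of_finite σ)), Finset.sum_range]
    rfl
  refine ⟨∑ i ∈ Finset.range m, ρ (σ ^ (q * i)) u, ?_, ?_⟩
  · rw [map_sum]
    have h1 := Finset.sum_range_succ (fun i => ρ (σ ^ (q * i)) u) m
    rw [Finset.sum_range_succ'] at h1
    rw [← hm, pow_orderOf_eq_one, mul_zero, pow_zero] at h1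
    refine Eq.trans (Finset.sum_congr rfl fun i _ => ?_) (add_right_cancel h1)
    rw [← Module.End.mul_apply, ← map_mul, ← pow_add, mul_add, mul_one, add_comm]
  · rw [← hu', hm]
    clear hm
    induction m with
    | zero => simp
    | succ m ih =>
      rw [mul_add q, mul_one, Finset.sum_range_add _ (q * m), ← ih, ← Finset.sum_add_distrib]
      refine Finset.sum_congr rfl fun j _ => ?_
      rw [Finset.sum_range_succ, map_add, ← Module.End.mul_apply, ← map_mul, ← pow_add, add_comm j]

/-- For a representation in characteristic `p` satisfying Higman's criterion, the lengths of the
fixed parts under the cyclic groups generated by `σ` and `σ ^ p ^ n` are proportional. -/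
lemma length_fixedPart_zpowers [Fintype G] (ρ : Representation R G W) (hρ : HasTraceOne ρ)
    (hp : ∀ w : W, (p : ℤ) • w = 0) (σ : G) (n : ℕ) (hn : p ^ n ∣ orderOf σ) :
    Module.length R (fixedPart ρ (Subgroup.zpowers (σ ^ p ^ n))) =
      (p ^ n : ℕ) * Module.length R (fixedPart ρ (Subgroup.zpowers σ)) := by
  have hfix : ∀ (x : G) (w : W), w ∈ fixedPart ρ (Subgroup.zpowers x) ↔ ρ x w = w :=
    fun x w => mem_fixedPart_zpowers
  set q := p ^ n with hq
  have hqpos : 0 < q := Nat.pow_pos (Fact.out : p.Prime).pos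
  have hcomm : ∀ w, ρ (σ ^ q) (ρ σ w) = ρ σ (ρ (σ ^ q) w) := fun w => by
    rw [← Module.End.mul_apply, ← Module.End.mul_apply, ← map_mul, ← map_mul, ← pow_succ,
      ← pow_succ']
  -- Here `a` is `σ` acting on the invariants of `σ ^ q`, so `a ^ q = 1`. In characteristic `p` this
  -- gives `(a - 1) ^ q = 0`, while `(a - 1) ^ (q - 1)` is the norm `1 + a + ⋯ + a ^ (q - 1)`. The
  -- trace condition puts the kernel of `a - 1` in the range of this norm, as
  -- `length_eq_mul_length_ker` requires.
  let a : Module.End R (fixedPart ρ (Subgroup.zpowers (σ ^ q))) :=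
    (ρ σ).restrict fun w hw => by
      rw [hfix] at hw ⊢
      rw [hcomm, hw]
  have ha : ∀ (j : ℕ) (t : fixedPart ρ (Subgroup.zpowers (σ ^ q))),
      (((a ^ j) t : fixedPart ρ (Subgroup.zpowers (σ ^ q))) : W) = ρ (σ ^ j) t := by
    intro j t
    induction j with
    | zero => simp
    | succ j ih =>
      rw [pow_succ', pow_succ', Module.End.mul_apply, map_mul, Module.End.mul_apply, ← ih]
      rfl
  have hT : ∀ t : fixedPart ρ (Subgroup.zpowers (σ ^ q)), (p : ℤ) • t = 0 := fun t =>
    Subtype.ext (hp t)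
  have hker : ∀ t : fixedPart ρ (Subgroup.zpowers (σ ^ q)), t ∈ LinearMap.ker (a - 1) ↔
      ρ σ t = t := fun t => by
    rw [LinearMap.mem_ker, LinearMap.sub_apply, sub_eq_zero, Subtype.ext_iff]
    rfl
  rw [length_eq_mul_length_ker (a - 1) q]
  · congr 1
    refine LinearEquiv.length_eq (LinearEquiv.ofBijective
      (LinearMap.codRestrict _ ((Submodule.subtype _).comp (Submodule.subtype _)) fun t => ?_) ?_)
    · exact (hfix _ _).2 ((hker _).1 t.2)
    · constructor
      · intro x y hxy
        have h2 := congrArg Subtype.val hxy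
        exact Subtype.ext (Subtype.ext h2)
      · rintro ⟨w, hw⟩
        rw [hfix] at hw
        have h1 : w ∈ fixedPart ρ (Subgroup.zpowers (σ ^ q)) := by
          rw [← hfix] at hw
          exact hw _ (Subgroup.pow_mem _ (Subgroup.mem_zpowers σ) q) |> fun h => (hfix _ _).2 h
        exact ⟨⟨⟨w, h1⟩, (hker _).2 hw⟩, rfl⟩
  · rw [sub_one_pow_prime_pow hT]
    ext t
    rw [LinearMap.sub_apply, Submodule.coe_sub, ha, (hfix _ _).1 t.2]
    simp
  · intro t ht
    rw [hker] at ht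
    obtain ⟨v, hv, hvt⟩ := exists_sum_pow_eq_of_hasTraceOne ρ hρ σ q hn t.1 ht
    refine ⟨⟨v, (hfix _ _).2 hv⟩, Subtype.ext ?_⟩
    rw [sub_one_pow_prime_pow_sub_one hT, ← hq, ← hvt, AddSubmonoidClass.coe_finsetSum]
    exact Finset.sum_congr rfl fun j _ => ha j _

end FixedParts


/-! ### Equivariant maps into a representation with trace one. -/

section EquivariantHom

universe v
variable {k : Type*} [CommRing k] {R : Type*} [CommRing R] [Algebra k R]
  {A : Type*} [Ring A] [Algebra k A] {H : Type*} [Group H] {W : Type*} [AddCommGroup W]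
  [Module k W] [Module R W] [IsScalarTower k R W]

/-- The `k`-linear maps from an `A`-module to a representation of `H` which are equivariant with
respect to a homomorphism `H →* A`. -/
def equivariantHom (u : H →* A) (ρ : Representation R H W) (M : Type*) [AddCommGroup M]
    [Module k M] [Module A M] [IsScalarTower k A M] : Submodule R (M →ₗ[k] W) where
  carrier := {β | ∀ h m, β (u h • m) = ρ h (β m)}
  add_mem' ha hb h m := by
    rw [LinearMap.add_apply, LinearMap.add_apply, map_add, ha, hb]
  zero_mem' h m := by simp
  smul_mem' r β hβ h m := by
    change r • β (u h • m) = ρ h (r • β m)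
    rw [hβ h m, map_smul]

/-- Precomposition with an `A`-linear map. -/
def equivariantHom.comp (u : H →* A) (ρ : Representation R H W) {M N : Type*} [AddCommGroup M]
    [Module k M] [Module A M] [IsScalarTower k A M] [AddCommGroup N]
    [Module k N] [Module A N] [IsScalarTower k A N] (f : M →ₗ[A] N) :
    equivariantHom (k := k) u ρ N →ₗ[R] equivariantHom (k := k) u ρ M where
  toFun β := ⟨β.1 ∘ₗ f.restrictScalars k, fun h m => by
    rw [LinearMap.comp_apply, LinearMap.restrictScalars_apply, map_smul, β.2]; rfl⟩
  map_add' _ _ := rfl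
  map_smul' _ _ := rfl

/-- The length of the module of equivariant homomorphisms. -/
noncomputable def equivariantLength (u : H →* A) (ρ : Representation R H W) (M : Type*)
    [AddCommGroup M] [Module k M] [Module A M] [IsScalarTower k A M] : ℕ∞ :=
  Module.length R (equivariantHom (k := k) u ρ M)

/-- Higman's averaging: with a `k`-linear retraction `s` of `f`, take the sum of the conjugates of
`θ ∘ β ∘ s`. On the image of `f` the retraction disappears by equivariance, and the trace identity
returns `β`. So `ρ` behaves like a relatively injective module. -/
lemma exists_equivariant_extension [Fintype H] {u : H →* A} {ρ : Representation R H W}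
    (hρ : HasTraceOne ρ) {M N : Type*} [AddCommGroup M]
    [Module k M] [Module A M] [IsScalarTower k A M] [AddCommGroup N]
    [Module k N] [Module A N] [IsScalarTower k A N] [IsSemisimpleModule k N] (f : M →ₗ[A] N)
    (hf : Function.Injective f) (β : equivariantHom (k := k) u ρ M) :
    ∃ γ : equivariantHom (k := k) u ρ N, equivariantHom.comp u ρ f γ = β := by
  obtain ⟨θ, hθ⟩ := hρ
  obtain ⟨s, hs'⟩ : ∃ s : N →ₗ[k] M, ∀ m, s (f m) = m := by
    obtain ⟨q, hq⟩ := exists_isCompl (LinearMap.range (f.restrictScalars k))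
    let e := LinearEquiv.ofInjective (f.restrictScalars k) hf
    refine ⟨e.symm.toLinearMap ∘ₗ Submodule.projectionOnto _ q hq, fun m => ?_⟩
    have h1 : Submodule.projectionOnto _ q hq (f m) = e m :=
      Submodule.projectionOnto_apply_left hq (e m)
    rw [LinearMap.comp_apply, h1]
    exact e.symm_apply_apply m
  let γ : N →ₗ[k] W :=
    { toFun := fun n => ∑ h, ρ h (θ (β.1 (s (u h⁻¹ • n))))
      map_add' := fun a b => by
        simp only [smul_add, map_add, Finset.sum_add_distrib]
      map_smul' := fun r a => by
        have h1 : ∀ h, u h • r • a = r • u h • a := fun h => by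
          rw [← algebraMap_smul A r a, ← algebraMap_smul A r (u h • a), smul_smul, smul_smul,
            Algebra.commutes]
        simp only [h1, map_smul, RingHom.id_apply, Finset.smul_sum]
        refine Finset.sum_congr rfl fun h _ => ?_
        rw [← algebraMap_smul R r (β.1 (s _)), map_smul, map_smul, algebraMap_smul] }
  refine ⟨⟨γ, fun h n => ?_⟩, Subtype.ext (LinearMap.ext fun m => ?_)⟩
  · change ∑ g, ρ g (θ (β.1 (s (u g⁻¹ • u h • n)))) = ρ h (∑ g, ρ g (θ (β.1 (s (u g⁻¹ • n)))))
    rw [← Equiv.sum_comp (Equiv.mulLeft h), map_sum]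
    refine Finset.sum_congr rfl fun g _ => ?_
    rw [Equiv.coe_mulLeft, smul_smul, ← map_mul u, mul_inv_rev, inv_mul_cancel_right, map_mul,
      Module.End.mul_apply]
  · change ∑ h, ρ h (θ (β.1 (s (u h⁻¹ • f m)))) = β.1 m
    rw [← hθ (β.1 m)]
    refine Finset.sum_congr rfl fun g _ => ?_
    rw [← map_smul, hs', β.2]

/-- Equivariant Hom is left exact. Surjectivity of restriction is the extension lemma, whose
semisimplicity hypothesis holds because modules killed by `π` are vector spaces over the residue
field. -/
lemma isAdditiveInvariant_equivariantLength [Fintype H] (u : H →* A) {ρ : Representation R H W}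
    (hρ : HasTraceOne ρ) (π : k) [(Ideal.span {π}).IsMaximal] :
    IsAdditiveInvariant.{v} A π (fun M _ _ _ _ => equivariantLength (k := k) u ρ M) where
  congr M N _ _ _ _ _ _ _ _ e := by
    refine LinearEquiv.length_eq (LinearEquiv.ofLinearMap (equivariantHom.comp u ρ e.symm.toLinearMap)
      (equivariantHom.comp u ρ e.toLinearMap) ?_ ?_)
    · ext β x
      exact congrArg β.1 (e.apply_symm_apply x)
    · ext β x
      exact congrArg β.1 (e.symm_apply_apply x)
  add M N K _ _ _ _ _ _ _ _ _ _ _ _ f g hN hf hfg hg := by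
    have hss : IsSemisimpleModule k N :=
      isSemisimpleModule_of_isTorsionBy (Ideal.span {π}) fun n r => by
        obtain ⟨a, ha⟩ := Ideal.mem_span_singleton'.1 r.2
        change (r : k) • n = 0
        rw [← ha, mul_smul, hN, smul_zero]
    rw [add_comm]
    refine Module.length_eq_add_of_exact (equivariantHom.comp (k := k) u ρ g)
      (equivariantHom.comp (k := k) u ρ f) ?_ ?_ ?_
    · intro β γ h
      ext x
      obtain ⟨n, rfl⟩ := hg x
      exact LinearMap.congr_fun (congrArg Subtype.val h) n
    · intro β
      exact exists_equivariant_extension hρ f hf β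
    · intro β
      constructor
      · intro h
        have h0 : ∀ m, β.1 (f m) = 0 := fun m =>
          LinearMap.congr_fun (congrArg Subtype.val h) m
        have hker : LinearMap.ker (g.restrictScalars k) ≤ LinearMap.ker β.1 := by
          intro n hn
          obtain ⟨m, rfl⟩ := (hfg n).1 hn
          exact h0 m
        let e := (g.restrictScalars k).quotKerEquivOfSurjective hg
        let γ : K →ₗ[k] W := (Submodule.liftQ _ β.1 hker) ∘ₗ e.symm.toLinearMap
        have hγ : ∀ n, γ (g n) = β.1 n := fun n => by
          have : e.symm (g n) = Submodule.Quotient.mk n := by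
            rw [LinearEquiv.symm_apply_eq]
            rfl
          change Submodule.liftQ _ β.1 hker (e.symm (g n)) = _
          rw [this]
          rfl
        refine ⟨⟨γ, fun h x => ?_⟩, Subtype.ext (LinearMap.ext hγ)⟩
        obtain ⟨n, rfl⟩ := hg x
        rw [← map_smul, hγ, hγ, β.2]
      · rintro ⟨γ, rfl⟩
        ext m
        change γ.1 (g (f m)) = 0
        rw [hfg.apply_apply_eq_zero, map_zero]

lemma equivariantLength_reduction (u : H →* A) (ρ : Representation R H W) (π : k)
    (hW : ∀ w : W, π • w = 0) (M : Type*) [AddCommGroup M] [Module k M] [Module A M]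
    [IsScalarTower k A M] :
    equivariantLength (k := k) u ρ (Reduction A M π) = equivariantLength (k := k) u ρ M := by
  refine LinearEquiv.length_eq (LinearEquiv.ofBijective
    (equivariantHom.comp u ρ (Submodule.mkQ _)) ⟨?_, ?_⟩)
  · intro β γ h
    refine Subtype.ext (LinearMap.ext fun x => ?_)
    obtain ⟨m, rfl⟩ := Submodule.Quotient.mk_surjective _ x
    exact LinearMap.congr_fun (congrArg Subtype.val h) m
  · intro β
    have hker : (LinearMap.range (smulHom A M π)).restrictScalars k ≤ LinearMap.ker β.1 := by
      rintro _ ⟨m, rfl⟩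
      rw [LinearMap.mem_ker, smulHom_apply, map_smul, hW]
    let γ : Reduction A M π →ₗ[k] W := (Submodule.liftQ _ β.1 hker) ∘ₗ
      (Submodule.Quotient.restrictScalarsEquiv k (LinearMap.range (smulHom A M π))).symm.toLinearMap
    have hγ : ∀ m, γ (Submodule.Quotient.mk m) = β.1 m := fun m => rfl
    refine ⟨⟨γ, fun h x => ?_⟩, Subtype.ext (LinearMap.ext hγ)⟩
    obtain ⟨m, rfl⟩ := Submodule.Quotient.mk_surjective _ x
    rw [← Submodule.Quotient.mk_smul, hγ, hγ, β.2]

/-- Commensurable lattices have the same number of equivariant maps to a torsion module. -/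
lemma equivariantLength_eq [Fintype H] (u : H →* A) {ρ : Representation R H W}
    (hρ : HasTraceOne ρ) (π : k) [(Ideal.span {π}).IsMaximal] (hW : ∀ w : W, π • w = 0)
    {M N : Type v} [AddCommGroup M] [Module k M] [Module A M] [IsScalarTower k A M]
    [AddCommGroup N] [Module k N] [Module A N] [IsScalarTower k A N]
    (m : ℕ) (d : k) (hd : IsCoprime d π) (hM : ∀ x : M, π • x = 0 → x = 0) (i : N →ₗ[A] M)
    (hi : Function.Injective i) (h : ∀ x : M, ∃ n, i n = (π ^ m * d) • x) :
    equivariantLength (k := k) u ρ N = equivariantLength (k := k) u ρ M := by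
  rw [← equivariantLength_reduction u ρ π hW N, ← equivariantLength_reduction u ρ π hW M]
  exact (isAdditiveInvariant_equivariantLength u hρ π).reduction_eq m d hd hM i hi h

end EquivariantHom


/-! ### From isomorphism over the fraction field to commensurability. -/

section Lattice

variable {R F A B : Type*} [CommRing R] [Field F] [Algebra R F]
  [Ring A] [Algebra R A] [Ring B] [Algebra F B] {φ : A →+* B}
  {P Q V W : Type*} [AddCommGroup P] [Module A P] [AddCommGroup Q] [Module A Q]
  [AddCommGroup V] [Module B V] [AddCommGroup W] [Module B W]

lemma exists_denominator_of_finite [IsDomain R] [Module.Finite A Q] (s : P →ₛₗ[φ] V)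
    (hs : ∀ v, ∃ r : R, r ≠ 0 ∧ ∃ p, s p = φ (algebraMap R A r) • v) (t : Q →ₛₗ[φ] V) :
    ∃ r : R, r ≠ 0 ∧ ∀ q, ∃ p, s p = φ (algebraMap R A r) • t q := by
  classical
  have hcomm : ∀ (r : R) (a : A) (v : V),
      φ (algebraMap R A r) • φ a • v = φ a • φ (algebraMap R A r) • v := fun r a v => by
    rw [smul_smul, smul_smul, ← map_mul, ← map_mul, Algebra.commutes]
  obtain ⟨T, hT⟩ := (Module.Finite.fg_top : (⊤ : Submodule A Q).FG)
  choose r hr p hp using fun q : Q => hs (t q)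
  refine ⟨∏ q ∈ T, r q, Finset.prod_ne_zero_iff.2 fun q _ => hr q, fun q => ?_⟩
  have hq : q ∈ Submodule.span A (T : Set Q) := hT ▸ Submodule.mem_top
  induction hq using Submodule.span_induction with
  | mem x hx =>
    refine ⟨algebraMap R A (∏ q ∈ T.erase x, r q) • p x, ?_⟩
    rw [map_smulₛₗ, hp, smul_smul, ← map_mul,
      ← map_mul, Finset.prod_erase_mul _ _ hx]
  | zero => exact ⟨0, by simp⟩
  | add x y _ _ hx hy =>
    obtain ⟨a, ha⟩ := hx
    obtain ⟨b, hb⟩ := hy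
    exact ⟨a + b, by rw [map_add, ha, hb, map_add, smul_add]⟩
  | smul a x _ hx =>
    obtain ⟨b, hb⟩ := hx
    exact ⟨a • b, by rw [map_smulₛₗ, hb, map_smulₛₗ, hcomm]⟩

/-- Two lattices which are isomorphic over the fraction field are commensurable. -/
lemma exists_injective_of_generic_equiv [IsDomain R] [FaithfulSMul R F] [Module R P]
    [IsScalarTower R A P] [Module.Finite A P] [Module.Finite A Q]
    (hφ : ∀ r, φ (algebraMap R A r) = algebraMap F B (algebraMap R F r))
    (s : P →ₛₗ[φ] V) (hsinj : Function.Injective s)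
    (hs : ∀ v, ∃ r : R, r ≠ 0 ∧ ∃ p, s p = φ (algebraMap R A r) • v)
    (t : Q →ₛₗ[φ] W) (htinj : Function.Injective t)
    (ht : ∀ v, ∃ r : R, r ≠ 0 ∧ ∃ p, t p = φ (algebraMap R A r) • v) (e : W ≃ₗ[B] V) :
    ∃ i : Q →ₗ[A] P, Function.Injective i ∧ ∃ d : R, d ≠ 0 ∧ ∀ p, ∃ q, i q = d • p := by
  have hcomm : ∀ (r : R) (a : A) (v : V),
      φ (algebraMap R A r) • φ a • v = φ a • φ (algebraMap R A r) • v := fun r a v => by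
    rw [smul_smul, smul_smul, ← map_mul, ← map_mul, Algebra.commutes]
  have hinj : ∀ r : R, r ≠ 0 → ∀ v : V, φ (algebraMap R A r) • v = 0 → v = 0 := fun r hr v hv => by
    have h0 : algebraMap R F r ≠ 0 := by
      rwa [Ne, FaithfulSMul.algebraMap_eq_zero_iff]
    rw [hφ] at hv
    have := congrArg (fun x => algebraMap F B (algebraMap R F r)⁻¹ • x) hv
    simpa only [smul_smul, ← map_mul, inv_mul_cancel₀ h0, map_one, one_smul, smul_zero] using this
  -- The embedding is `r • e` restricted to the lattices. The scalar `r'` clears the denominators of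
  -- the inverse, so `r * r'` carries `P` into the image.
  obtain ⟨r, hr, h1⟩ := exists_denominator_of_finite s hs (e.toLinearMap.comp t)
  obtain ⟨r', hr', h2⟩ := exists_denominator_of_finite t ht (e.symm.toLinearMap.comp s)
  choose f hf using h1
  have hf' : ∀ q, s (f q) = φ (algebraMap R A r) • e (t q) := hf
  let i : Q →ₗ[A] P :=
    { toFun := f
      map_add' := fun a b => hsinj (by rw [hf', map_add, map_add, map_add, hf', hf', smul_add])
      map_smul' := fun a b => hsinj (by
        rw [hf', map_smulₛₗ, map_smul, hcomm, RingHom.id_apply, map_smulₛₗ, hf']) }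
  refine ⟨i, (injective_iff_map_eq_zero i).2 fun q hq => ?_, r * r', mul_ne_zero hr hr', fun p => ?_⟩
  · have h3 : s (f q) = 0 := by
      change s (i q) = 0
      rw [hq, map_zero]
    rw [hf'] at h3
    have h4 := hinj r hr _ h3
    rw [LinearEquiv.map_eq_zero_iff] at h4
    exact htinj (h4.trans (map_zero t).symm)
  · obtain ⟨q, hq⟩ := h2 p
    have hq' : t q = φ (algebraMap R A r') • e.symm (s p) := hq
    refine ⟨q, hsinj ?_⟩
    change s (f q) = _
    rw [hf', hq', map_smul, LinearEquiv.apply_symm_apply, smul_smul, ← map_mul, ← map_mul,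
      ← map_smulₛₗ, algebraMap_smul]

end Lattice

/-! ### Maps out of permutation modules compute invariants of stabilizers. -/

section PermutationModule

variable (k : Type*) [CommRing k] (G : Type*) [Group G]

/-- The permutation representation on a `G`-set. -/
noncomputable def permRep (X : Type*) [MulAction G X] : Representation k G (X →₀ k) where
  toFun g := Finsupp.lmapDomain k k (g • ·)
  map_one' := by
    ext x
    simp
  map_mul' g h := by
    ext x
    simp [mul_smul]

variable {k G}

lemma permRep_single {X : Type*} [MulAction G X] (g : G) (x : X) (r : k) :
    permRep k G X g (Finsupp.single x r) = Finsupp.single (g • x) r :=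
  Finsupp.mapDomain_single

variable {R : Type*} [CommRing R] {W : Type*} [AddCommGroup W] [Module R W]

/-- The equivariant maps from a `G`-set to a representation. -/
def equivariantMaps (ρ : Representation R G W) (X : Type*) [MulAction G X] :
    Submodule R (X → W) where
  carrier := {f | ∀ (g : G) (x : X), f (g • x) = ρ g (f x)}
  add_mem' ha hb g x := by
    rw [Pi.add_apply, Pi.add_apply, map_add, ha, hb]
  zero_mem' g x := by simp
  smul_mem' r f hf g x := by
    rw [Pi.smul_apply, Pi.smul_apply, map_smul, hf]

lemma equivariantLength_permRep [Algebra k R] [Module k W] [IsScalarTower k R W]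
    (ρ : Representation R G W) (X : Type*) [MulAction G X] :
    equivariantLength (k := k) (MonoidAlgebra.of k G) ρ (permRep k G X).asModule =
      Module.length R (equivariantMaps ρ X) := by
  have hsm : ∀ (g : G) (x : (permRep k G X).asModule), MonoidAlgebra.of k G g • x =
      permRep k G X g x := fun g x => by
    rw [MonoidAlgebra.of_apply, Representation.single_smul, one_smul]
    rfl
  let f : equivariantHom (k := k) (MonoidAlgebra.of k G) ρ (permRep k G X).asModule →ₗ[R]
      equivariantMaps ρ X :=
    { toFun := fun β => ⟨fun x => β.1 (Finsupp.single x 1 : X →₀ k), fun g x => by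
        exact (congrArg β.1 ((hsm g (Finsupp.single x 1 : X →₀ k)).trans
          (permRep_single g x 1))).symm.trans (β.2 g (Finsupp.single x 1 : X →₀ k))⟩
      map_add' := fun _ _ => rfl
      map_smul' := fun _ _ => rfl }
  refine LinearEquiv.length_eq (LinearEquiv.ofBijective f ⟨fun β γ h => ?_, fun m => ?_⟩)
  · refine Subtype.ext ((Finsupp.lhom_ext' fun x => LinearMap.ext_ring ?_ :
      (β.1 : (X →₀ k) →ₗ[k] W) = γ.1))
    exact congrFun (congrArg Subtype.val h) x
  · have h1 : ∀ x, Finsupp.linearCombination k m.1 (Finsupp.single x 1) = m.1 x := fun x => by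
      rw [Finsupp.linearCombination_single, one_smul]
    have h2 : ∀ (g : G) (a : X →₀ k), Finsupp.linearCombination k m.1 (permRep k G X g a) =
        ρ g (Finsupp.linearCombination k m.1 a) := fun g a => by
      induction a using Finsupp.induction_linear with
      | zero => simp
      | add a b ha hb => rw [map_add, map_add, ha, hb, map_add, map_add]
      | single x r =>
        rw [permRep_single, Finsupp.linearCombination_single, Finsupp.linearCombination_single,
          m.2 g x, ← algebraMap_smul R r (m.1 x), map_smul, algebraMap_smul]
    exact ⟨⟨(Finsupp.linearCombination k m.1 : (X →₀ k) →ₗ[k] W), fun g x =>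
      (congrArg (Finsupp.linearCombination k m.1) (hsm g x)).trans (h2 g x)⟩,
      Subtype.ext (funext h1)⟩

/-- Evaluation at the trivial coset: its stabilizer is `C`, so the value must be fixed by `C`, and a
fixed vector spreads uniquely along the orbit. -/
lemma length_equivariantMaps_quotient (ρ : Representation R G W) (C : Subgroup G) :
    Module.length R (equivariantMaps ρ (G ⧸ C)) = Module.length R (fixedPart ρ C) := by
  let f : equivariantMaps ρ (G ⧸ C) →ₗ[R] fixedPart ρ C :=
    { toFun := fun m => ⟨m.1 ((1 : G) : G ⧸ C), fun c hc => by
        have h1 : c • ((1 : G) : G ⧸ C) = ((1 : G) : G ⧸ C) := by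
          change ((c * 1 : G) : G ⧸ C) = _
          rw [mul_one, eq_comm, QuotientGroup.eq]
          simpa using hc
        rw [← m.2, h1]⟩
      map_add' := fun _ _ => rfl
      map_smul' := fun _ _ => rfl }
  refine LinearEquiv.length_eq (LinearEquiv.ofBijective f ⟨fun m n h => ?_, fun w => ?_⟩)
  · refine Subtype.ext (funext fun x => ?_)
    obtain ⟨g, rfl⟩ := QuotientGroup.mk_surjective x
    have h1 : ((g : G) : G ⧸ C) = g • ((1 : G) : G ⧸ C) := by
      change _ = ((g * 1 : G) : G ⧸ C)
      rw [mul_one]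
    rw [h1, m.2, n.2]
    exact congrArg (ρ g) (congrArg Subtype.val h)
  · refine ⟨⟨Quotient.lift (fun g => ρ g w.1) fun a b hab => ?_, fun g x => ?_⟩, Subtype.ext ?_⟩
    · have h2 := w.2 _ (QuotientGroup.leftRel_apply.1 hab)
      nth_rewrite 1 [← h2]
      rw [← Module.End.mul_apply, ← map_mul, mul_inv_cancel_left]
    · obtain ⟨h, rfl⟩ := QuotientGroup.mk_surjective x
      change ρ (g * h) w.1 = ρ g (ρ h w.1)
      rw [map_mul, Module.End.mul_apply]
    · change ρ 1 w.1 = w.1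
      rw [map_one, Module.End.one_apply]

lemma length_equivariantMaps_sigma {ι : Type*} [Fintype ι] (ρ : Representation R G W)
    (X : ι → Type*) [∀ i, MulAction G (X i)] :
    Module.length R (equivariantMaps ρ (Σ i, X i)) =
      ∑ i, Module.length R (equivariantMaps ρ (X i)) := by
  rw [← Module.length_pi_of_fintype]
  let f : equivariantMaps ρ (Σ i, X i) →ₗ[R] ∀ i, equivariantMaps ρ (X i) :=
    { toFun := fun m i => ⟨fun x => m.1 ⟨i, x⟩, fun g x => m.2 g ⟨i, x⟩⟩
      map_add' := fun _ _ => rfl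
      map_smul' := fun _ _ => rfl }
  refine LinearEquiv.length_eq (LinearEquiv.ofBijective f ⟨fun m n h => ?_, fun w => ?_⟩)
  · refine Subtype.ext (funext fun x => ?_)
    exact congrFun (congrArg Subtype.val (congrFun h x.1)) x.2
  · exact ⟨⟨fun x => (w x.1).1 x.2, fun g x => (w x.1).2 g x.2⟩, rfl⟩

end PermutationModule


/-! ### Artin's relation between invariants of `G` and of its cyclic subgroups. -/

section Artin

variable {G : Type*} [Group G] [Fintype G]

-- The average over `H` is a projector onto the invariants, so its trace is their dimension.
omit [Fintype G] in
lemma card_mul_finrank_fixedPart {V : Type*} [AddCommGroup V] [Module ℚ V] [Module.Finite ℚ V]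
    (ρ : Representation ℚ G V) (H : Subgroup G) [Fintype H] :
    (Fintype.card H : ℚ) * Module.finrank ℚ (fixedPart ρ H) =
      ∑ h : H, LinearMap.trace ℚ V (ρ h) := by
  have h0 : (Fintype.card H : ℚ) ≠ 0 := Nat.cast_ne_zero.2 Fintype.card_ne_zero
  let f : V →ₗ[ℚ] V := (Fintype.card H : ℚ)⁻¹ • ∑ h : H, ρ h
  have hf : LinearMap.IsProj (fixedPart ρ H) f := by
    constructor
    · intro v h hh
      change ρ h (((Fintype.card H : ℚ)⁻¹ • ∑ h : H, ρ h) v) = _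
      rw [LinearMap.smul_apply, map_smul, LinearMap.sum_apply, map_sum]
      congr 1
      exact Fintype.sum_equiv (Equiv.mulLeft (⟨h, hh⟩ : H)) _ _ fun x => by simp
    · intro v hv
      change ((Fintype.card H : ℚ)⁻¹ • ∑ h : H, ρ h) v = v
      rw [LinearMap.smul_apply, LinearMap.sum_apply,
        Finset.sum_congr rfl fun h _ => hv h.1 h.2, Finset.sum_const, Finset.card_univ,
        ← Nat.cast_smul_eq_nsmul ℚ, smul_smul, inv_mul_cancel₀ h0, one_smul]
  rw [← hf.trace, map_smul, map_sum, smul_eq_mul, mul_inv_cancel_left₀ h0]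

-- A triangularity argument, by induction on the largest order of an element in the support of `f`.
-- Among the cyclic subgroups of that order, only the one generated by `g` contains `g`, so their
-- indicator functions correct `f` at the top order without interference.
open Classical in
lemma exists_sum_indicator_zpowers (k : ℕ) : ∀ f : G → ℚ,
    (∀ g h, Subgroup.zpowers g = Subgroup.zpowers h → f g = f h) →
    (∀ g, k < orderOf g → f g = 0) →
    ∃ a : G → ℚ, ∀ g, ∑ σ, (if g ∈ Subgroup.zpowers σ then a σ else 0) = f g := by
  induction k with
  | zero =>
    intro f _ hf
    refine ⟨0, fun g => ?_⟩
    rw [hf g (orderOf_pos g)]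
    simp
  | succ k ih =>
    intro f hf hfk
    -- The sum runs over elements, so each cyclic subgroup occurs once for every generator; the
    -- division compensates for this.
    let a₀ : G → ℚ := fun σ => if orderOf σ = k + 1 then
      f σ / (Finset.univ.filter fun τ => Subgroup.zpowers τ = Subgroup.zpowers σ).card else 0
    obtain ⟨a, ha⟩ := ih (fun g => f g - ∑ σ, (if g ∈ Subgroup.zpowers σ then a₀ σ else 0))
      (fun g h hgh => by
        have h1 : ∀ σ, g ∈ Subgroup.zpowers σ ↔ h ∈ Subgroup.zpowers σ := fun σ => by
          rw [← Subgroup.zpowers_le, ← Subgroup.zpowers_le, hgh]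
        simp only [hf g h hgh, h1])
      (fun g hg => by
        rw [sub_eq_zero]
        rcases (Nat.succ_le_of_lt hg).lt_or_eq with hlt | heq
        · rw [hfk g hlt]
          refine (Finset.sum_eq_zero fun σ _ => ?_).symm
          split_ifs with h
          · have h2 : orderOf g ≤ orderOf σ :=
              Nat.le_of_dvd (orderOf_pos σ) (orderOf_dvd_of_mem_zpowers h)
            have h3 : orderOf σ ≠ k + 1 := by omega
            exact if_neg h3
          · rfl
        · have hord : orderOf g = k + 1 := heq.symm
          have key : ∀ σ, (if g ∈ Subgroup.zpowers σ then a₀ σ else 0) =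
              if Subgroup.zpowers σ = Subgroup.zpowers g then f g / (Finset.univ.filter
                fun τ => Subgroup.zpowers τ = Subgroup.zpowers g).card else 0 := by
            intro σ
            by_cases hσ : Subgroup.zpowers σ = Subgroup.zpowers g
            · have h1 : orderOf σ = k + 1 := by
                rw [← Nat.card_zpowers, hσ, Nat.card_zpowers, hord]
              rw [if_pos hσ, if_pos (hσ ▸ Subgroup.mem_zpowers g)]
              simp only [a₀, if_pos h1, hf σ g hσ, hσ]
            · rw [if_neg hσ]
              split_ifs with h
              · refine if_neg fun h1 => hσ ?_
                refine (Subgroup.eq_of_le_of_card_ge (Subgroup.zpowers_le.2 h) ?_).symm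
                rw [Nat.card_zpowers, Nat.card_zpowers, h1, hord]
              · rfl
          rw [Finset.sum_congr rfl fun σ _ => key σ, ← Finset.sum_filter, Finset.sum_const,
            nsmul_eq_mul, mul_div_cancel₀]
          rw [Nat.cast_ne_zero, Finset.card_ne_zero]
          exact ⟨g, by simp⟩)
    refine ⟨fun σ => a σ + a₀ σ, fun g => ?_⟩
    have h1 := ha g
    rw [eq_sub_iff_add_eq, ← Finset.sum_add_distrib] at h1
    rw [← h1]
    refine Finset.sum_congr rfl fun σ _ => ?_
    split_ifs
    · rfl
    · simp

universe v

/-- A form of Artin's induction theorem: the dimension of the invariants is determined by the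
dimensions of the invariants under cyclic subgroups. -/
lemma exists_artin_relation (G : Type*) [Group G] [Fintype G] :
    ∃ (N : ℕ) (_ : N ≠ 0) (m n : G → ℕ), ∀ (V : Type v) [AddCommGroup V] [Module ℚ V]
      [Module.Finite ℚ V] (ρ : Representation ℚ G V),
      N * Module.finrank ℚ (fixedPart ρ ⊤) +
          ∑ σ, m σ * Module.finrank ℚ (fixedPart ρ (Subgroup.zpowers σ)) =
        ∑ σ, n σ * Module.finrank ℚ (fixedPart ρ (Subgroup.zpowers σ)) := by
  classical
  -- The constant function `1` becomes a combination of indicators of cyclic subgroups. Multiplying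
  -- by the character of `V` and summing over `G` gives `|G| dim V^G = ∑ a σ · |⟨σ⟩| · dim V^⟨σ⟩`.
  obtain ⟨a, ha⟩ := exists_sum_indicator_zpowers (G := G) (Fintype.card G) (fun _ => 1)
    (fun _ _ _ => rfl) (fun g hg => absurd (orderOf_le_card_univ (x := g)) (not_le.2 hg))
  -- Denominators are cleared by `D`; the integral coefficients are later split into positive and
  -- negative parts, so that the relation can be read in `ℕ` and then in `ℕ∞`.
  let D : ℕ := ∏ σ, (a σ).den
  have hD : D ≠ 0 := Finset.prod_ne_zero_iff.2 fun σ _ => (a σ).den_nz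
  have hz : ∀ σ, ∃ z : ℤ, (D : ℚ) * a σ * orderOf σ = z := fun σ => by
    refine ⟨(∏ τ ∈ Finset.univ.erase σ, (a τ).den : ℕ) * (a σ).num * orderOf σ, ?_⟩
    have h1 : D = (∏ τ ∈ Finset.univ.erase σ, (a τ).den) * (a σ).den :=
      (Finset.prod_erase_mul _ _ (Finset.mem_univ σ)).symm
    rw [h1]
    push_cast
    rw [mul_assoc (∏ τ ∈ Finset.univ.erase σ, ((a τ).den : ℚ)), Rat.den_mul_eq_num]
  choose z hz using hz
  refine ⟨D * Fintype.card G, mul_ne_zero hD Fintype.card_ne_zero, fun σ => (-z σ).toNat,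
    fun σ => (z σ).toNat, fun V _ _ _ ρ => ?_⟩
  have h1 : ∀ σ, ((z σ).toNat : ℚ) - ((-z σ).toNat : ℚ) = D * a σ * orderOf σ := fun σ => by
    rw [hz]
    have := Int.toNat_sub_toNat_neg (z σ)
    exact_mod_cast this
  have h2 : (Fintype.card G : ℚ) * Module.finrank ℚ (fixedPart ρ ⊤) =
      ∑ g, LinearMap.trace ℚ V (ρ g) := by
    have h3 := card_mul_finrank_fixedPart ρ ⊤
    rw [Fintype.card_congr Subgroup.topEquiv.toEquiv] at h3
    rw [h3]
    exact Fintype.sum_equiv Subgroup.topEquiv.toEquiv _ _ fun _ => rfl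
  have h4 : ∑ σ, a σ * (orderOf σ * Module.finrank ℚ (fixedPart ρ (Subgroup.zpowers σ))) =
      ∑ g, LinearMap.trace ℚ V (ρ g) := by
    have h5 : ∀ σ, (orderOf σ * Module.finrank ℚ (fixedPart ρ (Subgroup.zpowers σ)) : ℚ) =
        ∑ g, if g ∈ Subgroup.zpowers σ then LinearMap.trace ℚ V (ρ g) else 0 := fun σ => by
      rw [← Fintype.card_zpowers, card_mul_finrank_fixedPart, ← Finset.sum_filter]
      exact (Finset.sum_subtype (p := (· ∈ Subgroup.zpowers σ)) (Finset.univ.filter _)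
        (fun x => by simp) (fun g => LinearMap.trace ℚ V (ρ g))).symm
    simp only [h5, Finset.mul_sum]
    rw [Finset.sum_comm]
    refine Finset.sum_congr rfl fun g _ => ?_
    conv_rhs => rw [← one_mul (LinearMap.trace ℚ V (ρ g)), ← ha g, Finset.sum_mul]
    refine Finset.sum_congr rfl fun σ _ => ?_
    split_ifs
    · ring
    · simp
  have h6 : (D * Fintype.card G : ℚ) * Module.finrank ℚ (fixedPart ρ ⊤) =
      ∑ σ, (((z σ).toNat : ℚ) - ((-z σ).toNat : ℚ)) *
        Module.finrank ℚ (fixedPart ρ (Subgroup.zpowers σ)) := by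
    rw [mul_assoc, h2, ← h4, Finset.mul_sum]
    refine Finset.sum_congr rfl fun σ _ => ?_
    rw [h1]
    ring
  simp only [sub_mul, Finset.sum_sub_distrib] at h6
  rw [eq_sub_iff_add_eq] at h6
  exact_mod_cast h6

end Artin


/-! ### Carrying relations between permutation modules to characteristic `p`. -/

section BrauerInvariants

lemma length_eq_finrank (K V : Type*) [Field K] [AddCommGroup V] [Module K V]
    [Module.Finite K V] : Module.length K V = Module.finrank K V := by
  rw [Module.length_eq_rank, ← Module.finrank_eq_rank]
  simp

lemma homLength_eq_equivariantLength {k G M S : Type*} [CommRing k] [Group G] [AddCommGroup M]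
    [Module k M] [Module (MonoidAlgebra k G) M] [IsScalarTower k (MonoidAlgebra k G) M]
    [AddCommGroup S] [Module k S] [Module (MonoidAlgebra k G) S]
    [IsScalarTower k (MonoidAlgebra k G) S] :
    homLength k (MonoidAlgebra k G) M S =
      equivariantLength (k := k) (MonoidAlgebra.of k G) (Representation.ofModule' (k := k) S) M := by
  let f : (M →ₗ[MonoidAlgebra k G] S) →ₗ[k]
      equivariantHom (k := k) (MonoidAlgebra.of k G) (Representation.ofModule' (k := k) S) M :=
    { toFun := fun φ => ⟨φ.restrictScalars k, fun g m => map_smul φ _ m⟩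
      map_add' := fun _ _ => rfl
      map_smul' := fun _ _ => rfl }
  refine LinearEquiv.length_eq (LinearEquiv.ofBijective f ⟨fun φ ψ h => ?_, fun β => ?_⟩)
  · exact LinearMap.ext fun m => LinearMap.congr_fun (congrArg Subtype.val h) m
  · refine ⟨{ toFun := β.1, map_add' := map_add β.1, map_smul' := fun a m => ?_ }, rfl⟩
    rw [RingHom.id_apply]
    induction a using MonoidAlgebra.induction_linear with
    | zero => simp
    | add a b ha hb => rw [add_smul, map_add, ha, hb, add_smul]
    | single g r =>
      have h1 : MonoidAlgebra.single g r = r • MonoidAlgebra.of k G g := by simp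
      rw [h1, smul_assoc, smul_assoc, map_smul, β.2]
      rfl

/-- An equivariant semilinear map of representations is semilinear over the group rings. -/
noncomputable def asModuleMap {R F G P V : Type*} [CommRing R] [CommRing F] [Group G]
    [AddCommMonoid P] [Module R P] [AddCommMonoid V] [Module F V] {ρ : Representation R G P}
    {σ : Representation F G V} {φ : R →+* F} (f : P →ₛₗ[φ] V) (hf : ∀ g p, f (ρ g p) = σ g (f p)) :
    ρ.asModule →ₛₗ[MonoidAlgebra.mapRingHom G φ] σ.asModule where
  toFun m := σ.asModuleEquiv.symm (f (ρ.asModuleEquiv m))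
  map_add' a b := by simp
  map_smul' r m := by
    induction r using MonoidAlgebra.induction_linear with
    | zero => simp
    | add r s hr hs => simp only [add_smul, map_add, hr, hs]
    | single g t =>
      have h1 : MonoidAlgebra.mapRingHom G φ (MonoidAlgebra.single g t) =
          MonoidAlgebra.single g (φ t) := by simp
      apply σ.asModuleEquiv.injective
      simp only [h1, Representation.asModuleEquiv_map_smul, Representation.asAlgebraHom_single,
        LinearMap.smul_apply, map_smulₛₗ, LinearEquiv.apply_symm_apply, hf]
      rfl

lemma asModuleMap_injective {R F G P V : Type*} [CommRing R] [CommRing F] [Group G]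
    [AddCommMonoid P] [Module R P] [AddCommMonoid V] [Module F V] {ρ : Representation R G P}
    {σ : Representation F G V} {φ : R →+* F} (f : P →ₛₗ[φ] V) (hf : ∀ g p, f (ρ g p) = σ g (f p))
    (hinj : Function.Injective f) : Function.Injective (asModuleMap f hf) :=
  hinj

lemma asModuleMap_surjective_up_to_denominators {R F G P V : Type*} [CommRing R] [CommRing F]
    [Group G] [AddCommMonoid P] [Module R P] [AddCommMonoid V] [Module F V] {ρ : Representation R G P}
    {σ : Representation F G V} {φ : R →+* F} (f : P →ₛₗ[φ] V) (hf : ∀ g p, f (ρ g p) = σ g (f p))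
    (h : ∀ v, ∃ r : R, r ≠ 0 ∧ ∃ p, f p = φ r • v) (v : σ.asModule) :
    ∃ r : R, r ≠ 0 ∧ ∃ p, asModuleMap f hf p =
      MonoidAlgebra.mapRingHom G φ (algebraMap R (MonoidAlgebra R G) r) • v := by
  obtain ⟨r, hr, p, hp⟩ := h v
  refine ⟨r, hr, p, ?_⟩
  have : MonoidAlgebra.mapRingHom G φ (algebraMap R (MonoidAlgebra R G) r) =
      algebraMap F (MonoidAlgebra F G) (φ r) := by simp
  rw [this, algebraMap_smul]
  exact hp

/-- The coefficientwise map of finitely supported functions. -/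
noncomputable def finsuppMapRangeₛₗ {R F : Type*} [CommRing R] [CommRing F] (f : R →+* F)
    (X : Type*) : (X →₀ R) →ₛₗ[f] (X →₀ F) where
  toFun a := a.mapRange f (map_zero f)
  map_add' a b := Finsupp.mapRange_add (map_add f) a b
  map_smul' r a := by
    ext x
    simp

lemma finsuppMapRangeₛₗ_permRep {R F : Type*} [CommRing R] [CommRing F] (f : R →+* F)
    {G X : Type*} [Group G] [MulAction G X] (g : G) (a : X →₀ R) :
    finsuppMapRangeₛₗ f X (permRep R G X g a) = permRep F G X g (finsuppMapRangeₛₗ f X a) := by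
  induction a using Finsupp.induction_linear with
  | zero => simp
  | add a b ha hb => rw [map_add, map_add, ha, hb, map_add, map_add]
  | single x t =>
    have h : ∀ (x : X) (t : R), finsuppMapRangeₛₗ f X (Finsupp.single x t) =
      Finsupp.single x (f t) := fun x t =>
      Finsupp.mapRange_single (hf := map_zero f)
    rw [permRep_single, h, h, permRep_single]

lemma finsuppMapRangeₛₗ_surjective_up_to_denominators {R F : Type*} [CommRing R] [IsDomain R]
    [Field F] [Algebra R F] [IsFractionRing R F] (X : Type*) (v : X →₀ F) :
    ∃ r : R, r ≠ 0 ∧ ∃ p, finsuppMapRangeₛₗ (algebraMap R F) X p = algebraMap R F r • v := by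
  induction v using Finsupp.induction_linear with
  | zero => exact ⟨1, one_ne_zero, 0, by simp⟩
  | add a b ha hb =>
    obtain ⟨r, hr, p, hp⟩ := ha
    obtain ⟨s, hs, q, hq⟩ := hb
    refine ⟨r * s, mul_ne_zero hr hs, s • p + r • q, ?_⟩
    rw [map_add, map_smulₛₗ, map_smulₛₗ, hp, hq, map_mul, smul_add, smul_smul, smul_smul, mul_comm]
  | single x t =>
    obtain ⟨⟨c, s⟩, hc⟩ := IsLocalization.surj (nonZeroDivisors R) t
    refine ⟨s, nonZeroDivisors.coe_ne_zero s, Finsupp.single x c, ?_⟩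
    have h : finsuppMapRangeₛₗ (algebraMap R F) X (Finsupp.single x c) =
      Finsupp.single x (algebraMap R F c) :=
      Finsupp.mapRange_single (hf := map_zero _)
    rw [h, Finsupp.smul_single, smul_eq_mul, mul_comm, hc]

lemma exists_injective_permRep {F : Type*} (R : Type*) [CommRing R] [IsDomain R] [Field F]
    [Algebra R F] [IsFractionRing R F] {G X Y : Type*} [Group G] [MulAction G X] [MulAction G Y]
    [Finite X] [Finite Y]
    (e : (permRep F G Y).asModule ≃ₗ[MonoidAlgebra F G] (permRep F G X).asModule) :
    ∃ i : (permRep R G Y).asModule →ₗ[MonoidAlgebra R G] (permRep R G X).asModule,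
      Function.Injective i ∧ ∃ d : R, d ≠ 0 ∧ ∀ p, ∃ q, i q = d • p := by
  have : Module.Finite (MonoidAlgebra R G) (permRep R G X).asModule :=
    have : Module.Finite R (permRep R G X).asModule := inferInstanceAs (Module.Finite R (X →₀ R))
    Module.Finite.of_restrictScalars_finite R _ _
  have : Module.Finite (MonoidAlgebra R G) (permRep R G Y).asModule :=
    have : Module.Finite R (permRep R G Y).asModule := inferInstanceAs (Module.Finite R (Y →₀ R))
    Module.Finite.of_restrictScalars_finite R _ _
  exact exists_injective_of_generic_equiv (R := R) (F := F) (A := MonoidAlgebra R G)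
    (B := MonoidAlgebra F G) (P := (permRep R G X).asModule) (Q := (permRep R G Y).asModule)
    (V := (permRep F G X).asModule) (W := (permRep F G Y).asModule)
    (φ := MonoidAlgebra.mapRingHom G (algebraMap R F)) (fun r => by simp)
    (asModuleMap (finsuppMapRangeₛₗ (algebraMap R F) X) (finsuppMapRangeₛₗ_permRep _))
    (asModuleMap_injective _ _ (Finsupp.mapRange_injective (algebraMap R F) (map_zero _)
      (FaithfulSMul.algebraMap_injective R F)))
    (asModuleMap_surjective_up_to_denominators _ _
      (finsuppMapRangeₛₗ_surjective_up_to_denominators _))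
    (asModuleMap (finsuppMapRangeₛₗ (algebraMap R F) Y) (finsuppMapRangeₛₗ_permRep _))
    (asModuleMap_injective _ _ (Finsupp.mapRange_injective (algebraMap R F) (map_zero _)
      (FaithfulSMul.algebraMap_injective R F)))
    (asModuleMap_surjective_up_to_denominators _ _
      (finsuppMapRangeₛₗ_surjective_up_to_denominators _)) e

variable {G : Type u} [Group G] [Fintype G]

omit [Fintype G] in
lemma equivariantLength_permRep_sigma {k R W : Type*} [CommRing k] [CommRing R] [AddCommGroup W]
    [Module R W] [Algebra k R] [Module k W] [IsScalarTower k R W] (ρ : Representation R G W)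
    {ι : Type*} [Fintype ι] (C : ι → Subgroup G) :
    equivariantLength (k := k) (MonoidAlgebra.of k G) ρ (permRep k G (Σ i, G ⧸ C i)).asModule =
      ∑ i, Module.length R (fixedPart ρ (C i)) := by
  rw [equivariantLength_permRep, length_equivariantMaps_sigma]
  exact Finset.sum_congr rfl fun i _ => length_equivariantMaps_quotient ρ (C i)

/-- Over `ℚ` the hypothesis makes the two permutation modules isomorphic, since semisimple modules
are determined by Hom lengths. Their integral forms are then commensurable, so they have equally
many equivariant maps to `W`, and maps from `ℤ[G/C]` to `W` are the invariants of `C`. -/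
lemma sum_length_fixedPart_eq {ι κ : Type} [Fintype ι] [Fintype κ] (C : ι → Subgroup G)
    (D : κ → Subgroup G)
    (h : ∀ (V : Type u) [AddCommGroup V] [Module ℚ V] [Module.Finite ℚ V]
      (ρ : Representation ℚ G V), ∑ i, Module.finrank ℚ (fixedPart ρ (C i)) =
        ∑ i, Module.finrank ℚ (fixedPart ρ (D i)))
    {R W : Type*} [CommRing R] [AddCommGroup W] [Module R W] (ρ : Representation R G W)
    (hρ : HasTraceOne ρ) (p : ℕ) [Fact p.Prime] (hp : ∀ w : W, (p : ℤ) • w = 0) :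
    ∑ i, Module.length R (fixedPart ρ (C i)) = ∑ i, Module.length R (fixedPart ρ (D i)) := by
  classical
  have e : Nonempty ((permRep ℚ G (Σ i, G ⧸ C i)).asModule ≃ₗ[MonoidAlgebra ℚ G]
      (permRep ℚ G (Σ i, G ⧸ D i)).asModule) := by
    refine nonempty_linearEquiv_of_isSemisimpleModule (R := ℚ) _ ?_ _ _ rfl ?_ ?_
    · rw [length_eq_finrank]
      exact ENat.natCast_ne_top _
    · rw [length_eq_finrank]
      exact ENat.natCast_ne_top _
    · intro S _ _ _ _ _ hS
      rw [Module.length_ne_top_iff, isFiniteLength_iff_isNoetherian_isArtinian] at hS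
      have := hS.1
      rw [homLength_eq_equivariantLength, homLength_eq_equivariantLength,
        equivariantLength_permRep_sigma, equivariantLength_permRep_sigma]
      simp only [length_eq_finrank]
      exact_mod_cast h S _
  obtain ⟨e⟩ := e
  obtain ⟨i, hi, d, hd, hid⟩ := exists_injective_permRep ℤ e.symm
  rw [← equivariantLength_permRep_sigma (k := ℤ), ← equivariantLength_permRep_sigma (k := ℤ)]
  have hpp : Prime (p : ℤ) := Nat.prime_iff_prime_int.1 Fact.out
  have hmax : (Ideal.span {(p : ℤ)}).IsMaximal :=
    PrincipalIdealRing.isMaximal_of_irreducible hpp.irreducible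
  -- The commensurability constant is split into its `p`-part and a factor prime to `p`, the form
  -- needed by `equivariantLength_eq`.
  obtain ⟨m, d', hd', rfl⟩ : ∃ (m : ℕ) (d' : ℤ), ¬ (p : ℤ) ∣ d' ∧ d = (p : ℤ) ^ m * d' := by
    have h1 := (Int.finiteMultiplicity_iff (a := (p : ℤ)) (b := d)).2 ⟨by simpa using (Fact.out : p.Prime).ne_one, hd⟩
    obtain ⟨c, hc, hc'⟩ := h1.exists_eq_pow_mul_and_not_dvd
    exact ⟨_, c, hc', hc⟩
  exact (equivariantLength_eq (MonoidAlgebra.of ℤ G) hρ (p : ℤ) hp m d'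
    ((hpp.coprime_iff_not_dvd.2 hd').symm)
    (fun x hx => by
      have h2 : ∀ y : (Σ i, G ⧸ C i) →₀ ℤ, (p : ℤ) • y = 0 → y = 0 := fun y hy =>
        (smul_eq_zero.1 hy).resolve_left hpp.ne_zero
      exact h2 x hx) i hi hid).symm

end BrauerInvariants


/-! ### Reduction to cyclic subgroups of order prime to `p`, and Higman's criterion. -/

section Swan

/-- Take `p ^ n` to be the exact power of `p` in the order of `σ`. Then `σ ^ p ^ n` has order prime
to `p`, its invariants are `p ^ n` times as long as those of `σ` in both representations, and `p ^
n` cancels. -/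
lemma length_fixedPart_zpowers_eq {G : Type*} [Group G] [Fintype G] {R W W' : Type*} [CommRing R]
    [AddCommGroup W] [Module R W] [AddCommGroup W'] [Module R W'] {ρ : Representation R G W}
    {ρ' : Representation R G W'} (hρ : HasTraceOne ρ) (hρ' : HasTraceOne ρ') (p : ℕ)
    [Fact p.Prime] (hp : ∀ w : W, (p : ℤ) • w = 0) (hp' : ∀ w : W', (p : ℤ) • w = 0)
    (h : ∀ σ : G, ¬ p ∣ orderOf σ → Module.length R (fixedPart ρ (Subgroup.zpowers σ)) =
      Module.length R (fixedPart ρ' (Subgroup.zpowers σ))) (σ : G) :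
    Module.length R (fixedPart ρ (Subgroup.zpowers σ)) =
      Module.length R (fixedPart ρ' (Subgroup.zpowers σ)) := by
  have hpp : p.Prime := Fact.out
  obtain ⟨n, d, hd, hσ⟩ := Nat.exists_eq_pow_mul_and_not_dvd (orderOf_pos σ).ne' p hpp.ne_one
  have hdvd : p ^ n ∣ orderOf σ := ⟨d, hσ⟩
  have hq : p ^ n ≠ 0 := pow_ne_zero _ hpp.ne_zero
  have h1 := length_fixedPart_zpowers ρ hρ hp σ n hdvd
  have h2 := length_fixedPart_zpowers ρ' hρ' hp' σ n hdvd
  have h3 : orderOf (σ ^ p ^ n) = d := by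
    rw [orderOf_pow_of_dvd hq hdvd, hσ, Nat.mul_div_cancel_left _ (Nat.pos_of_ne_zero hq)]
  rw [h _ (h3 ▸ hd), h2] at h1
  exact (ENat.mul_right_strictMono (by exact_mod_cast hq) (ENat.natCast_ne_top _)).injective h1.symm

/-- Multiplicities are realized as index types `Fin (n σ)`. Relabelling `G` by `Fin r` puts the
total index type in `Type`, where `sum_length_fixedPart_eq` expects it. -/
lemma sum_sigma_fin {G M : Type*} [Group G] [Fintype G] [AddCommMonoid M] (n : G → ℕ)
    {r : ℕ} (e : G ≃ Fin r) (f : Subgroup G → M) :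
    ∑ x : Σ i, Fin (n (e.symm i)), f (Subgroup.zpowers (e.symm x.1)) =
      ∑ σ, n σ • f (Subgroup.zpowers σ) := by
  rw [Fintype.sum_sigma, ← Equiv.sum_comp e.symm]
  refine Finset.sum_congr rfl fun i _ => ?_
  change ∑ _ : Fin (n (e.symm i)), f (Subgroup.zpowers (e.symm i)) = _
  rw [Finset.sum_const, Finset.card_univ, Fintype.card_fin]

lemma sum_sumElim_sigma_fin {G M : Type*} [Group G] [Fintype G] [AddCommMonoid M] (N : ℕ)
    (n : G → ℕ) {r : ℕ} (e : G ≃ Fin r) (f : Subgroup G → M) :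
    ∑ x : Fin N ⊕ Σ i, Fin (n (e.symm i)),
      f (Sum.elim (fun _ => ⊤) (fun x => Subgroup.zpowers (e.symm x.1)) x) =
      N • f ⊤ + ∑ σ, n σ • f (Subgroup.zpowers σ) := by
  rw [Fintype.sum_sum_type, ← sum_sigma_fin n e]
  congr 1
  change ∑ _ : Fin N, f ⊤ = _
  rw [Finset.sum_const, Finset.card_univ, Fintype.card_fin]

lemma length_artin_relation {G : Type u} [Group G] [Fintype G] {N : ℕ} {m n : G → ℕ}
    (hrel : ∀ (V : Type u) [AddCommGroup V] [Module ℚ V] [Module.Finite ℚ V]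
      (ρ : Representation ℚ G V),
      N * Module.finrank ℚ (fixedPart ρ ⊤) +
          ∑ σ, m σ * Module.finrank ℚ (fixedPart ρ (Subgroup.zpowers σ)) =
        ∑ σ, n σ * Module.finrank ℚ (fixedPart ρ (Subgroup.zpowers σ)))
    {R W : Type*} [CommRing R] [AddCommGroup W] [Module R W] (ρ : Representation R G W)
    (hρ : HasTraceOne ρ) (p : ℕ) [Fact p.Prime] (hp : ∀ w : W, (p : ℤ) • w = 0) :
    N * Module.length R (fixedPart ρ ⊤) +
        ∑ σ, m σ * Module.length R (fixedPart ρ (Subgroup.zpowers σ)) =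
      ∑ σ, n σ * Module.length R (fixedPart ρ (Subgroup.zpowers σ)) := by
  let e := Fintype.equivFin G
  have key := sum_length_fixedPart_eq (ι := Fin N ⊕ Σ i, Fin (m (e.symm i)))
    (κ := Σ i, Fin (n (e.symm i)))
    (Sum.elim (fun _ => ⊤) (fun x => Subgroup.zpowers (e.symm x.1)))
    (fun x => Subgroup.zpowers (e.symm x.1))
    (fun V _ _ _ ρ => by
      rw [sum_sumElim_sigma_fin N m _ (fun H => Module.finrank ℚ (fixedPart ρ H)),
        sum_sigma_fin n _ (fun H => Module.finrank ℚ (fixedPart ρ H))]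
      simpa using hrel V ρ) ρ hρ p hp
  rw [sum_sumElim_sigma_fin N m _ (fun H => Module.length R (fixedPart ρ H)),
    sum_sigma_fin n _ (fun H => Module.length R (fixedPart ρ H))] at key
  simpa using key

/-- For representations in characteristic `p` satisfying Higman's criterion, the length of the
invariants is determined by the lengths of the invariants under cyclic subgroups of order prime to
`p`. -/
lemma length_fixedPart_top_eq {G : Type u} [Group G] [Fintype G] {R W W' : Type*} [CommRing R]
    [AddCommGroup W] [Module R W] [AddCommGroup W'] [Module R W'] {ρ : Representation R G W}
    {ρ' : Representation R G W'} (hρ : HasTraceOne ρ) (hρ' : HasTraceOne ρ') (p : ℕ)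
    [Fact p.Prime] (hp : ∀ w : W, (p : ℤ) • w = 0) (hp' : ∀ w : W', (p : ℤ) • w = 0)
    (hW : Module.length R W ≠ ⊤)
    (h : ∀ σ : G, ¬ p ∣ orderOf σ → Module.length R (fixedPart ρ (Subgroup.zpowers σ)) =
      Module.length R (fixedPart ρ' (Subgroup.zpowers σ))) :
    Module.length R (fixedPart ρ ⊤) = Module.length R (fixedPart ρ' ⊤) := by
  obtain ⟨N, hN, m, n, hrel⟩ := exists_artin_relation.{u} G
  have h1 := length_artin_relation hrel ρ hρ p hp
  have h2 := length_artin_relation hrel ρ' hρ' p hp'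
  simp only [← length_fixedPart_zpowers_eq hρ hρ' p hp hp' h] at h2
  rw [← h1] at h2
  -- Only finite terms cancel in `ℕ∞`; this is where the finite length of `W` enters.
  have hfin : ∀ H, Module.length R (fixedPart ρ H) ≠ ⊤ := fun H =>
    ne_top_of_le_ne_top hW (Module.length_le_of_injective (Submodule.subtype _)
      (Submodule.subtype_injective _))
  have hsum : ∑ σ, (m σ : ℕ∞) * Module.length R (fixedPart ρ (Subgroup.zpowers σ)) ≠ ⊤ :=
    ENat.sum_ne_top.2 fun σ _ => WithTop.mul_ne_top (ENat.natCast_ne_top _) (hfin _)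
  have h3 := (ENat.add_left_injective_of_ne_top hsum) h2
  exact ((ENat.mul_right_strictMono (by exact_mod_cast hN) (ENat.natCast_ne_top _)).injective h3).symm

variable {R G : Type*} [CommRing R] [Group G] [Fintype G]

/-- On `RG` let `θ` keep only the coefficient at `1`; its conjugate by `g` keeps the coefficient at
`g`, and these add up to the identity. Free modules inherit `θ` coordinatewise, and a direct summand
inherits it because the splitting commutes with `G`. -/
lemma exists_trace_eq_one_of_projective (P : Type*) [AddCommGroup P] [Module R P]
    [Module (MonoidAlgebra R G) P] [IsScalarTower R (MonoidAlgebra R G) P]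
    [Module.Projective (MonoidAlgebra R G) P] :
    ∃ θ : P →ₗ[R] P, ∀ x, ∑ g, MonoidAlgebra.of R G g • θ (MonoidAlgebra.of R G g⁻¹ • x) = x := by
  classical
  obtain ⟨s, hs⟩ := Module.projective_def'.1 ‹Module.Projective (MonoidAlgebra R G) P›
  let c : MonoidAlgebra R G →ₗ[R] MonoidAlgebra R G :=
    (MonoidAlgebra.lsingle 1) ∘ₗ (Finsupp.lapply 1) ∘ₗ
      (MonoidAlgebra.coeffLinearEquiv R).toLinearMap
  have hc : ∀ a : MonoidAlgebra R G, ∑ g, MonoidAlgebra.of R G g * c (MonoidAlgebra.of R G g⁻¹ * a) = a := by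
    intro a
    have h1 : ∀ g, MonoidAlgebra.of R G g * c (MonoidAlgebra.of R G g⁻¹ * a) =
        MonoidAlgebra.single g (a.coeff g) := by
      intro g
      have h2 : c (MonoidAlgebra.of R G g⁻¹ * a) = MonoidAlgebra.single 1 (a.coeff g) := by
        change MonoidAlgebra.single 1 ((MonoidAlgebra.of R G g⁻¹ * a).coeff 1) = _
        rw [MonoidAlgebra.of_apply]
        congr 1
        simp
      rw [h2, MonoidAlgebra.of_apply, MonoidAlgebra.single_mul_single, mul_one, one_mul]
    simp only [h1]
    ext x
    simp [MonoidAlgebra.coeff_sum]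
  let θ₀ : (P →₀ MonoidAlgebra R G) →ₗ[R] (P →₀ MonoidAlgebra R G) := Finsupp.mapRange.linearMap c
  have hθ₀ : ∀ a, ∑ g, MonoidAlgebra.of R G g • θ₀ (MonoidAlgebra.of R G g⁻¹ • a) = a := by
    intro a
    ext1 x
    rw [Finsupp.finsetSum_apply]
    exact hc (a x)
  let π := Finsupp.linearCombination (MonoidAlgebra R G) (id : P → P)
  refine ⟨(π.restrictScalars R) ∘ₗ θ₀ ∘ₗ (s.restrictScalars R), fun x => ?_⟩
  have h1 := congrArg π (hθ₀ (s x))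
  rw [map_sum, show π (s x) = x from LinearMap.congr_fun hs x] at h1
  conv_rhs => rw [← h1]
  refine Finset.sum_congr rfl fun g _ => ?_
  rw [map_smul π, ← map_smul s]
  rfl

omit [Fintype G] in
/-- The equivariant homomorphisms are the invariants of the conjugation action. -/
lemma equivariantLength_eq_length_fixedPart {P S : Type*} [AddCommGroup P] [Module R P]
    [Module (MonoidAlgebra R G) P] [IsScalarTower R (MonoidAlgebra R G) P] [AddCommGroup S]
    [Module R S] [Module (MonoidAlgebra R G) S] [IsScalarTower R (MonoidAlgebra R G) S]
    (H : Subgroup G) :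
    Module.length R (fixedPart (Representation.linHom (Representation.ofModule' (k := R) (G := G) P)
      (Representation.ofModule' (k := R) (G := G) S)) H) =
      equivariantLength (k := R) ((MonoidAlgebra.of R G).comp H.subtype)
        ((Representation.ofModule' (k := R) (G := G) S).comp H.subtype) P := by
  have h : fixedPart (Representation.linHom (Representation.ofModule' (k := R) (G := G) P)
      (Representation.ofModule' (k := R) (G := G) S)) H =
      equivariantHom ((MonoidAlgebra.of R G).comp H.subtype)
        ((Representation.ofModule' (k := R) (G := G) S).comp H.subtype) P := by
    ext β
    have hP : ∀ (g : G) (x : P), Representation.ofModule' (k := R) P g x =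
      MonoidAlgebra.of R G g • x := fun _ _ => rfl
    constructor
    · intro h g x
      have h1 := LinearMap.congr_fun (h g g.2) (MonoidAlgebra.of R G g • x)
      rw [Representation.linHom_apply, LinearMap.comp_apply, LinearMap.comp_apply, hP, smul_smul,
        ← map_mul, inv_mul_cancel, map_one, one_smul] at h1
      exact h1.symm
    · intro h g hg
      ext x
      have h1 := h ⟨g, hg⟩ (MonoidAlgebra.of R G g⁻¹ • x)
      rw [Representation.linHom_apply, LinearMap.comp_apply, LinearMap.comp_apply, hP]
      refine h1.symm.trans ?_
      congr 1
      change MonoidAlgebra.of R G g • MonoidAlgebra.of R G g⁻¹ • x = x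
      rw [smul_smul, ← map_mul, mul_inv_cancel, map_one, one_smul]
  rw [h]
  rfl

/-- Precompose with the `θ` of `P`: in each conjugate the two actions on the target cancel, leaving
`w ∘ g θ g⁻¹`. The representation on `S` is therefore arbitrary. -/
lemma hasTraceOne_linHom {P S : Type*} [AddCommGroup P] [Module R P]
    [Module (MonoidAlgebra R G) P] [IsScalarTower R (MonoidAlgebra R G) P] [AddCommGroup S]
    [Module R S] (ρ : Representation R G S) [Module.Projective (MonoidAlgebra R G) P] :
    HasTraceOne (Representation.linHom (Representation.ofModule' (k := R) (G := G) P) ρ) := by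
  obtain ⟨θ, hθ⟩ := exists_trace_eq_one_of_projective (R := R) (G := G) P
  refine ⟨LinearMap.lcomp R S θ, fun w => ?_⟩
  ext x
  have h1 : ∀ (g : G) (x : P), Representation.ofModule' (k := R) P g x =
    MonoidAlgebra.of R G g • x := fun _ _ => rfl
  conv_rhs => rw [← hθ x, map_sum]
  rw [LinearMap.sum_apply]
  refine Finset.sum_congr rfl fun g _ => ?_
  simp only [Representation.linHom_apply, LinearMap.comp_apply, LinearMap.lcomp_apply, h1,
    inv_inv]
  rw [← Module.End.mul_apply, ← map_mul, mul_inv_cancel, map_one, Module.End.one_apply]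

end Swan


/-! ### Swan's theorem over a local principal ideal domain. -/

section Swan

open IsLocalRing

/-- The trivial Higman element of a representation of a group whose order is invertible. -/
lemma hasTraceOne_of_isUnit_card {R H S : Type*} [CommRing R] [Group H] [Fintype H]
    [AddCommGroup S] [Module R S] (ρ : Representation R H S)
    (h : IsUnit (Fintype.card H : R)) : HasTraceOne ρ := by
  obtain ⟨c, hc⟩ := h
  refine ⟨((c⁻¹ : Rˣ) : R) • LinearMap.id, fun w => ?_⟩
  have h1 : ∀ g, ρ g ((((c⁻¹ : Rˣ) : R) • LinearMap.id : S →ₗ[R] S) (ρ g⁻¹ w)) =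
      ((c⁻¹ : Rˣ) : R) • w := fun g => by
    rw [LinearMap.smul_apply, LinearMap.id_apply, map_smul, ← Module.End.mul_apply, ← map_mul,
      mul_inv_cancel, map_one, Module.End.one_apply]
  rw [Finset.sum_congr rfl fun g _ => h1 g, Finset.sum_const, Finset.card_univ,
    ← Nat.cast_smul_eq_nsmul R, ← hc, smul_smul, Units.mul_inv, one_smul]

lemma projective_of_projective_algebra {R A P : Type*} [CommRing R] [Ring A] [Algebra R A]
    [Module.Free R A] [AddCommGroup P] [Module R P] [Module A P] [IsScalarTower R A P]
    [Module.Projective A P] : Module.Projective R P := by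
  obtain ⟨s, hs⟩ := Module.projective_def'.1 ‹Module.Projective A P›
  exact Module.Projective.of_split (s.restrictScalars R)
    ((Finsupp.linearCombination A (id : P → P)).restrictScalars R)
    (LinearMap.ext fun x => LinearMap.congr_fun hs x)

variable {R : Type u} [CommRing R] [IsDomain R] [IsLocalRing R] [IsPrincipalIdealRing R]
  {G : Type u} [Group G] [Fintype G]
  {P Q : Type u} [AddCommGroup P] [Module R P]
    [Module (MonoidAlgebra R G) P] [IsScalarTower R (MonoidAlgebra R G) P] [AddCommGroup Q]
    [Module R Q] [Module (MonoidAlgebra R G) Q] [IsScalarTower R (MonoidAlgebra R G) Q]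

-- In a discrete valuation ring `d` is a unit times a power of the uniformizer, so the coprime
-- factor in `equivariantLength_eq` is that unit. The trace condition on `S` is averaging over `H`,
-- whose order is invertible.
omit [Fintype G] in
lemma equivariantLength_eq_of_commensurable (hR : ¬ IsField R) {S : Type*} [AddCommGroup S]
    [Module R S] (hS : Module.IsTorsionBySet R S (maximalIdeal R)) {H : Type*} [Group H] [Fintype H]
    (hH : IsUnit (Fintype.card H : R)) (u : H →* MonoidAlgebra R G) (ρ : Representation R H S)
    [Module.IsTorsionFree R P] (i : Q →ₗ[MonoidAlgebra R G] P) (hi : Function.Injective i)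
    (d : R) (hd : d ≠ 0) (h : ∀ p, ∃ q, i q = d • p) :
    equivariantLength (k := R) u ρ P = equivariantLength (k := R) u ρ Q := by
  have : IsDiscreteValuationRing R := { not_a_field' := fun h => hR (isField_iff_maximalIdeal_eq.2 h) }
  obtain ⟨π, hπ⟩ := IsDiscreteValuationRing.exists_irreducible R
  have hmax : maximalIdeal R = Ideal.span {π} := hπ.maximalIdeal_eq
  have : (Ideal.span {π}).IsMaximal := hmax ▸ maximalIdeal.isMaximal R
  obtain ⟨n, c, rfl⟩ := IsDiscreteValuationRing.eq_unit_mul_pow_irreducible hd hπ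
  refine (equivariantLength_eq u (hasTraceOne_of_isUnit_card ρ hH) π
    (fun w => @hS w ⟨π, hmax ▸ Ideal.mem_span_singleton_self π⟩) n (c : R)
    ⟨((c⁻¹ : Rˣ) : R), 0, by simp⟩ (fun x hx => ?_) i hi ?_).symm
  · exact (smul_eq_zero.1 hx).resolve_left hπ.ne_zero
  · intro x
    rw [mul_comm]
    exact h x

omit [Fintype G] [IsDomain R] [IsLocalRing R] [IsPrincipalIdealRing R] in
lemma homLength_eq_length_fixedPart_top (S : Type*) [AddCommGroup S] [Module R S]
    [Module (MonoidAlgebra R G) S] [IsScalarTower R (MonoidAlgebra R G) S] :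
    homLength R (MonoidAlgebra R G) P S =
      Module.length R (fixedPart (Representation.linHom
        (Representation.ofModule' (k := R) (G := G) P)
        (Representation.ofModule' (k := R) (G := G) S)) ⊤) := by
  rw [homLength_eq_equivariantLength, equivariantLength_eq_length_fixedPart]
  have h : equivariantHom (k := R) ((MonoidAlgebra.of R G).comp (⊤ : Subgroup G).subtype)
      ((Representation.ofModule' (k := R) (G := G) S).comp (⊤ : Subgroup G).subtype) P =
      equivariantHom (MonoidAlgebra.of R G) (Representation.ofModule' (k := R) (G := G) S) P := by
    ext β
    exact ⟨fun h g m => h ⟨g, trivial⟩ m, fun h g m => h g.1 m⟩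
  unfold equivariantLength
  rw [h]

/-- Swan's theorem: finitely generated projective modules over the group ring of a local
principal ideal domain which become isomorphic over the fraction field are isomorphic. -/
theorem nonempty_linearEquiv_of_commensurable [Module.Finite (MonoidAlgebra R G) P]
    [Module.Finite (MonoidAlgebra R G) Q] [Module.Projective (MonoidAlgebra R G) P]
    [Module.Projective (MonoidAlgebra R G) Q] (i : Q →ₗ[MonoidAlgebra R G] P)
    (hi : Function.Injective i)
    (d : R) (hd : d ≠ 0) (h : ∀ p, ∃ q, i q = d • p) :
    Nonempty (P ≃ₗ[MonoidAlgebra R G] Q) := by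
  have hPfin : Module.Finite R P := Module.Finite.trans (MonoidAlgebra R G) P
  have hPfree : Module.IsTorsionFree R P := by
    have : Module.Projective R P := projective_of_projective_algebra (A := MonoidAlgebra R G)
    infer_instance
  by_cases hR : IsField R
  · obtain ⟨c, hc⟩ := hR.mul_inv_cancel hd
    refine ⟨(LinearEquiv.ofBijective i ⟨hi, fun p => ?_⟩).symm⟩
    obtain ⟨q, hq⟩ := h (c • p)
    exact ⟨q, by rw [hq, smul_smul, hc, one_smul]⟩
  refine nonempty_linearEquiv_of_projective (R := R) fun S _ _ _ _ hS hSfin => ?_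
  -- Averaging over `G` itself is enough in this case. It includes residue characteristic zero, so
  -- that afterwards `p` is a prime.
  by_cases hunit : IsUnit (Fintype.card G : R)
  · rw [homLength_eq_equivariantLength, homLength_eq_equivariantLength]
    exact equivariantLength_eq_of_commensurable hR hS hunit _ _ i hi d hd h
  obtain ⟨p, hp⟩ := CharP.exists (ResidueField R)
  have hres : ∀ n : ℕ, IsUnit (n : R) ↔ ¬ p ∣ n := fun n => by
    rw [← CharP.cast_eq_zero_iff (ResidueField R) p n, ← map_natCast (residue R),
      residue_eq_zero_iff, mem_maximalIdeal, mem_nonunits_iff, not_not]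
  have hp0 : p ≠ 0 := by
    rintro rfl
    rw [hres, zero_dvd_iff] at hunit
    exact hunit Fintype.card_ne_zero
  have hpp : Fact p.Prime := ⟨(CharP.char_is_prime_or_zero (ResidueField R) p).resolve_right hp0⟩
  have hpS : ∀ s : S, (p : ℤ) • s = 0 := fun s => by
    have h1 : (p : R) ∈ maximalIdeal R := by
      rw [mem_maximalIdeal, mem_nonunits_iff, hres, not_not]
    have h2 := @hS s ⟨(p : R), h1⟩
    rw [natCast_zsmul, ← Nat.cast_smul_eq_nsmul R]
    exact h2
  -- The representations compared are `Hom_R(P, S)` and `Hom_R(Q, S)` with conjugation action.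
  -- Projectivity of `P` and `Q` supplies the trace condition for `G`, and for cyclic subgroups of
  -- order prime to `p` the order is a unit of `R`.
  have key := length_fixedPart_top_eq
    (hasTraceOne_linHom (P := P) (Representation.ofModule' (k := R) (G := G) S))
    (hasTraceOne_linHom (P := Q) (Representation.ofModule' (k := R) (G := G) S)) p
    (fun w => LinearMap.ext fun x => hpS (w x)) (fun w => LinearMap.ext fun x => hpS (w x)) ?_ ?_
  · rw [homLength_eq_length_fixedPart_top, homLength_eq_length_fixedPart_top, key]
  · exact length_linearMap_ne_top (length_ne_top_of_isTorsionBy hS)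
  · intro σ hσ
    rw [equivariantLength_eq_length_fixedPart, equivariantLength_eq_length_fixedPart]
    refine equivariantLength_eq_of_commensurable hR hS ?_ _ _ i hi d hd h
    rw [hres, Fintype.card_zpowers]
    exact hσ

end Swan


/-! ### Equality and cofinality in Grothendieck groups. -/

section Heller

universe w v
variable {C : Type v} [Category.{w} C] [Abelian C]

lemma shortExact_biprod_map {S T : ShortComplex C} (hS : S.ShortExact) (hT : T.ShortExact) :
    (ShortComplex.mk (biprod.map S.f T.f) (biprod.map S.g T.g)
      (by ext <;> simp)).ShortExact := by
  have := hS.mono_f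
  have := hS.epi_g
  have := hT.mono_f
  have := hT.epi_g
  refine { exact := ShortComplex.exact_of_f_is_kernel _ (KernelFork.IsLimit.ofι' _ _
    fun {A} k hk => ⟨biprod.lift (hS.exact.lift (k ≫ biprod.fst) ?_)
      (hT.exact.lift (k ≫ biprod.snd) ?_), ?_⟩), mono_f := ?_, epi_g := ?_ }
  · have := congrArg (· ≫ biprod.fst) hk
    simpa using this
  · have := congrArg (· ≫ biprod.snd) hk
    simpa using this
  · ext <;> simp [ShortComplex.Exact.lift_f]
  · dsimp
    infer_instance
  · dsimp
    infer_instance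

variable {P : ObjectProperty C}

lemma K0.of_shortExact (S : ShortComplex C) (hS : S.ShortExact) (h₁ : P S.X₁) (h₂ : P S.X₂)
    (h₃ : P S.X₃) : (K0.of S.X₂ h₂ : K0 P) = K0.of S.X₁ h₁ + K0.of S.X₃ h₃ := by
  rw [← sub_eq_zero, ← sub_sub]
  exact (QuotientAddGroup.eq_zero_iff _).2 (AddSubgroup.subset_closure ⟨S, hS, h₁, h₂, h₃, rfl⟩)

lemma K0.of_biprod (A B : C) (hA : P A) (hB : P B) (hAB : P (A ⊞ B)) :
    (K0.of (A ⊞ B) hAB : K0 P) = K0.of A hA + K0.of B hB :=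
  K0.of_shortExact (ShortComplex.mk (biprod.inl : A ⟶ A ⊞ B) biprod.snd (by simp))
    (ShortComplex.Splitting.ofHasBinaryBiproduct A B).shortExact hA hAB hB

/-- A zero object `Z` satisfying `P` lets an isomorphism be viewed as a short exact sequence with
third term `Z`; comparison with the identity removes the class of `Z`. -/
lemma K0.of_iso (hz : ∃ Z, IsZero Z ∧ P Z) {A B : C} (e : A ≅ B) (hA : P A) (hB : P B) :
    (K0.of A hA : K0 P) = K0.of B hB := by
  obtain ⟨Z, hZ, hPZ⟩ := hz
  have h0 : ∀ {A B : C} (e : A ≅ B) (hA : P A) (hB : P B),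
      (K0.of B hB : K0 P) = K0.of A hA + K0.of Z hPZ := fun {A B} e hA hB =>
    K0.of_shortExact (ShortComplex.mk e.hom (hZ.from_ B) (hZ.eq_of_tgt _ _))
      { exact := (ShortComplex.exact_iff_epi _ (hZ.eq_of_tgt _ _)).2 inferInstance
        mono_f := inferInstance
        epi_g := ⟨fun _ _ _ => hZ.eq_of_src _ _⟩ } hA hB hPZ
  have h1 := h0 (Iso.refl A) hA hA
  rw [h0 e hA hB, ← h1]

lemma K0.exists_sub (hz : ∃ Z, IsZero Z ∧ P Z) (hsum : ∀ A B, P A → P B → P (A ⊞ B)) (z : K0 P) :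
    ∃ (A B : C) (hA : P A) (hB : P B), z = K0.of A hA - K0.of B hB := by
  obtain ⟨Z, hZ, hPZ⟩ := hz
  obtain ⟨z, rfl⟩ := QuotientAddGroup.mk_surjective z
  have hZ0 : (K0.of Z hPZ : K0 P) = 0 := by
    have h := K0.of_biprod Z Z hPZ hPZ (hsum _ _ hPZ hPZ)
    rw [← K0.of_iso ⟨Z, hZ, hPZ⟩ (hZ.iso (by simpa [biprod_isZero_iff] using hZ)) hPZ] at h
    simpa using h
  induction z using FreeAbelianGroup.induction_on with
  | zero => exact ⟨Z, Z, hPZ, hPZ, by simp; rfl⟩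
  | of A => exact ⟨A.obj, Z, A.property, hPZ, by rw [hZ0, sub_zero]; rfl⟩
  | neg A => exact ⟨Z, A.obj, hPZ, A.property, by rw [hZ0, zero_sub]; rfl⟩
  | add x y hx hy =>
    obtain ⟨A, B, hA, hB, h⟩ := hx
    obtain ⟨A', B', hA', hB', h'⟩ := hy
    refine ⟨A ⊞ A', B ⊞ B', hsum _ _ hA hA', hsum _ _ hB hB', ?_⟩
    rw [K0.of_biprod A A' hA hA', K0.of_biprod B B' hB hB', add_sub_add_comm, ← h, ← h']
    rfl

variable (P) in
/-- Isomorphism of objects, as an equivalence relation. -/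
def isoSetoid : Setoid P.FullSubcategory where
  r A B := Nonempty (A.obj ≅ B.obj)
  iseqv := ⟨fun _ => ⟨Iso.refl _⟩, fun ⟨e⟩ => ⟨e.symm⟩, fun ⟨e⟩ ⟨f⟩ => ⟨e.trans f⟩⟩

/-- The commutative monoid of isomorphism classes, with respect to direct sums. -/
@[reducible]
noncomputable def isoClassMonoid (hz : ∃ Z, IsZero Z ∧ P Z)
    (hsum : ∀ A B, P A → P B → P (A ⊞ B)) : AddCommMonoid (_root_.Quotient (isoSetoid P)) :=
  let _ : Add (_root_.Quotient (isoSetoid P)) :=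
    ⟨Quotient.map₂ (fun A B => ⟨A.obj ⊞ B.obj, hsum _ _ A.property B.property⟩)
      (fun _ _ ⟨e⟩ _ _ ⟨f⟩ => ⟨biprod.mapIso e f⟩)⟩
  let _ : Zero (_root_.Quotient (isoSetoid P)) := ⟨⟦⟨hz.choose, hz.choose_spec.2⟩⟧⟩
  { add_assoc := by
      rintro ⟨A⟩ ⟨B⟩ ⟨D⟩
      exact Quotient.sound ⟨biprod.associator _ _ _⟩
    add_comm := by
      rintro ⟨A⟩ ⟨B⟩
      exact Quotient.sound ⟨biprod.braiding _ _⟩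
    zero_add := by
      rintro ⟨A⟩
      exact Quotient.sound ⟨(isoZeroBiprod hz.choose_spec.1).symm⟩
    add_zero := by
      rintro ⟨A⟩
      exact Quotient.sound ⟨(isoBiprodZero hz.choose_spec.1).symm⟩
    nsmul := nsmulRec }

lemma shortExact_biprod_right {S : ShortComplex C} (hS : S.ShortExact) (D : C) :
    (ShortComplex.mk (S.f ≫ biprod.inl : S.X₁ ⟶ S.X₂ ⊞ D) (biprod.map S.g (𝟙 D))
      (by ext <;> simp)).ShortExact := by
  have := hS.mono_f
  have := hS.epi_g
  refine { exact := ShortComplex.exact_of_f_is_kernel _ (KernelFork.IsLimit.ofι' _ _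
    fun {A} k hk => ⟨hS.exact.lift (k ≫ biprod.fst) ?_, ?_⟩), mono_f := ?_, epi_g := ?_ }
  · have := congrArg (· ≫ biprod.fst) hk
    simpa using this
  · have h := congrArg (· ≫ biprod.snd) hk
    ext
    · simp [ShortComplex.Exact.lift_f_assoc]
    · simpa using h.symm
  · dsimp
    exact mono_comp _ _
  · dsimp
    infer_instance

/-- Heller's criterion for the equality of two classes in a Grothendieck group. -/
theorem K0.exists_of_eq (hz : ∃ Z, IsZero Z ∧ P Z) (hsum : ∀ A B, P A → P B → P (A ⊞ B))
    {A B : C} {hA : P A} {hB : P B} (h : (K0.of A hA : K0 P) = K0.of B hB) :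
    ∃ (U V E E' : C) (_ : P U) (_ : P V) (_ : P E) (_ : P E') (i : U ⟶ E) (p : E ⟶ V)
      (i' : U ⟶ E') (p' : E' ⟶ V) (w : i ≫ p = 0) (w' : i' ≫ p' = 0),
      (ShortComplex.mk i p w).ShortExact ∧ (ShortComplex.mk i' p' w').ShortExact ∧
        Nonempty (A ⊞ E ≅ B ⊞ E') := by
  let _ := isoClassMonoid hz hsum
  let γ : P.FullSubcategory → Algebra.GrothendieckAddGroup (_root_.Quotient (isoSetoid P)) := fun A =>
    Algebra.GrothendieckAddGroup.of ⟦A⟧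
  have hγ : ∀ A B : P.FullSubcategory,
      γ ⟨A.obj ⊞ B.obj, hsum _ _ A.property B.property⟩ = γ A + γ B := fun A B =>
    map_add Algebra.GrothendieckAddGroup.of (⟦A⟧ : _root_.Quotient (isoSetoid P)) ⟦B⟧
  let φ := FreeAbelianGroup.lift γ
  -- In the group completion of the monoid of isomorphism classes, every relation is `[E] - [E']`
  -- for two extensions with the same ends. A generator compares an extension with the split one,
  -- sums are formed termwise, and negation exchanges `E` and `E'`.
  have key : ∀ z ∈ K0Relations P,
      ∃ (U V E E' : C) (_ : P U) (_ : P V) (hE : P E) (hE' : P E') (i : U ⟶ E) (p : E ⟶ V)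
      (i' : U ⟶ E') (p' : E' ⟶ V) (w : i ≫ p = 0) (w' : i' ≫ p' = 0),
      (ShortComplex.mk i p w).ShortExact ∧ (ShortComplex.mk i' p' w').ShortExact ∧
        φ z = γ ⟨E, hE⟩ - γ ⟨E', hE'⟩ := by
    intro z hz'
    induction hz' using AddSubgroup.closure_induction with
    | mem x hx =>
      obtain ⟨S, hS, h₁, h₂, h₃, rfl⟩ := hx
      refine ⟨S.X₁, S.X₃, S.X₂, S.X₁ ⊞ S.X₃, h₁, h₃, h₂, hsum _ _ h₁ h₃, S.f, S.g, biprod.inl,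
        biprod.snd, S.zero, by simp, hS,
        (ShortComplex.Splitting.ofHasBinaryBiproduct S.X₁ S.X₃).shortExact, ?_⟩
      rw [hγ ⟨S.X₁, h₁⟩ ⟨S.X₃, h₃⟩]
      simp only [φ, map_sub, FreeAbelianGroup.lift_apply_of]
      abel
    | zero =>
      obtain ⟨Z, hZ, hPZ⟩ := hz
      have hs : (ShortComplex.mk (0 : Z ⟶ Z) (0 : Z ⟶ Z) (by simp)).ShortExact :=
        { exact := ShortComplex.exact_of_isZero_X₂ _ hZ
          mono_f := ⟨fun _ _ _ => hZ.eq_of_tgt _ _⟩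
          epi_g := ⟨fun _ _ _ => hZ.eq_of_src _ _⟩ }
      exact ⟨Z, Z, Z, Z, hPZ, hPZ, hPZ, hPZ, 0, 0, 0, 0, by simp, by simp, hs, hs, by simp⟩
    | add x y _ _ hx hy =>
      obtain ⟨U, V, E, E', hU, hV, hE, hE', i, p, i', p', w, w', h1, h2, h3⟩ := hx
      obtain ⟨U₂, V₂, E₂, E₂', hU₂, hV₂, hE₂, hE₂', i₂, p₂, i₂', p₂', w₂, w₂', h1₂, h2₂, h3₂⟩ := hy
      refine ⟨U ⊞ U₂, V ⊞ V₂, E ⊞ E₂, E' ⊞ E₂', hsum _ _ hU hU₂, hsum _ _ hV hV₂,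
        hsum _ _ hE hE₂, hsum _ _ hE' hE₂', _, _, _, _, _, _, shortExact_biprod_map h1 h1₂,
        shortExact_biprod_map h2 h2₂, ?_⟩
      rw [map_add, h3, h3₂, hγ ⟨E, hE⟩ ⟨E₂, hE₂⟩, hγ ⟨E', hE'⟩ ⟨E₂', hE₂'⟩]
      abel
    | neg x _ hx =>
      obtain ⟨U, V, E, E', hU, hV, hE, hE', i, p, i', p', w, w', h1, h2, h3⟩ := hx
      exact ⟨U, V, E', E, hU, hV, hE', hE, i', p', i, p, w', w, h2, h1, by rw [map_neg, h3, neg_sub]⟩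
  have h0 : FreeAbelianGroup.of (⟨A, hA⟩ : P.FullSubcategory) - FreeAbelianGroup.of ⟨B, hB⟩ ∈
      K0Relations P := by
    rw [← QuotientAddGroup.eq_zero_iff]
    exact sub_eq_zero.2 h
  obtain ⟨U, V, E, E', hU, hV, hE, hE', i, p, i', p', w, w', h1, h2, h3⟩ := key _ h0
  rw [map_sub, FreeAbelianGroup.lift_apply_of, FreeAbelianGroup.lift_apply_of,
    sub_eq_sub_iff_add_eq_add, add_comm (γ ⟨E, hE⟩), ← hγ, ← hγ] at h3
  -- Equality in the group completion is an isomorphism only after adding some `D`, which is then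
  -- absorbed into `E`, `E'` and the common end `V`.
  obtain ⟨⟨d, hd⟩, hD⟩ := (AddLocalization.addMonoidOf
    (⊤ : AddSubmonoid (_root_.Quotient (isoSetoid P)))).eq_iff_exists.1 h3
  obtain ⟨D, rfl⟩ := Quotient.exists_rep d
  obtain ⟨e⟩ := Quotient.exact hD
  exact ⟨U, V ⊞ D.obj, E' ⊞ D.obj, E ⊞ D.obj, hU, hsum _ _ hV D.property, hsum _ _ hE' D.property,
    hsum _ _ hE D.property, _, _, _, _, _, _, shortExact_biprod_right h2 D.obj,
    shortExact_biprod_right h1 D.obj,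
    ⟨(biprod.associator _ _ _).symm.trans ((biprod.braiding _ _).trans (e.trans
      ((biprod.braiding _ _).trans (biprod.associator _ _ _))))⟩⟩

/-- Cofinality: if every object satisfying `Q` is a direct summand of an object satisfying `P`,
with complement satisfying `Q`, and `P` is closed under those extensions which satisfy `Q`, then
the canonical map between the Grothendieck groups is injective. -/
theorem K0.map_id_injective {P Q : ObjectProperty C} (hPQ : ∀ A, P A → Q A)
    (hz : ∃ Z, IsZero Z ∧ P Z) (hsum : ∀ A B, P A → P B → P (A ⊞ B))
    (hsumQ : ∀ A B, Q A → Q B → Q (A ⊞ B)) (hcof : ∀ A, Q A → ∃ B, Q B ∧ P (A ⊞ B))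
    (hext : ∀ S : ShortComplex C, S.ShortExact → P S.X₁ → Q S.X₂ → P S.X₃ → P S.X₂)
    (hex : ∀ S : ShortComplex C, S.ShortExact → (S.map (𝟭 C)).ShortExact) :
    Function.Injective (K0.map (P := P) (Q := Q) (𝟭 C) hPQ hex) := by
  rw [injective_iff_map_eq_zero]
  intro z hz'
  obtain ⟨A, B, hA, hB, rfl⟩ := K0.exists_sub hz hsum z
  rw [map_sub, K0.map_of, K0.map_of, sub_eq_zero] at hz'
  obtain ⟨Z, hZ, hPZ⟩ := hz
  obtain ⟨U, V, E, E', hU, hV, hE, hE', i, p, i', p', w, w', h1, h2, ⟨e⟩⟩ :=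
    K0.exists_of_eq ⟨Z, hZ, hPQ Z hPZ⟩ hsumQ hz'
  obtain ⟨U', hU', hUU'⟩ := hcof U hU
  obtain ⟨V', hV', hVV'⟩ := hcof V hV
  -- Adding the split extension of `V'` by `U'` gives both ends the property `P`. Closure under
  -- extensions puts the middle term in `P`, with a class in `K0 P` depending only on the ends.
  have key : ∀ {E : C} (hE : Q E) (i : U ⟶ E) (p : E ⟶ V) (w : i ≫ p = 0)
      (_ : (ShortComplex.mk i p w).ShortExact), ∃ hP : P (E ⊞ (U' ⊞ V')),
      (K0.of (E ⊞ (U' ⊞ V')) hP : K0 P) = K0.of (U ⊞ U') hUU' + K0.of (V ⊞ V') hVV' := by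
    intro E hE i p w h
    have h3 := shortExact_biprod_map h (ShortComplex.Splitting.ofHasBinaryBiproduct U' V').shortExact
    have h4 := hext _ h3 hUU' (hsumQ _ _ hE (hsumQ _ _ hU' hV')) hVV'
    exact ⟨h4, K0.of_shortExact _ h3 hUU' h4 hVV'⟩
  obtain ⟨h3, h3'⟩ := key hE i p w h1
  obtain ⟨h4, h4'⟩ := key hE' i' p' w' h2
  have h5 := K0.of_iso ⟨Z, hZ, hPZ⟩ ((biprod.associator A E (U' ⊞ V')).symm.trans
    ((biprod.mapIso e (Iso.refl _)).trans (biprod.associator B E' (U' ⊞ V'))))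
    (hsum _ _ hA h3) (hsum _ _ hB h4)
  rw [K0.of_biprod A _ hA h3, K0.of_biprod B _ hB h4, h3', h4'] at h5
  rw [add_right_cancel h5, sub_self]

end Heller


/-! ### Cancellation over finite dimensional algebras. -/

section FieldCoefficients

lemma nonempty_equiv_prod_of_exact {B M N K : Type*} [Ring B] [AddCommGroup M] [Module B M]
    [AddCommGroup N] [Module B N] [AddCommGroup K] [Module B K] [Module.Projective B K]
    (f : M →ₗ[B] N) (g : N →ₗ[B] K) (hf : Function.Injective f) (hfg : Function.Exact f g)
    (hg : Function.Surjective g) : Nonempty (N ≃ₗ[B] M × K) := by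
  obtain ⟨l, hl⟩ := Module.projective_lifting_property g LinearMap.id hg
  exact ⟨(hfg.splitSurjectiveEquiv hf ⟨l, hl⟩).1⟩

lemma nonempty_equiv_prod_of_shortExact {B : Type u} [Ring B] (S : ShortComplex (ModuleCat.{u} B))
    (hS : S.ShortExact) [Module.Projective B S.X₃] : Nonempty (S.X₂ ≃ₗ[B] S.X₁ × S.X₃) :=
  nonempty_equiv_prod_of_exact S.f.hom S.g.hom hS.moduleCat_injective_f
    ((ShortComplex.ShortExact.moduleCat_exact_iff_function_exact _).1 hS.exact) hS.moduleCat_surjective_g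

/-- Over an algebra which is finite dimensional over a field, finitely generated projective modules
with the same class in the Grothendieck group are isomorphic. -/
theorem nonempty_linearEquiv_of_K0_eq {F B : Type u} [Field F] [Ring B] [Algebra F B]
    [Module.Finite F B] {M N : ModuleCat.{u} B} (hM : fgProjective B M) (hN : fgProjective B N)
    (h : (K0.of M hM : K0 (fgProjective B)) = K0.of N hN) : Nonempty (M ≃ₗ[B] N) := by
  have hprod : ∀ {M N E : ModuleCat.{u} B} (_ : fgProjective B M) (_ : fgProjective B N)
      (_ : E ≃ₗ[B] M × N), fgProjective B E := fun {M N E} hM hN e =>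
    have := hM.1
    have := hM.2
    have := hN.1
    have := hN.2
    ⟨Module.Finite.equiv e.symm, Module.Projective.of_equiv e.symm⟩
  obtain ⟨U, V, E, E', hU, hV, hE, hE', i, p, i', p', w, w', h1, h2, ⟨e⟩⟩ := K0.exists_of_eq
    ⟨ModuleCat.of B PUnit.{u + 1}, ModuleCat.isZero_of_subsingleton _, inferInstanceAs
      (Module.Finite B PUnit.{u + 1}), inferInstanceAs (Module.Projective B PUnit.{u + 1})⟩
    (fun A B hA hB => hprod hA hB (ModuleCat.biprodIsoProd A B).toLinearEquiv) h
  have := hV.2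
  obtain ⟨e1⟩ := nonempty_equiv_prod_of_shortExact _ h1
  obtain ⟨e2⟩ := nonempty_equiv_prod_of_shortExact _ h2
  -- Both sequences split because `V` is projective, so `E` and `E'` are isomorphic and `M`, `N` are
  -- stably isomorphic. The summand `E` is then cancelled through Hom lengths, which are additive
  -- and finite.
  have e3 : (M × E) ≃ₗ[B] (N × E) :=
    ((ModuleCat.biprodIsoProd M E).symm.trans (e.trans
      (ModuleCat.biprodIsoProd N E'))).toLinearEquiv.trans
        (LinearEquiv.prodCongr (LinearEquiv.refl B N) (e2.trans e1.symm))
  have := hM.1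
  have := hM.2
  have := hN.1
  have := hN.2
  have := hE.1
  let _ : Module F M := Module.compHom M (algebraMap F B)
  let _ : Module F N := Module.compHom N (algebraMap F B)
  let _ : Module F E := Module.compHom E (algebraMap F B)
  have : IsScalarTower F B M := IsScalarTower.of_algebraMap_smul fun _ _ => rfl
  have : IsScalarTower F B N := IsScalarTower.of_algebraMap_smul fun _ _ => rfl
  have : IsScalarTower F B E := IsScalarTower.of_algebraMap_smul fun _ _ => rfl
  have : Module.Finite F E := Module.Finite.trans B E
  refine nonempty_linearEquiv_of_projective (R := F) fun S _ _ _ _ _ hfin => ?_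
  have h3 := homLength_congr_left (R := F) (S := S) e3
  rw [homLength_prod, homLength_prod] at h3
  exact ENat.add_left_injective_of_ne_top (homLength_ne_top
    (by rw [length_eq_finrank]; exact ENat.natCast_ne_top _)) h3

end FieldCoefficients


/-! ### Modules on a scheme with bases of sections near every point. -/

section LocalBases

open scoped Topology

variable {X : Scheme.{u}}

lemma stalkMap_germ {M N : X.Modules} (f : M ⟶ N) (x : X) (U : X.Opens) (hx : x ∈ U)
    (s : Γ(M, U)) :
    stalkMap f x (M.presheaf.germ U x hx s) = N.presheaf.germ U x hx (f.app U s) :=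
by
  rw [stalkMap_apply]
  erw [TopCat.Presheaf.stalkFunctor_map_germ_apply]
  rfl

lemma mem_iInf_opens {T : Type*} [TopologicalSpace T] {ι : Type*} [Finite ι] {V : ι → Opens T}
    {x : T} (h : ∀ i, x ∈ V i) : x ∈ (⨅ i, V i : Opens T) := by
  rw [← SetLike.mem_coe, Opens.coe_iInf]
  exact Set.mem_iInter.2 h

lemma stalkMap_add {M N : X.Modules} (f g : M ⟶ N) (x : X) :
    stalkMap (f + g) x = stalkMap f x + stalkMap g x := by
  ext m
  obtain ⟨U, hU, s, rfl⟩ := M.presheaf.exists_germ_eq m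
  rw [LinearMap.add_apply, stalkMap_germ, stalkMap_germ, stalkMap_germ, ← map_add]
  rfl

lemma stalkMap_zero (M N : X.Modules) (x : X) : stalkMap (0 : M ⟶ N) x = 0 := by
  have h := stalkMap_add (0 : M ⟶ N) 0 x
  rwa [add_zero, left_eq_add] at h

lemma stalkMap_sum {M N : X.Modules} {ι : Type*} (s : Finset ι) (f : ι → (M ⟶ N)) (x : X) :
    stalkMap (∑ i ∈ s, f i) x = ∑ i ∈ s, stalkMap (f i) x := by
  classical
  induction s using Finset.induction_on with
  | empty => exact stalkMap_zero M N x
  | insert a s ha ih => rw [Finset.sum_insert ha, Finset.sum_insert ha, stalkMap_add, ih]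

/-- The germs at `x` of a finite family of sections form a basis of the stalk. -/
def IsBasisAt {M : X.Modules} {ι : Type u} [Fintype ι] {V : X.Opens} (e : ι → Γ(M, V)) (x : X)
    (hx : x ∈ V) : Prop :=
  Function.Bijective (Fintype.linearCombination (X.presheaf.stalk x)
    (fun i => M.presheaf.germ V x hx (e i)))

lemma linearCombination_surjective_iff {R N ι : Type*} [Semiring R] [AddCommMonoid N] [Module R N]
    [Fintype ι] (v : ι → N) :
    Function.Surjective (Fintype.linearCombination R v) ↔ Submodule.span R (Set.range v) = ⊤ := by
  rw [← LinearMap.range_eq_top, Fintype.range_linearCombination]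

lemma exists_sections_of_germs (M : X.Modules) (x : X) {ι : Type u} [Finite ι]
    (m : ι → M.presheaf.stalk x) :
    ∃ (V : X.Opens) (hx : x ∈ V) (e : ι → Γ(M, V)), ∀ i, M.presheaf.germ V x hx (e i) = m i := by
  choose V hV s hs using fun i => M.presheaf.exists_germ_eq (m i)
  have hx : x ∈ (⨅ i, V i : X.Opens) := mem_iInf_opens hV
  exact ⟨⨅ i, V i, hx, fun i => M.presheaf.map (homOfLE (iInf_le V i)).op (s i), fun i => by
    rw [M.presheaf.germ_res_apply, hs]⟩

lemma exists_eq_sum_of_germ_mem_span (M : X.Modules) {ι : Type u} [Fintype ι] {V V' : X.Opens}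
    (e : ι → Γ(M, V)) (s : Γ(M, V')) (x : X) (hx : x ∈ V) (hx' : x ∈ V')
    (h : M.presheaf.germ V' x hx' s ∈
      Submodule.span (X.presheaf.stalk x) (Set.range fun i => M.presheaf.germ V x hx (e i))) :
    ∃ (W : X.Opens) (_ : x ∈ W) (f : W ⟶ V) (f' : W ⟶ V') (r : ι → Γ(X, W)),
      M.presheaf.map f'.op s = ∑ i, r i • M.presheaf.map f.op (e i) := by
  rw [← Fintype.range_linearCombination] at h
  obtain ⟨c, hc⟩ := h
  rw [Fintype.linearCombination_apply] at hc
  choose U hU r hr using fun i => X.presheaf.exists_germ_eq (c i)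
  have hxU : x ∈ (⨅ i, U i : X.Opens) := mem_iInf_opens hU
  set W : X.Opens := (⨅ i, U i) ⊓ (V ⊓ V') with hW
  have hxW : x ∈ W := ⟨hxU, hx, hx'⟩
  have hWU (i : ι) : W ≤ U i := inf_le_left.trans (iInf_le U i)
  have hWV : W ≤ V := inf_le_right.trans inf_le_left
  have hWV' : W ≤ V' := inf_le_right.trans inf_le_right
  have hst : M.presheaf.germ W x hxW (M.presheaf.map (homOfLE hWV').op s) =
      M.presheaf.germ W x hxW (∑ i, X.presheaf.map (homOfLE (hWU i)).op (r i) •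
        M.presheaf.map (homOfLE hWV).op (e i)) := by
    rw [M.presheaf.germ_res_apply, ← hc, map_sum]
    refine Finset.sum_congr rfl fun i _ => ?_
    rw [germ_smul, M.presheaf.germ_res_apply, ← hr]
    exact congrArg (· • _) (X.presheaf.germ_res_apply _ _ _ _).symm
  obtain ⟨W', hxW', i₁, i₂, heq⟩ := M.presheaf.germ_eq x hxW hxW _ _ hst
  refine ⟨W', hxW', i₁ ≫ homOfLE hWV, i₁ ≫ homOfLE hWV',
    fun i => X.presheaf.map i₁.op (X.presheaf.map (homOfLE (hWU i)).op (r i)), ?_⟩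
  rw [op_comp, op_comp, M.presheaf.map_comp, M.presheaf.map_comp]
  refine heq.trans ?_
  rw [map_sum]
  refine Finset.sum_congr rfl fun i _ => ?_
  rw [Subsingleton.elim i₂ i₁]
  exact Scheme.Modules.map_smul _ _ _ _

lemma germ_eq_sum {M : X.Modules} {ι : Type u} [Fintype ι] {V V' W : X.Opens} (e : ι → Γ(M, V))
    (s : Γ(M, V')) (f : W ⟶ V) (f' : W ⟶ V') (r : ι → Γ(X, W))
    (h : M.presheaf.map f'.op s = ∑ i, r i • M.presheaf.map f.op (e i)) (y : X) (hy : y ∈ W) :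
    M.presheaf.germ V' y (f'.le hy) s = Fintype.linearCombination (X.presheaf.stalk y)
      (fun i => M.presheaf.germ V y (f.le hy) (e i)) (fun i => X.presheaf.germ W y hy (r i)) := by
  rw [← M.presheaf.germ_res_apply f' y hy s, h, map_sum, Fintype.linearCombination_apply]
  refine Finset.sum_congr rfl fun i _ => ?_
  rw [germ_smul, M.presheaf.germ_res_apply]

lemma eventually_germ_mem_span (M : X.Modules) {ι : Type u} [Fintype ι] {V V' : X.Opens}
    (e : ι → Γ(M, V)) (s : Γ(M, V')) (x : X) (hx : x ∈ V) (hx' : x ∈ V')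
    (h : M.presheaf.germ V' x hx' s ∈
      Submodule.span (X.presheaf.stalk x) (Set.range fun i => M.presheaf.germ V x hx (e i))) :
    ∀ᶠ y in 𝓝 x, ∀ (hy : y ∈ V) (hy' : y ∈ V'), M.presheaf.germ V' y hy' s ∈
      Submodule.span (X.presheaf.stalk y) (Set.range fun i => M.presheaf.germ V y hy (e i)) := by
  obtain ⟨W, hxW, f, f', r, hr⟩ := exists_eq_sum_of_germ_mem_span M e s x hx hx' h
  filter_upwards [W.isOpen.mem_nhds hxW] with y hyW hy hy'
  rw [← Fintype.range_linearCombination]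
  exact ⟨_, (germ_eq_sum e s f f' r hr y hyW).symm⟩

lemma isBasisAt_res {M : X.Modules} {ι : Type u} [Fintype ι] {V W : X.Opens} (e : ι → Γ(M, V))
    (f : W ⟶ V) (x : X) (hx : x ∈ W) :
    IsBasisAt (fun i => M.presheaf.map f.op (e i)) x hx ↔ IsBasisAt e x (f.le hx) := by
  unfold IsBasisAt
  simp only [M.presheaf.germ_res_apply]

/-- Locally on `X`, the module has a finite family of sections which is a basis of all stalks. -/
def HasLocalBases (M : X.Modules) : Prop :=
  ∀ x : X, ∃ (V : X.Opens) (_ : x ∈ V) (ι : Type u) (_ : Fintype ι) (e : ι → Γ(M, V)),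
    ∀ (y : X) (hy : y ∈ V), IsBasisAt e y hy

lemma exists_isBasisAt_of_eventually {M : X.Modules} {x : X} {V : X.Opens} (hx : x ∈ V)
    {ι : Type u} [Fintype ι] (e : ι → Γ(M, V))
    (h : ∀ᶠ y in 𝓝 x, ∀ hy : y ∈ V, IsBasisAt e y hy) :
    ∃ (V : X.Opens) (_ : x ∈ V) (ι : Type u) (_ : Fintype ι) (e : ι → Γ(M, V)),
      ∀ (y : X) (hy : y ∈ V), IsBasisAt e y hy := by
  obtain ⟨W, hW, hWo, hxW⟩ := eventually_nhds_iff.1 h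
  let W' : X.Opens := ⟨W, hWo⟩ ⊓ V
  refine ⟨W', ⟨hxW, hx⟩, ι, inferInstance,
    fun i => M.presheaf.map (homOfLE (inf_le_right : W' ≤ V)).op (e i), fun y hy => ?_⟩
  rw [isBasisAt_res]
  exact hW y hy.1 hy.2

/-- A family of sections which is a basis of one stalk of a module with local bases is a basis of
the nearby stalks. -/
lemma HasLocalBases.eventually_isBasisAt {M : X.Modules} (hM : HasLocalBases M) {ι : Type u}
    [Fintype ι] {V : X.Opens} (e : ι → Γ(M, V)) (x : X) (hx : x ∈ V) (h : IsBasisAt e x hx) :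
    ∀ᶠ y in 𝓝 x, ∀ hy : y ∈ V, IsBasisAt e y hy := by
  obtain ⟨U, hxU, κ, _, f, hf⟩ := hM x
  have hcard : Fintype.card ι = Fintype.card κ :=
    card_eq_of_linearEquiv (X.presheaf.stalk x)
      ((LinearEquiv.ofBijective _ h).trans (LinearEquiv.ofBijective _ (hf x hxU)).symm)
  have h1 : ∀ᶠ y in 𝓝 x, ∀ j, ∀ (hy : y ∈ V) (hy' : y ∈ U), M.presheaf.germ U y hy' (f j) ∈
      Submodule.span (X.presheaf.stalk y) (Set.range fun i => M.presheaf.germ V y hy (e i)) := by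
    rw [Filter.eventually_all]
    intro j
    apply eventually_germ_mem_span M e (f j) x hx hxU
    rw [(linearCombination_surjective_iff _).1 h.2]
    trivial
  filter_upwards [h1, U.isOpen.mem_nhds hxU] with y hy hyU hyV
  have : Module.Finite (X.presheaf.stalk y) (M.presheaf.stalk y) :=
    Module.Finite.equiv (LinearEquiv.ofBijective _ (hf y hyU))
  have hsurj : Function.Surjective (Fintype.linearCombination (X.presheaf.stalk y)
      (fun i => M.presheaf.germ V y hyV (e i))) := by
    rw [linearCombination_surjective_iff, eq_top_iff,
      ← (linearCombination_surjective_iff _).1 (hf y hyU).2, Submodule.span_le]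
    rintro _ ⟨j, rfl⟩
    exact hy j hyV hyU
  refine ⟨?_, hsurj⟩
  -- The family `e` generates the nearby stalks and has as many members as a basis there, the
  -- cardinality having been compared at `x`. A surjection between free modules of equal finite rank
  -- is injective.
  let φ : (ι → X.presheaf.stalk y) ≃ₗ[X.presheaf.stalk y] (κ → X.presheaf.stalk y) :=
    LinearEquiv.funCongrLeft _ _ (Fintype.equivOfCardEq hcard.symm)
  exact OrzechProperty.injective_of_surjective_of_injective
    ((LinearEquiv.ofBijective _ (hf y hyU)).toLinearMap ∘ₗ φ.toLinearMap) _
    ((LinearEquiv.ofBijective _ (hf y hyU)).injective.comp φ.injective) hsurj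

lemma HasLocalBases.free_stalk {M : X.Modules} (hM : HasLocalBases M) (x : X) :
    Module.Free (X.presheaf.stalk x) (M.presheaf.stalk x) := by
  obtain ⟨V, hxV, ι, _, e, he⟩ := hM x
  exact Module.Free.of_equiv (LinearEquiv.ofBijective _ (he x hxV))

lemma HasLocalBases.finite_stalk {M : X.Modules} (hM : HasLocalBases M) (x : X) :
    Module.Finite (X.presheaf.stalk x) (M.presheaf.stalk x) := by
  obtain ⟨V, hxV, ι, _, e, he⟩ := hM x
  exact Module.Finite.equiv (LinearEquiv.ofBijective _ (he x hxV))

lemma HasLocalBases.of_biproduct {κ : Type u} [Fintype κ] [DecidableEq κ] {A : κ → X.Modules}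
    (N : X.Modules)
    (i : ∀ k, A k ⟶ N) (p : ∀ k, N ⟶ A k) (hip : ∀ k, i k ≫ p k = 𝟙 _)
    (hip' : ∀ k l, k ≠ l → i k ≫ p l = 0) (hsum : ∑ k, p k ≫ i k = 𝟙 N)
    (hA : ∀ k, HasLocalBases (A k)) : HasLocalBases N := by
  intro x
  choose V hV ι hι e he using fun k => hA k x
  have hx : x ∈ (⨅ k, V k : X.Opens) := mem_iInf_opens hV
  refine ⟨⨅ k, V k, hx, Σ k, ι k, inferInstance, fun a => (i a.1).app _
    ((A a.1).presheaf.map (homOfLE (iInf_le V a.1)).op (e a.1 a.2)), fun y hy => ?_⟩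
  have hyk (k : κ) : y ∈ V k := iInf_le V k hy
  have hcomb (c : (Σ k, ι k) → X.presheaf.stalk y) :
      Fintype.linearCombination (X.presheaf.stalk y) (fun a : Σ k, ι k =>
        N.presheaf.germ (⨅ k, V k) y hy ((i a.1).app _
          ((A a.1).presheaf.map (homOfLE (iInf_le V a.1)).op (e a.1 a.2)))) c =
      ∑ k, stalkMap (i k) y (Fintype.linearCombination (X.presheaf.stalk y)
        (fun j => (A k).presheaf.germ (V k) y (hyk k) (e k j)) (fun j => c ⟨k, j⟩)) := by
    simp only [Fintype.linearCombination_apply, Fintype.sum_sigma, map_sum, map_smul]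
    refine Finset.sum_congr rfl fun k _ => Finset.sum_congr rfl fun j _ => ?_
    rw [← stalkMap_germ, (A k).presheaf.germ_res_apply]
  have hpi (k l : κ) (a : (A k).presheaf.stalk y) :
      stalkMap (p l) y (stalkMap (i k) y a) = if h : k = l then h ▸ a else 0 := by
    rw [← LinearMap.comp_apply, ← stalkMap_comp]
    split_ifs with h
    · subst h
      rw [hip, stalkMap_id]
      rfl
    · rw [hip' k l h, stalkMap_zero]
      rfl
  have hp (k : κ) (c : (Σ k, ι k) → X.presheaf.stalk y) :
      stalkMap (p k) y (∑ k, stalkMap (i k) y (Fintype.linearCombination (X.presheaf.stalk y)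
        (fun j => (A k).presheaf.germ (V k) y (hyk k) (e k j)) (fun j => c ⟨k, j⟩))) =
      Fintype.linearCombination (X.presheaf.stalk y)
        (fun j => (A k).presheaf.germ (V k) y (hyk k) (e k j)) (fun j => c ⟨k, j⟩) := by
    rw [map_sum, Finset.sum_eq_single k]
    · rw [hpi, dif_pos rfl]
    · intro l _ hl
      rw [hpi, dif_neg hl]
    · simp
  constructor
  · rw [injective_iff_map_eq_zero]
    intro c hc
    rw [hcomb] at hc
    funext ⟨k, j⟩
    have h := hp k c
    rw [hc, map_zero] at h
    exact congrFun ((injective_iff_map_eq_zero _).1 (he k y (hyk k)).1 _ h.symm) j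
  · intro n
    choose c hc using fun k => (he k y (hyk k)).2 (stalkMap (p k) y n)
    refine ⟨fun a => c a.1 a.2, ?_⟩
    rw [hcomb]
    have h := LinearMap.congr_fun (congrArg (fun f => stalkMap f y) hsum) n
    rw [stalkMap_id, stalkMap_sum, LinearMap.sum_apply] at h
    refine Eq.trans (Finset.sum_congr rfl fun k _ => ?_) h
    rw [stalkMap_comp, LinearMap.comp_apply]
    exact congrArg _ (hc k)

lemma HasLocalBases.of_binaryBiproduct {A B N : X.Modules} (hA : HasLocalBases A)
    (hB : HasLocalBases B) (inl : A ⟶ N) (inr : B ⟶ N) (fst : N ⟶ A) (snd : N ⟶ B)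
    (inl_fst : inl ≫ fst = 𝟙 A) (inl_snd : inl ≫ snd = 0) (inr_fst : inr ≫ fst = 0)
    (inr_snd : inr ≫ snd = 𝟙 B) (total : fst ≫ inl + snd ≫ inr = 𝟙 N) : HasLocalBases N := by
  let F : ULift.{u} Bool → X.Modules := fun b => bif b.down then A else B
  refine HasLocalBases.of_biproduct (A := F) N
    (fun | ⟨true⟩ => inl | ⟨false⟩ => inr) (fun | ⟨true⟩ => fst | ⟨false⟩ => snd) ?_ ?_ ?_ ?_
  · rintro ⟨_ | _⟩
    · exact inr_snd
    · exact inl_fst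
  · rintro ⟨_ | _⟩ ⟨_ | _⟩ h
    · exact (h rfl).elim
    · exact inr_fst
    · exact inl_snd
    · exact (h rfl).elim
  · have h : (Finset.univ : Finset (ULift.{u} Bool)) = {⟨true⟩, ⟨false⟩} := rfl
    rw [h, Finset.sum_pair (by simp)]
    exact total
  · rintro ⟨_ | _⟩
    · exact hB
    · exact hA

lemma HasLocalBases.of_isZero {Z : X.Modules} (hZ : IsZero Z) : HasLocalBases Z :=
  HasLocalBases.of_biproduct (κ := PEmpty) (A := fun k => k.elim) Z (fun k => k.elim)
    (fun k => k.elim) (fun k => k.elim) (fun k => k.elim) (hZ.eq_of_src _ _) (fun k => k.elim)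

lemma linearCombination_sumElim {R N ι κ : Type*} [Semiring R] [AddCommMonoid N] [Module R N]
    [Fintype ι] [Fintype κ] (v : ι → N) (w : κ → N) (c : ι ⊕ κ → R) :
    Fintype.linearCombination R (Sum.elim v w) c =
      Fintype.linearCombination R v (c ∘ Sum.inl) + Fintype.linearCombination R w (c ∘ Sum.inr) := by
  simp [Fintype.linearCombination_apply]

lemma linearCombination_comp {R N N' ι : Type*} [Semiring R] [AddCommMonoid N] [Module R N]
    [AddCommMonoid N'] [Module R N'] [Fintype ι] (f : N →ₗ[R] N') (v : ι → N) (c : ι → R) :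
    Fintype.linearCombination R (fun i => f (v i)) c = f (Fintype.linearCombination R v c) := by
  simp [Fintype.linearCombination_apply]

section Exact

variable {R A E B ι κ : Type*} [Ring R] [AddCommGroup A] [Module R A] [AddCommGroup E] [Module R E]
  [AddCommGroup B] [Module R B] [Fintype ι] [Fintype κ] {f : A →ₗ[R] E} {g : E →ₗ[R] B}
  (hinj : Function.Injective f) (hex : Function.Exact f g) {v : ι → A} {w : κ → E}
  (hw : Function.Bijective (Fintype.linearCombination R (fun j => g (w j))))

include hinj hex hw

lemma linearCombination_sumElim_bijective
    (hv : Function.Bijective (Fintype.linearCombination R v)) :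
    Function.Bijective (Fintype.linearCombination R (Sum.elim (fun i => f (v i)) w)) := by
  constructor
  · rw [injective_iff_map_eq_zero]
    intro c hc
    rw [linearCombination_sumElim, linearCombination_comp] at hc
    have h1 := congrArg g hc
    rw [map_add, hex.apply_apply_eq_zero, zero_add, ← linearCombination_comp, map_zero] at h1
    have h2 := (injective_iff_map_eq_zero _).1 hw.1 _ h1
    rw [h2, map_zero, add_zero] at hc
    have h3 := (injective_iff_map_eq_zero _).1 hv.1 _ ((injective_iff_map_eq_zero _).1 hinj _ hc)
    ext (i | j)
    · exact congrFun h3 i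
    · exact congrFun h2 j
  · intro n
    obtain ⟨d, hd⟩ := hw.2 (g n)
    obtain ⟨a, ha⟩ := (hex (n - Fintype.linearCombination R w d)).1 (by
      rw [map_sub, ← linearCombination_comp, hd, sub_self])
    obtain ⟨c, rfl⟩ := hv.2 a
    refine ⟨Sum.elim c d, ?_⟩
    rw [linearCombination_sumElim, linearCombination_comp, Sum.elim_comp_inl, Sum.elim_comp_inr, ha,
      sub_add_cancel]

lemma linearCombination_bijective_of_sumElim
    (h : Function.Bijective (Fintype.linearCombination R (Sum.elim (fun i => f (v i)) w))) :
    Function.Bijective (Fintype.linearCombination R v) := by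
  constructor
  · rw [injective_iff_map_eq_zero]
    intro c hc
    have h1 := (injective_iff_map_eq_zero _).1 h.1 (Sum.elim c 0) (by
      rw [linearCombination_sumElim, linearCombination_comp, Sum.elim_comp_inl, Sum.elim_comp_inr,
        hc, map_zero, map_zero, add_zero])
    funext i
    exact congrFun h1 (Sum.inl i)
  · intro a
    obtain ⟨c, hc⟩ := h.2 (f a)
    rw [linearCombination_sumElim, linearCombination_comp] at hc
    have h1 := congrArg g hc
    rw [map_add, hex.apply_apply_eq_zero, hex.apply_apply_eq_zero, zero_add,
      ← linearCombination_comp] at h1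
    rw [(injective_iff_map_eq_zero _).1 hw.1 _ h1, map_zero, add_zero] at hc
    exact ⟨_, hinj hc⟩

end Exact

/-- The stalk sequence at `x` splits, so the stalk of the kernel is free. Sections lifting a basis
of it, together with lifts of a basis of the quotient stalk, form a basis of the middle stalk. The
middle and quotient bases persist near `x`, and exactness forces the kernel part to be a basis there
too. -/
lemma HasLocalBases.kernel (S : ShortComplex X.Modules) (hS : S.ShortExact)
    (h₂ : HasLocalBases S.X₂) (h₃ : HasLocalBases S.X₃) : HasLocalBases S.X₁ := by
  intro x
  obtain ⟨hinj, hex, hsurj⟩ := stalkMap_exact S hS x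
  have := h₂.free_stalk x
  have := h₂.finite_stalk x
  have := h₃.free_stalk x
  have := h₃.finite_stalk x
  obtain ⟨ψ⟩ : Nonempty (S.X₂.presheaf.stalk x ≃ₗ[X.presheaf.stalk x]
      S.X₁.presheaf.stalk x × S.X₃.presheaf.stalk x) :=
    nonempty_equiv_prod_of_exact _ _ hinj hex hsurj
  have : Module.Finite (X.presheaf.stalk x) (S.X₁.presheaf.stalk x) :=
    Module.Finite.of_surjective (LinearMap.fst _ _ _ ∘ₗ ψ.toLinearMap)
      (Prod.fst_surjective.comp ψ.surjective)
  have : Module.Projective (X.presheaf.stalk x) (S.X₁.presheaf.stalk x) :=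
    Module.Projective.of_split (ψ.symm.toLinearMap ∘ₗ LinearMap.inl _ _ _)
      (LinearMap.fst _ _ _ ∘ₗ ψ.toLinearMap) (by ext; simp)
  have : Module.Free (X.presheaf.stalk x) (S.X₁.presheaf.stalk x) :=
    Module.free_of_flat_of_isLocalRing
  let b₁ := Module.Free.chooseBasis (X.presheaf.stalk x) (S.X₁.presheaf.stalk x)
  let b₃ := Module.Free.chooseBasis (X.presheaf.stalk x) (S.X₃.presheaf.stalk x)
  obtain ⟨V₁, hx₁, k, hk⟩ := exists_sections_of_germs S.X₁ x b₁
  choose l' hl' using fun j => hsurj (b₃ j)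
  obtain ⟨V₂, hx₂, l, hl⟩ := exists_sections_of_germs S.X₂ x l'
  let V := V₁ ⊓ V₂
  have hxV : x ∈ V := ⟨hx₁, hx₂⟩
  let k' := fun i => S.X₁.presheaf.map (homOfLE (inf_le_left : V ≤ V₁)).op (k i)
  let m := fun j => S.X₂.presheaf.map (homOfLE (inf_le_right : V ≤ V₂)).op (l j)
  let e := Sum.elim (fun i => S.f.app V (k' i)) m
  have hgerm (y : X) (hy : y ∈ V) : (fun a => S.X₂.presheaf.germ V y hy (e a)) = Sum.elim
      (fun i => stalkMap S.f y (S.X₁.presheaf.germ V y hy (k' i)))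
      (fun j => S.X₂.presheaf.germ V y hy (m j)) := by
    ext (i | j)
    · exact (stalkMap_germ _ _ _ _ _).symm
    · rfl
  have hb₁ : IsBasisAt k' x hxV := by
    have h := b₁.equivFun.symm.bijective
    rw [isBasisAt_res, IsBasisAt]
    simp only [hk]
    convert h using 1
    ext c
    simp [Fintype.linearCombination_apply, Module.Basis.equivFun_symm_apply]
  have hb₃ : IsBasisAt (fun j => S.g.app V (m j)) x hxV := by
    have h := b₃.equivFun.symm.bijective
    have h2 (j) : S.X₃.presheaf.germ V x hxV (S.g.app V (m j)) = b₃ j := by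
      rw [← stalkMap_germ, S.X₂.presheaf.germ_res_apply, hl, hl']
    rw [IsBasisAt]
    simp only [h2]
    convert h using 1
    ext c
    simp [Fintype.linearCombination_apply, Module.Basis.equivFun_symm_apply]
  have hb₂ : IsBasisAt e x hxV := by
    rw [IsBasisAt, hgerm]
    apply linearCombination_sumElim_bijective hinj hex _ hb₁
    simp only [stalkMap_germ]
    exact hb₃
  apply exists_isBasisAt_of_eventually hxV k'
  filter_upwards [h₂.eventually_isBasisAt e x hxV hb₂, h₃.eventually_isBasisAt _ x hxV hb₃]
    with y hy₂ hy₃ hy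
  obtain ⟨hinj, hex, -⟩ := stalkMap_exact S hS y
  have h2 := hy₂ hy
  have h3 := hy₃ hy
  rw [IsBasisAt, hgerm] at h2
  rw [IsBasisAt] at h3
  simp only [← stalkMap_germ] at h3
  exact linearCombination_bijective_of_sumElim hinj hex h3 h2

end LocalBases

/-! ### Recognizing free sheaves of modules. -/

section FreeSheaves

variable {C : Type u} [SmallCategory C] {J : GrothendieckTopology C} {R : Sheaf J RingCat.{u}}
  {M : SheafOfModules.{u} R} {ι : Type u} [Fintype ι] (s : ι → M.sections)

lemma freeHomEquiv_symm_app_sum (W : Cᵒᵖ) (c : ι → R.obj.obj W) :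
    ((M.freeHomEquiv.symm s).val.app W).hom
      (∑ i, ((SheafOfModules.ιFree (R := R) i).val.app W).hom (c i)) =
        ∑ i, c i • (s i).eval W := by
  refine (map_sum _ _ _).trans (Finset.sum_congr rfl fun i _ => ?_)
  have h : SheafOfModules.ιFree (R := R) i ≫ M.freeHomEquiv.symm s =
      M.unitHomEquiv.symm (s i) := by
    rw [← SheafOfModules.unitHomEquiv_symm_freeHomEquiv_apply, Equiv.apply_symm_apply]
  refine Eq.trans ?_ (unitHomEquiv_symm_app_apply (s i) W (c i) ((s i).eval W) rfl)
  rw [← h]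
  rfl

/-- As the index set is finite, the identity of the free sheaf is a finite sum of projections
followed by inclusions. A section is therefore a combination over `W` itself, without refining `W`.
-/
lemma exists_sum_ιFree (W : Cᵒᵖ) (t : (SheafOfModules.free (R := R) ι).val.obj W) :
    ∃ c : ι → R.obj.obj W, t = ∑ i, ((SheafOfModules.ιFree (R := R) i).val.app W).hom (c i) := by
  classical
  let pr (i : ι) : SheafOfModules.free (R := R) ι ⟶ SheafOfModules.unit R :=
    Cofan.IsColimit.desc (SheafOfModules.isColimitFreeCofan ι)
      (fun j => if j = i then 𝟙 _ else 0)
  have hpr (i j : ι) : SheafOfModules.ιFree (R := R) j ≫ pr i = if j = i then 𝟙 _ else 0 :=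
    Cofan.IsColimit.fac (SheafOfModules.isColimitFreeCofan ι) _ j
  have hid : 𝟙 (SheafOfModules.free (R := R) ι) =
      ∑ i, pr i ≫ SheafOfModules.ιFree (R := R) i := by
    refine Cofan.IsColimit.hom_ext (SheafOfModules.isColimitFreeCofan ι) _ _ (fun j => ?_)
    change SheafOfModules.ιFree j ≫ _ = SheafOfModules.ιFree j ≫ _
    rw [Preadditive.comp_sum, Finset.sum_eq_single j]
    · rw [← Category.assoc, hpr, if_pos rfl, Category.id_comp, Category.comp_id]
    · intro b _ hb
      rw [← Category.assoc, hpr, if_neg hb.symm, zero_comp]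
    · simp
  let ev : (SheafOfModules.free (R := R) ι ⟶ SheafOfModules.free (R := R) ι) →+
      (SheafOfModules.free (R := R) ι).val.obj W :=
    { toFun := fun g => (g.val.app W).hom t
      map_zero' := rfl
      map_add' := fun _ _ => rfl }
  refine ⟨fun i => ((pr i).val.app W).hom t, ?_⟩
  exact (congrArg ev hid).trans (map_sum ev _ _)

/-- A finite family of global sections which is sectionwise independent and locally generates a
sheaf of modules identifies it with a free sheaf of modules. -/
lemma isIso_freeHomEquiv_symm
    (hind : ∀ (W : C) (c : ι → R.obj.obj (op W)),
      ∑ i, c i • (s i).eval (op W) = 0 → c = 0)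
    (hgen : ∀ (W : C) (m : M.val.obj (op W)), ∃ S ∈ J W, ∀ ⦃V : C⦄ (f : V ⟶ W), S f →
      ∃ c : ι → R.obj.obj (op V),
        M.val.presheaf.map f.op m =
          ∑ i, c i • (s i).eval (op V)) :
    IsIso (M.freeHomEquiv.symm s) := by
  let T := SheafOfModules.toSheaf.{u} R
  let π := M.freeHomEquiv.symm s
  have hepi : Epi π := by
    have h : Sheaf.IsLocallySurjective (T.map π) := by
      refine ⟨fun {W} m => ?_⟩
      obtain ⟨S, hS, h⟩ := hgen W m
      refine J.superset_covering (fun V f hf => ?_) hS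
      obtain ⟨c, hc⟩ := h f hf
      refine ⟨∑ i, ((SheafOfModules.ιFree (R := R) i).val.app (op V)).hom (c i), ?_⟩
      exact (freeHomEquiv_symm_app_sum s (op V) c).trans hc.symm
    have : Epi (T.map π) := (Sheaf.isLocallySurjective_iff_epi' _ _).1 h
    exact T.epi_of_epi_map this
  have hmono : Mono π := by
    have : Mono (T.map π) := by
      apply Sheaf.mono_of_injective
      rintro ⟨W⟩
      refine (injective_iff_map_eq_zero (((T.map π).hom.app (op W)).hom)).2 fun t ht => ?_
      obtain ⟨c, rfl⟩ := exists_sum_ιFree (op W) t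
      have h := hind W c ((freeHomEquiv_symm_app_sum s (op W) c).symm.trans ht)
      subst h
      exact Finset.sum_eq_zero fun i _ => map_zero _
    exact T.mono_of_mono_map this
  exact isIso_of_mono_of_epi π

end FreeSheaves


/-! ### Local bases imply coherence. -/

section Coherent

variable {X : Scheme.{u}}

/-- Sections of an `𝒪_X`-module over `V`, as sections of its restriction to the slice site. -/
noncomputable def overSection {M : X.Modules} {V : X.Opens} (s : Γ(M, V)) :
    (SheafOfModules.over (R := X.ringCatSheaf) M V).sections :=
  PresheafOfModules.sectionsMk (fun W => (M.presheaf.map W.unop.hom.op s : Γ(M, W.unop.left)))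
    (fun W W' f => by
      have h : W'.unop.hom.op = W.unop.hom.op ≫ f.unop.left.op := by
        rw [← op_comp, Over.w]
      rw [h, M.presheaf.map_comp]
      rfl)

/-- The sieve of those open subsets on which a section is a linear combination of the given
sections. -/
def combinationSieve {M : X.Modules} {V W : X.Opens} {ι : Type u} [Fintype ι] (e : ι → Γ(M, V))
    (p : W ⟶ V) (s : Γ(M, W)) : Sieve W where
  arrows U f := ∃ r : ι → Γ(X, U),
    M.presheaf.map f.op s = ∑ i, r i • M.presheaf.map (f ≫ p).op (e i)
  downward_closed := by
    rintro U U' f ⟨r, hr⟩ g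
    refine ⟨fun i => X.presheaf.map g.op (r i), ?_⟩
    rw [op_comp, M.presheaf.map_comp]
    refine (congrArg (fun t => M.presheaf.map g.op t) hr).trans ?_
    refine (map_sum (M.presheaf.map g.op).hom _ _).trans (Finset.sum_congr rfl fun i _ => ?_)
    refine (Scheme.Modules.map_smul M g (r i) (M.presheaf.map (f ≫ p).op (e i))).trans ?_
    rw [Category.assoc, op_comp (f := g), M.presheaf.map_comp]
    rfl

lemma combinationSieve_mem {M : X.Modules} {V W : X.Opens} {ι : Type u} [Fintype ι]
    (e : ι → Γ(M, V)) (he : ∀ (y : X) (hy : y ∈ V), IsBasisAt e y hy) (p : W ⟶ V) (s : Γ(M, W)) :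
    combinationSieve e p s ∈ Opens.grothendieckTopology X W := by
  intro y hy
  obtain ⟨U, hyU, f, f', r, hr⟩ := exists_eq_sum_of_germ_mem_span M e s y (p.le hy) hy (by
    rw [(linearCombination_surjective_iff _).1 (he y (p.le hy)).2]
    trivial)
  refine ⟨U, f', ⟨r, ?_⟩, hyU⟩
  rw [hr, Subsingleton.elim f (f' ≫ p)]

lemma eq_zero_of_sum_eq_zero {M : X.Modules} {V W : X.Opens} {ι : Type u} [Fintype ι]
    (e : ι → Γ(M, V)) (he : ∀ (y : X) (hy : y ∈ V), IsBasisAt e y hy) (p : W ⟶ V)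
    (c : ι → Γ(X, W)) (h : ∑ i, c i • M.presheaf.map p.op (e i) = 0) : c = 0 := by
  funext i
  refine TopCat.Presheaf.section_ext X.sheaf W _ _ fun y hy => ?_
  have h1 := germ_eq_sum e (0 : Γ(M, W)) p (𝟙 W) c (by rw [h, map_zero]) y hy
  rw [map_zero] at h1
  have h2 := (injective_iff_map_eq_zero _).1 (he y (p.le hy)).1 _ h1.symm
  exact (congrFun h2 i).trans (map_zero _).symm

/-- Independence in the stalks gives independence over every open subset, since sections of `𝒪_X`
are detected by germs; generation of the stalks gives local generation. -/
lemma isIso_of_isBasisAt {M : X.Modules} {V : X.Opens} {ι : Type u} [Fintype ι]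
    (e : ι → Γ(M, V)) (he : ∀ (y : X) (hy : y ∈ V), IsBasisAt e y hy) :
    IsIso ((SheafOfModules.over (R := X.ringCatSheaf) M V).freeHomEquiv.symm
      (fun i => overSection (e i))) := by
  apply isIso_freeHomEquiv_symm
  · intro W c h
    exact eq_zero_of_sum_eq_zero e he W.hom c h
  · intro W m
    refine ⟨(Sieve.overEquiv W).symm (combinationSieve e W.hom m), ?_, ?_⟩
    · exact GrothendieckTopology.overEquiv_symm_mem_over _ _ _ (combinationSieve_mem e he W.hom m)
    · intro U f hf
      rw [Sieve.overEquiv_symm_iff] at hf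
      obtain ⟨r, hr⟩ := hf
      refine ⟨r, hr.trans (Finset.sum_congr rfl fun i _ => ?_)⟩
      rw [Over.w]
      rfl

lemma isQuasicoherent_and_isFiniteType_of_isIso {T : Type u} [TopologicalSpace T]
    {R : Sheaf (Opens.grothendieckTopology T) RingCat.{u}} (M : SheafOfModules.{u} R)
    (V : T → Opens T) (hV : ∀ x, x ∈ V x) (ι : T → Type u) [∀ x, Finite (ι x)]
    (s : ∀ x, ι x → (M.over (V x)).sections)
    (hs : ∀ x, IsIso ((M.over (V x)).freeHomEquiv.symm (s x))) :
    M.IsQuasicoherent ∧ M.IsFiniteType := by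
  let σ (x : T) : (M.over (V x)).GeneratingSections := ⟨ι x, s x, inferInstance⟩
  let q : SheafOfModules.LocalGeneratorsData.{u} M :=
    { I := T
      X := V
      coversTop := (Opens.coversTop_iff _ _).2 (by
        rw [IsOpenCover, eq_top_iff]
        exact fun x _ => Opens.mem_iSup.2 ⟨x, hV x⟩)
      generators := σ }
  have hq : q.IsLocallyFreeData := by
    constructor
    exact hs
  have hfree := q.isLocallyFree
  have hfin (x : T) : (σ x).IsFiniteType := ⟨inferInstanceAs (Finite (ι x))⟩
  have hqfin : q.IsFiniteType := by
    constructor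
    exact hfin
  refine ⟨inferInstance, ?_⟩
  constructor
  exact ⟨q, hqfin⟩

lemma HasLocalBases.isCoherent {M : X.Modules} (hM : HasLocalBases M) : IsCoherent M := by
  choose V hV ι hι e he using hM
  exact isQuasicoherent_and_isFiniteType_of_isIso (R := X.ringCatSheaf) M V hV ι
    (fun x i => overSection (e x i)) (fun x => isIso_of_isBasisAt (e x) (he x))

/-- Sections generating a module of finite type near a point. -/
lemma exists_span_germ_eq_top (M : X.Modules)
    (hM : SheafOfModules.IsFiniteType.{u} (R := X.ringCatSheaf) M) (x : X) :
    ∃ (U : X.Opens) (_ : x ∈ U) (ι : Type u) (_ : Fintype ι) (g : ι → Γ(M, U)),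
      ∀ (y : X) (hy : y ∈ U), Submodule.span (X.presheaf.stalk y)
        (Set.range fun i => M.presheaf.germ U y hy (g i)) = ⊤ := by
  obtain ⟨⟨I, Y, hY, gen⟩, ⟨hgen⟩⟩ := hM.exists_localGeneratorsData
  obtain ⟨i, hi⟩ := ((Opens.coversTop_iff _ _).1 hY).exists_mem x
  have h1 : (gen i).IsFiniteType := hgen i
  have h2 : Finite (gen i).I := h1.finite
  have h3 : Fintype (gen i).I := Fintype.ofFinite _
  obtain ⟨g, hg⟩ := exists_sum_of_generatingSections_over M (Y i) (gen i)
  refine ⟨Y i, hi, (gen i).I, h3, g, fun y hy => ?_⟩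
  rw [eq_top_iff]
  rintro m -
  obtain ⟨V, hVU, hyV, s, rfl⟩ := M.presheaf.exists_le_germ_eq m hy
  obtain ⟨S, hS, h⟩ := hg V (homOfLE hVU) s
  obtain ⟨W, f, hf, hyW⟩ := hS y hyV
  obtain ⟨r, hr⟩ := h f hf
  rw [← Fintype.range_linearCombination]
  exact ⟨_, (germ_eq_sum g s (f ≫ homOfLE hVU) f r hr y hyW).symm⟩

end Coherent

/-! ### Sections of quasi-coherent modules which vanish generically. -/

section Torsion

variable {X : Scheme.{u}}

/-- On the affine `U`, restriction to a basic open subset `D(f)` inside `W` is localization at `f`,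
so a power of `f` kills `s`. This power is nonzero because `D(f)` is nonempty and `X` is integral.
-/
lemma exists_ne_zero_smul_eq_zero [IsIntegral X] (M : X.Modules)
    (hM : SheafOfModules.IsQuasicoherent.{u} (R := X.ringCatSheaf) M)
    {U W : X.Opens} (hU : IsAffineOpen U) (hWU : W ≤ U) (hW : (W : Set X).Nonempty) (s : Γ(M, U))
    (hs : M.presheaf.map (homOfLE hWU).op s = 0) : ∃ g : Γ(X, U), g ≠ 0 ∧ g • s = 0 := by
  obtain ⟨x, hx⟩ := hW
  let R := Γ(X, U)
  let h := hU.fromSpec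
  let N := M.restrict h
  have hN : N.IsQuasicoherent := Scheme.Modules.isQuasicoherent_restrictFunctor h M
  have hloc : IsLocalizing (modulesSpecToSheaf.obj N) :=
    (isIso_fromTildeΓ_iff_isLocalizing N).1 inferInstance
  have htop : h ''ᵁ ⊤ = U := h.image_top_eq_opensRange.trans hU.opensRange_fromSpec
  obtain ⟨p, hp⟩ : x ∈ Set.range h := by
    rw [show Set.range h = U from hU.range_fromSpec]
    exact hWU hx
  obtain ⟨_, ⟨_, ⟨f, rfl⟩, rfl⟩, hpf, hfW⟩ :=
    (PrimeSpectrum.isBasis_basic_opens (R := R)).exists_subset_of_mem_open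
      (show p ∈ (h ⁻¹ᵁ W : Set (Spec R)) by
        change h p ∈ W
        rw [hp]
        exact hx) (h ⁻¹ᵁ W).isOpen
  let s' : Γ(M, h ''ᵁ ⊤) := M.presheaf.map (homOfLE htop.le).op s
  have hfW' : h ''ᵁ (PrimeSpectrum.basicOpen f) ≤ W := by
    rintro _ ⟨q, hq, rfl⟩
    exact hfW hq
  have hz : ((modulesSpecToSheaf.obj N).obj.map (PrimeSpectrum.basicOpen f).leTop.op).hom s' = 0 := by
    change M.presheaf.map (homOfLE (h.image_mono le_top)).op s' = 0
    have h1 := congrArg (fun t => M.presheaf.map (homOfLE hfW').op t) hs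
    simp only [map_zero, s'] at h1 ⊢
    rw [← h1, ← ConcreteCategory.comp_apply, ← ConcreteCategory.comp_apply, ← M.presheaf.map_comp,
      ← M.presheaf.map_comp]
    rfl
  have := hloc f
  obtain ⟨⟨_, k, rfl⟩, hc⟩ := (IsLocalizedModule.eq_zero_iff (Submonoid.powers f) _).1 hz
  have hf : f ≠ 0 := by
    rintro rfl
    exact hpf (Ideal.zero_mem _)
  have hc' : (h.appIso ⊤).inv ((Spec R).presheaf.map (le_top : (⊤ : (Spec R).Opens) ≤ ⊤).hom.op
      ((Scheme.ΓSpecIso R).inv (f ^ k))) • s' = 0 := hc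
  have hne : Nonempty U := ⟨x, hWU hx⟩
  have hR : IsDomain R := inferInstance
  let g := (h.appIso ⊤).inv ((Spec R).presheaf.map (le_top : (⊤ : (Spec R).Opens) ≤ ⊤).hom.op
      ((Scheme.ΓSpecIso R).inv (f ^ k)))
  refine ⟨X.presheaf.map (homOfLE htop.ge).op g, ?_, ?_⟩
  · intro h0
    have : IsIso (homOfLE htop.ge) := ⟨homOfLE htop.le, rfl, rfl⟩
    have h1 := (map_eq_zero_iff _ (ConcreteCategory.bijective_of_isIso
      (X.presheaf.map (homOfLE htop.ge).op)).injective).1 h0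
    have h2 := (map_eq_zero_iff _ (ConcreteCategory.bijective_of_isIso
      (h.appIso ⊤).inv).injective).1 h1
    have : IsIso (le_top : (⊤ : (Spec R).Opens) ≤ ⊤).hom := ⟨𝟙 _, rfl, rfl⟩
    have h3 := (map_eq_zero_iff _ (ConcreteCategory.bijective_of_isIso
      ((Spec R).presheaf.map (le_top : (⊤ : (Spec R).Opens) ≤ ⊤).hom.op)).injective).1 h2
    have h4 := (map_eq_zero_iff _ (ConcreteCategory.bijective_of_isIso
      (Scheme.ΓSpecIso R).inv).injective).1 h3
    exact pow_ne_zero k hf h4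
  · have h1 : s = M.presheaf.map (homOfLE htop.ge).op s' := by
      simp only [s']
      rw [← ConcreteCategory.comp_apply, ← M.presheaf.map_comp]
      exact (congrArg (fun t => t s) (M.presheaf.map_id (op U))).symm
    rw [h1, ← Scheme.Modules.map_smul, hc', map_zero]

variable [IrreducibleSpace X]

lemma genericPoint_mem {U : X.Opens} {x : X} (hx : x ∈ U) : genericPoint X ∈ U :=
  ((genericPoint_spec X).mem_open_set_iff U.isOpen).2 ⟨x, trivial, hx⟩

/-- The specialization map from the stalk at a point to the stalk at the generic point. -/
noncomputable def toGenericStalk (M : X.Modules) (x : X) :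
    M.presheaf.stalk x →ₛₗ[algebraMap (X.presheaf.stalk x) X.functionField]
      M.presheaf.stalk (genericPoint X) where
  toFun m := M.presheaf.stalkSpecializes (genericPoint_specializes x) m
  map_add' := map_add _
  map_smul' r m := by
    obtain ⟨U, hU, r, rfl⟩ := X.presheaf.exists_germ_eq r
    obtain ⟨V, hVU, hV, m, rfl⟩ := M.presheaf.exists_le_germ_eq m hU
    rw [← X.presheaf.germ_res_apply (homOfLE hVU) x hV r]
    erw [← germ_smul, TopCat.Presheaf.germ_stalkSpecializes_apply,
      TopCat.Presheaf.germ_stalkSpecializes_apply, germ_smul]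
    congr 1
    exact (TopCat.Presheaf.germ_stalkSpecializes_apply _ _ _ _).symm

end Torsion

/-! ### Stalks as lattices in the generic stalk. -/

section GenericStalk

open scoped Topology

variable {X : Scheme.{u}} [IrreducibleSpace X]

lemma toGenericStalk_germ (M : X.Modules) (x : X) (U : X.Opens) (hx : x ∈ U) (s : Γ(M, U)) :
    toGenericStalk M x (M.presheaf.germ U x hx s) =
      M.presheaf.germ U (genericPoint X) (genericPoint_mem hx) s :=
  TopCat.Presheaf.germ_stalkSpecializes_apply (F := M.presheaf) (hy := hx)
    (h := genericPoint_specializes x) s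

lemma toGenericStalk_stalkMap {M N : X.Modules} (f : M ⟶ N) (x : X) (m : M.presheaf.stalk x) :
    toGenericStalk N x (stalkMap f x m) = stalkMap f (genericPoint X) (toGenericStalk M x m) := by
  obtain ⟨U, hU, s, rfl⟩ := M.presheaf.exists_germ_eq m
  rw [stalkMap_germ, toGenericStalk_germ, toGenericStalk_germ, stalkMap_germ]

lemma toGenericStalk_linearCombination {M : X.Modules} {ι : Type u} [Fintype ι] {V : X.Opens}
    (e : ι → Γ(M, V)) (x : X) (hx : x ∈ V) (c : ι → X.presheaf.stalk x) :
    toGenericStalk M x (Fintype.linearCombination (X.presheaf.stalk x)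
      (fun i => M.presheaf.germ V x hx (e i)) c) =
    Fintype.linearCombination X.functionField
      (fun i => M.presheaf.germ V (genericPoint X) (genericPoint_mem hx) (e i))
      (fun i => algebraMap (X.presheaf.stalk x) X.functionField (c i)) := by
  rw [Fintype.linearCombination_apply, Fintype.linearCombination_apply, map_sum]
  refine Finset.sum_congr rfl fun i _ => ?_
  rw [map_smulₛₗ, toGenericStalk_germ]

/-- Elements of the stalk of a quasi-coherent module which vanish generically are torsion. -/
lemma exists_smul_eq_zero_of_toGenericStalk_eq_zero [IsIntegral X] (M : X.Modules)
    (hM : SheafOfModules.IsQuasicoherent.{u} (R := X.ringCatSheaf) M) (x : X)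
    (m : M.presheaf.stalk x) (hm : toGenericStalk M x m = 0) :
    ∃ r : X.presheaf.stalk x, r ≠ 0 ∧ r • m = 0 := by
  obtain ⟨U₀, hx₀, s₀, rfl⟩ := M.presheaf.exists_germ_eq m
  obtain ⟨_, ⟨U, hU, rfl⟩, hxU, hUU₀⟩ :=
    X.isBasis_affineOpens.exists_subset_of_mem_open hx₀ U₀.isOpen
  let s : Γ(M, U) := M.presheaf.map (homOfLE hUU₀).op s₀
  have hs : M.presheaf.germ U x hxU s = M.presheaf.germ U₀ x hx₀ s₀ :=
    M.presheaf.germ_res_apply _ _ _ _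
  rw [← hs] at hm ⊢
  rw [toGenericStalk_germ, ← map_zero (M.presheaf.germ U _ (genericPoint_mem hxU)).hom] at hm
  obtain ⟨W, hW, i₁, i₂, hi⟩ := M.presheaf.germ_eq _ _ _ _ _ hm
  rw [map_zero] at hi
  obtain ⟨g, hg, hgs⟩ := exists_ne_zero_smul_eq_zero M hM hU i₁.le ⟨_, hW⟩ s hi
  refine ⟨X.presheaf.germ U x hxU g, fun h => hg ?_, ?_⟩
  · exact germ_injective_of_isIntegral X x hxU (h.trans (map_zero _).symm)
  · rw [← germ_smul, hgs, map_zero]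

/-- Clearing denominators in a generic relation yields an element of the stalk at `x` which vanishes
generically. By quasi-coherence it is torsion, and its coordinates in the basis at `x` must vanish.
-/
lemma IsBasisAt.genericPoint_injective [IsIntegral X] {M : X.Modules}
    (hM : SheafOfModules.IsQuasicoherent.{u} (R := X.ringCatSheaf) M) {ι : Type u} [Fintype ι]
    {V : X.Opens} {e : ι → Γ(M, V)} {x : X} {hx : x ∈ V} (h : IsBasisAt e x hx) :
    Function.Injective (Fintype.linearCombination X.functionField
      (fun i => M.presheaf.germ V (genericPoint X) (genericPoint_mem hx) (e i))) := by
  rw [injective_iff_map_eq_zero]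
  intro c hc
  obtain ⟨b, hb⟩ := IsLocalization.exist_integer_multiples_of_finite
    (nonZeroDivisors (X.presheaf.stalk x)) c
  choose a ha using hb
  have hb0 : algebraMap (X.presheaf.stalk x) X.functionField b ≠ 0 := by
    rw [Ne, FaithfulSMul.algebraMap_eq_zero_iff]
    exact nonZeroDivisors.coe_ne_zero b
  have h1 : toGenericStalk M x (Fintype.linearCombination (X.presheaf.stalk x)
      (fun i => M.presheaf.germ V x hx (e i)) a) = 0 := by
    rw [toGenericStalk_linearCombination]
    have h2 : (fun i => algebraMap (X.presheaf.stalk x) X.functionField (a i)) =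
        algebraMap (X.presheaf.stalk x) X.functionField b • c := by
      funext i
      rw [ha, Pi.smul_apply, Algebra.smul_def, smul_eq_mul]
    rw [h2, map_smul, hc, smul_zero]
  obtain ⟨r, hr, hr0⟩ := exists_smul_eq_zero_of_toGenericStalk_eq_zero M hM x _ h1
  rw [← map_smul] at hr0
  have h3 := (injective_iff_map_eq_zero _).1 h.1 _ hr0
  funext i
  have h4 : a i = 0 := (mul_eq_zero.1 (congrFun h3 i)).resolve_left hr
  have h5 := ha i
  rw [h4, map_zero, Algebra.smul_def, eq_comm, mul_eq_zero] at h5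
  exact h5.resolve_left hb0

lemma injective_linearCombination_of_genericPoint [IsIntegral X] {M : X.Modules} {ι : Type u}
    [Fintype ι] {V : X.Opens} (e : ι → Γ(M, V)) {x : X} (hx : x ∈ V)
    (h : Function.Injective (Fintype.linearCombination X.functionField
      (fun i => M.presheaf.germ V (genericPoint X) (genericPoint_mem hx) (e i)))) :
    Function.Injective (Fintype.linearCombination (X.presheaf.stalk x)
      (fun i => M.presheaf.germ V x hx (e i))) := by
  rw [injective_iff_map_eq_zero] at h ⊢
  intro c hc
  have h1 := h _ ((toGenericStalk_linearCombination e x hx c).symm.trans (by rw [hc, map_zero]))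
  funext i
  exact (FaithfulSMul.algebraMap_eq_zero_iff _ X.functionField).1 (congrFun h1 i)

/-- A coherent module on an integral scheme whose stalks are free is locally free. -/
lemma IsCoherent.hasLocalBases [IsIntegral X] {M : X.Modules} (hM : IsCoherent M)
    (hfree : ∀ x : X, Module.Free (X.presheaf.stalk x) (M.presheaf.stalk x)) :
    HasLocalBases M := by
  intro x
  have := finite_stalk M hM.2 x
  have := hfree x
  let b := Module.Free.chooseBasis (X.presheaf.stalk x) (M.presheaf.stalk x)
  obtain ⟨V, hx, e, he⟩ := exists_sections_of_germs M x b
  have hb : IsBasisAt e x hx := by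
    have h := b.equivFun.symm.bijective
    rw [IsBasisAt]
    simp only [he]
    convert h using 1
    ext c
    simp [Fintype.linearCombination_apply, Module.Basis.equivFun_symm_apply]
  obtain ⟨U, hxU, κ, _, g, hg⟩ := exists_span_germ_eq_top M hM.2 x
  apply exists_isBasisAt_of_eventually hx e
  have h1 : ∀ᶠ y in 𝓝 x, ∀ j, ∀ (hy : y ∈ V) (hy' : y ∈ U), M.presheaf.germ U y hy' (g j) ∈
      Submodule.span (X.presheaf.stalk y) (Set.range fun i => M.presheaf.germ V y hy (e i)) := by
    rw [Filter.eventually_all]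
    intro j
    apply eventually_germ_mem_span M e (g j) x hx hxU
    rw [(linearCombination_surjective_iff _).1 hb.2]
    trivial
  filter_upwards [h1, U.isOpen.mem_nhds hxU] with y hy hyU hyV
  -- Generation spreads from `x` to `y` because `M` is of finite type. Independence passes from `x`
  -- to the generic point and from there back to `y`.
  refine ⟨injective_linearCombination_of_genericPoint e hyV (hb.genericPoint_injective hM.1), ?_⟩
  rw [linearCombination_surjective_iff, eq_top_iff, ← hg y hyU, Submodule.span_le]
  rintro _ ⟨j, rfl⟩
  exact hy j hyV hyU

/-- A local basis around `x` is at once a basis at `x` and at the generic point, so coordinates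
reduce the claim to `𝒪_{X,x} ⊆ F`. -/
lemma HasLocalBases.toGenericStalk_injective [IsIntegral X] {M : X.Modules}
    (hM : HasLocalBases M) (x : X) : Function.Injective (toGenericStalk M x) := by
  obtain ⟨V, hx, ι, _, e, he⟩ := hM x
  rw [injective_iff_map_eq_zero]
  intro m hm
  obtain ⟨c, rfl⟩ := (he x hx).2 m
  rw [toGenericStalk_linearCombination] at hm
  have h := (injective_iff_map_eq_zero _).1 (he _ (genericPoint_mem hx)).1 _ hm
  have hc : c = 0 := by
    funext i
    exact (FaithfulSMul.algebraMap_eq_zero_iff _ X.functionField).1 (congrFun h i)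
  rw [hc, map_zero]

lemma HasLocalBases.exists_toGenericStalk_eq_smul [IsIntegral X] {M : X.Modules}
    (hM : HasLocalBases M) (x : X) (v : M.presheaf.stalk (genericPoint X)) :
    ∃ r : X.presheaf.stalk x, r ≠ 0 ∧ ∃ m, toGenericStalk M x m =
      algebraMap (X.presheaf.stalk x) X.functionField r • v := by
  obtain ⟨V, hx, ι, _, e, he⟩ := hM x
  obtain ⟨c, rfl⟩ := (he _ (genericPoint_mem hx)).2 v
  obtain ⟨b, hb⟩ := IsLocalization.exist_integer_multiples_of_finite
    (nonZeroDivisors (X.presheaf.stalk x)) c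
  choose a ha using hb
  refine ⟨b, nonZeroDivisors.coe_ne_zero b, Fintype.linearCombination (X.presheaf.stalk x)
      (fun i => M.presheaf.germ V x hx (e i)) a, ?_⟩
  rw [toGenericStalk_linearCombination]
  refine Eq.trans ?_ (map_smul _ _ _)
  congr 1
  funext i
  rw [ha, Pi.smul_apply, Algebra.smul_def, smul_eq_mul]

end GenericStalk

/-! ### Local rings of Dedekind schemes are principal ideal domains. -/

section DedekindScheme

open IsLocalRing

lemma isPrincipal_of_spanFinrank_le_one {R M : Type*} [Ring R] [AddCommGroup M] [Module R M]
    (N : Submodule R M) (hN : N.FG) (h : N.spanFinrank ≤ 1) : N.IsPrincipal := by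
  have h1 := hN.generators_ncard
  have h2 := Submodule.span_generators N
  rcases Nat.le_one_iff_eq_zero_or_eq_one.1 h with h0 | h0
  · rw [h0, Set.ncard_eq_zero hN.finite_generators] at h1
    rw [h1, Submodule.span_empty] at h2
    rw [← h2]
    exact bot_isPrincipal
  · rw [h0, Set.ncard_eq_one] at h1
    obtain ⟨a, ha⟩ := h1
    exact ⟨a, by rw [← h2, ha]⟩

/-- A regular local ring of dimension at most one is a principal ideal domain. -/
lemma isDomain_and_isPrincipalIdealRing_of_isRegularLocalRing (R : Type*) [CommRing R]
    [IsRegularLocalRing R] (hdim : ringKrullDim R ≤ 1) : IsDomain R ∧ IsPrincipalIdealRing R := by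
  have hs : ((maximalIdeal R).spanFinrank : WithBot ℕ∞) = ringKrullDim R :=
    IsRegularLocalRing.spanFinrank_maximalIdeal
  have hle : (maximalIdeal R).spanFinrank ≤ 1 := by
    rw [← hs] at hdim
    exact_mod_cast hdim
  have hprinc := isPrincipal_of_spanFinrank_le_one (maximalIdeal R) (IsNoetherian.noetherian _) hle
  obtain ⟨t, ht⟩ := hprinc
  have hbot : (⊥ : Ideal R).IsPrime := by
    -- In dimension zero regularity leaves no generators for the maximal ideal, which is therefore
    -- zero. Otherwise a prime `P` that is not maximal misses the generator `t`, so every element of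
    -- `P` is `t` times an element of `P`, and Nakayama gives `P = 0`.
    by_cases hall : ∀ P : Ideal R, P.IsPrime → P.IsMaximal
    · have h0 : Ring.KrullDimLE 0 R := Ring.krullDimLE_zero_iff.2 hall
      rw [Ring.krullDimLE_iff, ← hs] at h0
      have h1 : (maximalIdeal R).spanFinrank = 0 := by
        exact Nat.le_zero.1 (by exact_mod_cast h0)
      have h2 : maximalIdeal R = ⊥ := by
        exact (Submodule.spanFinrank_eq_zero_iff_eq_bot
          (IsNoetherian.noetherian (maximalIdeal R))).1 h1
      rw [← h2]
      infer_instance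
    · push Not at hall
      obtain ⟨P, hP, hPm⟩ := hall
      have htP : t ∉ P := fun h => hPm (by
        have : maximalIdeal R ≤ P := by
          rw [ht]
          exact (Ideal.span_singleton_le_iff_mem _).2 h
        rw [← (maximalIdeal.isMaximal R).eq_of_le hP.ne_top this]
        exact maximalIdeal.isMaximal R)
      have hPbot : P = ⊥ := by
        refine Submodule.eq_bot_of_le_smul_of_le_jacobson_bot (maximalIdeal R) P
          (IsNoetherian.noetherian _) (fun p hp => ?_) (IsLocalRing.maximalIdeal_le_jacobson _)
        have hpm : p ∈ maximalIdeal R := le_maximalIdeal hP.ne_top hp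
        rw [ht] at hpm
        obtain ⟨a, rfl⟩ := Submodule.mem_span_singleton.1 hpm
        have haP : a ∈ P := (hP.mem_or_mem hp).resolve_right htP
        rw [smul_eq_mul, mul_comm]
        refine Ideal.mul_mem_mul haP ?_
        rw [ht]
        exact Submodule.mem_span_singleton_self t
      rwa [← hPbot]
  have hdom : IsDomain R := IsDomain.of_bot_isPrime R
  have h : (maximalIdeal R).IsPrincipal → IsPrincipalIdealRing R :=
    ((tfae_of_isNoetherianRing_of_isLocalRing_of_isDomain R).out 4 0).1
  exact ⟨hdom, h ⟨t, ht⟩⟩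

variable (X : Scheme.{u}) [IsDedekindScheme X]

lemma IsDedekindScheme.ringKrullDim_stalk_le_one (x : X) :
    ringKrullDim (X.presheaf.stalk x) ≤ 1 := by
  rw [ringKrullDim_stalk_eq_coheight]
  refine (Order.coheight_le_krullDim x).trans ?_
  rw [Order.krullDim_eq_of_orderIso (irreducibleSetEquivPoints (α := X)).symm]
  exact IsDedekindScheme.topologicalKrullDim_le_one

instance (x : X) : IsDomain (X.presheaf.stalk x) :=
  have := IsDedekindScheme.isRegularLocalRing_stalk x
  (isDomain_and_isPrincipalIdealRing_of_isRegularLocalRing _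
    (IsDedekindScheme.ringKrullDim_stalk_le_one X x)).1

instance (x : X) : IsPrincipalIdealRing (X.presheaf.stalk x) :=
  have := IsDedekindScheme.isRegularLocalRing_stalk x
  (isDomain_and_isPrincipalIdealRing_of_isRegularLocalRing _
    (IsDedekindScheme.ringKrullDim_stalk_le_one X x)).2

instance : IsIntegral X := by
  have : IsReduced X := isReduced_of_isReduced_stalk X
  exact isIntegral_of_irreducibleSpace_of_isReduced X

end DedekindScheme

/-! ### Freeness of induced representations. -/

section InducedRepresentations

variable {R G M N : Type*} [CommRing R] [Group G] [Fintype G] [DecidableEq G] [AddCommGroup M]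
  [Module R M] [AddCommGroup N] [Module R N]

/-- A representation which is induced from a free module is free over the group ring. -/
lemma free_asModule_of_induced [Module.Free R M] [Module.Finite R M] (ρ : Representation R G N)
    (j : M →ₗ[R] N) (p : G → N →ₗ[R] M) (hp : ∀ g h m, p g (ρ h (j m)) = if g = h then m else 0)
    (hsum : ∀ n, ∑ g, ρ g (j (p g n)) = n) :
    Module.Free (MonoidAlgebra R G) ρ.asModule := by
  let b := Module.Free.chooseBasis R M
  -- The projection `p g` reads off the coefficient at `g`, which turns a relation over the group
  -- ring into one relation over `R` for each `g`.
  have hpa (g : G) (a : MonoidAlgebra R G) (m : M) :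
      p g (ρ.asModuleEquiv (a • ρ.asModuleEquiv.symm (j m))) = a.coeff g • m := by
    induction a using MonoidAlgebra.induction_linear with
    | zero => simp
    | add r s hr hs => rw [add_smul, map_add, map_add, hr, hs, MonoidAlgebra.coeff_add,
        Finsupp.add_apply, add_smul]
    | single h r =>
      rw [Representation.asModuleEquiv_map_smul, Representation.asAlgebraHom_single,
        LinearEquiv.apply_symm_apply, LinearMap.smul_apply, map_smul, hp, MonoidAlgebra.coeff_single]
      by_cases hgh : g = h
      · simp [hgh]
      · simp [hgh]
  let v := fun i => ρ.asModuleEquiv.symm (j (b i))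
  refine Module.Free.of_basis (Module.Basis.mk (v := v) ?_ ?_)
  · rw [Fintype.linearIndependent_iff]
    intro c hc i
    ext g
    have h := congrArg (fun n => p g (ρ.asModuleEquiv n)) hc
    simp only [map_sum, map_zero, v, hpa] at h
    exact Fintype.linearIndependent_iff.1 b.linearIndependent _ h i
  · rintro n -
    rw [← ρ.asModuleEquiv.symm_apply_apply n, ← hsum (ρ.asModuleEquiv n), map_sum]
    refine Submodule.sum_mem _ fun g _ => ?_
    have h1 (m : M) : ρ.asModuleEquiv.symm (ρ g (j m)) ∈
        Submodule.span (MonoidAlgebra R G) (Set.range v) := by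
      rw [Representation.asModuleEquiv_symm_map_rho]
      refine Submodule.smul_mem _ _ ?_
      rw [← b.sum_repr m, map_sum, map_sum]
      refine Submodule.sum_mem _ fun i _ => ?_
      rw [map_smul, Representation.asModuleEquiv_symm_map_smul]
      exact Submodule.smul_mem _ _ (Submodule.subset_span ⟨i, rfl⟩)
    exact h1 _

end InducedRepresentations

/-! ### Induced `𝒪_X G`-modules. -/

section InducedModules

variable {X : Scheme.{u}} {G : Type u} [Group G] [Fintype G]

instance (X : Scheme.{u}) : HasFiniteBiproducts X.Modules := Abelian.hasFiniteBiproducts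

/-- The `𝒪_X G`-module induced by an `𝒪_X`-module. -/
noncomputable def induced (G : Type u) [Group G] [Fintype G] (M : X.Modules) : GModules X G where
  V := ⨁ fun _ : G => M
  ρ :=
    { toFun := fun h => biproduct.desc fun g => biproduct.ι (fun _ : G => M) (h * g)
      map_one' := by
        refine biproduct.hom_ext' _ _ fun g => ?_
        rw [biproduct.ι_desc, one_mul]
        exact (Category.comp_id _).symm
      map_mul' := fun h k => by
        refine biproduct.hom_ext' _ _ fun g => ?_
        rw [biproduct.ι_desc, mul_assoc, End.mul_def, biproduct.ι_desc_assoc, biproduct.ι_desc] }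

/-- The inclusion of a summand of an induced module. -/
noncomputable def inducedι (M : X.Modules) (g : G) : M ⟶ (induced G M).V :=
  biproduct.ι (fun _ : G => M) g

/-- The projection to a summand of an induced module. -/
noncomputable def inducedπ (M : X.Modules) (g : G) : (induced G M).V ⟶ M :=
  biproduct.π (fun _ : G => M) g

lemma inducedι_hom_ext {M N : X.Modules} (f f' : (induced G M).V ⟶ N)
    (h : ∀ g, inducedι M g ≫ f = inducedι M g ≫ f') : f = f' :=
  biproduct.hom_ext' _ _ h

lemma inducedι_π_self (M : X.Modules) (g : G) : inducedι M g ≫ inducedπ M g = 𝟙 M :=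
  biproduct.ι_π_self _ g

lemma inducedι_π_ne (M : X.Modules) {g h : G} (hgh : g ≠ h) : inducedι M g ≫ inducedπ M h = 0 :=
  biproduct.ι_π_ne _ hgh

lemma induced_total (M : X.Modules) :
    ∑ g : G, inducedπ M g ≫ inducedι M g = 𝟙 (induced G M).V := by
  refine inducedι_hom_ext _ _ fun h => ?_
  rw [Preadditive.comp_sum, Finset.sum_eq_single h, ← Category.assoc, inducedι_π_self,
    Category.id_comp, Category.comp_id]
  · intro g _ hg
    rw [← Category.assoc, inducedι_π_ne M hg.symm, zero_comp]
  · simp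

lemma inducedι_ρ (M : X.Modules) (h g : G) :
    inducedι M g ≫ (induced G M).ρ h = inducedι M (h * g) :=
  biproduct.ι_desc _ _

/-- The underlying morphism of the counit from the module induced by the underlying module of an
`𝒪_X G`-module. -/
noncomputable def inducedDesc (M : GModules X G) : (induced G M.V).V ⟶ M.V :=
  biproduct.desc fun g => M.ρ g

lemma inducedι_desc (M : GModules X G) (g : G) : inducedι M.V g ≫ inducedDesc M = M.ρ g :=
  biproduct.ι_desc _ _

/-- The counit from the module induced by the underlying module of an `𝒪_X G`-module. -/
noncomputable def inducedCounit (M : GModules X G) : induced G M.V ⟶ M where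
  hom := inducedDesc M
  comm h := by
    refine inducedι_hom_ext _ _ fun g => ?_
    rw [← Category.assoc, inducedι_ρ, inducedι_desc, ← Category.assoc, inducedι_desc, map_mul]
    rfl

/-- The summand at `1` splits the counit as a map of `𝒪_X`-modules. The splitting need not be
equivariant, but the forgetful functor reflects epimorphisms. -/
instance (M : GModules X G) : Epi (inducedCounit M) := by
  have h : IsSplitEpi (inducedDesc M) := ⟨⟨inducedι M.V 1, by
    rw [inducedι_desc, map_one]
    rfl⟩⟩
  have : Epi ((Action.forget X.Modules G).map (inducedCounit M)) :=
    inferInstanceAs (Epi (inducedDesc M))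
  exact (Action.forget X.Modules G).epi_of_epi_map this

lemma HasLocalBases.induced {M : X.Modules} (hM : HasLocalBases M) :
    HasLocalBases (induced G M).V := by
  classical
  exact HasLocalBases.of_biproduct _ (inducedι M) (inducedπ M) (inducedι_π_self M)
    (fun _ _ => inducedι_π_ne M) (induced_total M) (fun _ => hM)

lemma stalkRep_inducedι (M : X.Modules) (x : X) (h : G) (m : M.presheaf.stalk x) :
    stalkRep (induced G M) x h (stalkMap (inducedι M 1) x m) = stalkMap (inducedι M h) x m := by
  have h1 := inducedι_ρ M h 1
  rw [mul_one] at h1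
  rw [← h1, stalkMap_comp]
  rfl

lemma free_stalk_induced {M : X.Modules} (hM : HasLocalBases M) (x : X) :
    Module.Free (StalkGroupRing X G x) ((stalkGFunctor x).obj (induced G M)) := by
  classical
  have := hM.free_stalk x
  have := hM.finite_stalk x
  refine free_asModule_of_induced (stalkRep (GaloisModule.induced G M) x)
    (stalkMap (inducedι M 1) x) (fun g => stalkMap (inducedπ M g) x) (fun g h m => ?_)
    (fun n => ?_)
  · rw [stalkRep_inducedι, ← LinearMap.comp_apply, ← stalkMap_comp]
    split_ifs with hgh
    · subst hgh
      rw [inducedι_π_self, stalkMap_id]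
      rfl
    · rw [inducedι_π_ne _ (Ne.symm hgh), stalkMap_zero]
      rfl
  · simp only [stalkRep_inducedι]
    have h := LinearMap.congr_fun (congrArg (fun f => stalkMap f x) (induced_total (G := G) M)) n
    rw [stalkMap_id, stalkMap_sum, LinearMap.sum_apply] at h
    refine Eq.trans (Finset.sum_congr rfl fun k _ => ?_) h
    rw [stalkMap_comp]
    rfl

end InducedModules

/-! ### Closure properties, and cofinality of locally free modules. -/

section LocallyProjective

variable {X : Scheme.{u}} {G : Type u} [Group G]

lemma nonempty_stalk_equiv_prod (S : ShortComplex (GModules X G)) (hS : S.ShortExact) (x : X)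
    (h : Module.Projective (StalkGroupRing X G x) ((stalkGFunctor x).obj S.X₃)) :
    Nonempty ((stalkGFunctor x).obj S.X₂ ≃ₗ[StalkGroupRing X G x]
      (stalkGFunctor x).obj S.X₁ × (stalkGFunctor x).obj S.X₃) :=
  have : Module.Projective (StalkGroupRing X G x) (S.map (stalkGFunctor x)).X₃ := h
  nonempty_equiv_prod_of_shortExact _ (stalkGFunctor_shortExact x S hS)

lemma nonempty_stalk_biprod_equiv_prod (A B : GModules X G) (x : X)
    (h : Module.Projective (StalkGroupRing X G x) ((stalkGFunctor x).obj B)) :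
    Nonempty ((stalkGFunctor x).obj (A ⊞ B) ≃ₗ[StalkGroupRing X G x]
      (stalkGFunctor x).obj A × (stalkGFunctor x).obj B) :=
  nonempty_stalk_equiv_prod _ (ShortComplex.Splitting.ofHasBinaryBiproduct A B).shortExact x h

lemma HasLocalBases.biprod {A B : GModules X G} (hA : HasLocalBases A.V)
    (hB : HasLocalBases B.V) : HasLocalBases (A ⊞ B).V := by
  refine hA.of_binaryBiproduct hB (biprod.inl : A ⟶ A ⊞ B).hom (biprod.inr : B ⟶ A ⊞ B).hom
    (biprod.fst : A ⊞ B ⟶ A).hom (biprod.snd : A ⊞ B ⟶ B).hom ?_ ?_ ?_ ?_ ?_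
  · exact congrArg Action.Hom.hom (biprod.inl_fst (X := A) (Y := B))
  · exact congrArg Action.Hom.hom (biprod.inl_snd (X := A) (Y := B))
  · exact congrArg Action.Hom.hom (biprod.inr_fst (X := A) (Y := B))
  · exact congrArg Action.Hom.hom (biprod.inr_snd (X := A) (Y := B))
  · exact congrArg Action.Hom.hom (biprod.total (X := A) (Y := B))

/-- A stalk projective over `𝒪_{X,x} G` is projective over the local ring `𝒪_{X,x}`, hence free, so
coherence can be traded for local bases. -/
lemma locallyProjective_iff [IsIntegral X] [Finite G] (P : GModules X G) :
    locallyProjective X G P ↔ HasLocalBases P.V ∧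
      ∀ x : X, Module.Projective (StalkGroupRing X G x) ((stalkGFunctor x).obj P) := by
  refine ⟨fun h => ⟨h.1.hasLocalBases fun x => ?_, h.2⟩, fun h => ⟨h.1.isCoherent, h.2⟩⟩
  have := finite_stalk P.V h.1.2 x
  have h1 : Module.Projective (StalkGroupRing X G x) (stalkRep P x).asModule := h.2 x
  have h2 : Module.Projective (X.presheaf.stalk x) (stalkRep P x).asModule :=
    projective_of_projective_algebra (A := StalkGroupRing X G x)
  have h3 : Module.Projective (X.presheaf.stalk x) (P.V.presheaf.stalk x) :=
    Module.Projective.of_equiv (stalkRep P x).asModuleEquiv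
  exact Module.free_of_flat_of_isLocalRing

lemma locallyFree_iff [IsIntegral X] [Finite G] (P : GModules X G) :
    locallyFree X G P ↔ HasLocalBases P.V ∧
      ∀ x : X, Module.Free (StalkGroupRing X G x) ((stalkGFunctor x).obj P) :=
  ⟨fun h => ⟨((locallyProjective_iff P).1 (locallyProjective_of_locallyFree P h)).1, h.2⟩,
    fun h => ⟨h.1.isCoherent, h.2⟩⟩

variable (X G)

lemma exists_isZero_locallyFree : ∃ Z : GModules X G, IsZero Z ∧ locallyFree X G Z := by
  obtain ⟨Z, hZ⟩ := HasZeroObject.zero (C := GModules X G)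
  refine ⟨Z, hZ, HasLocalBases.isCoherent (HasLocalBases.of_isZero ?_), fun x => ?_⟩
  · exact (Action.forget X.Modules G).map_isZero hZ
  · have : Subsingleton ((stalkGFunctor x).obj Z) :=
      ModuleCat.subsingleton_of_isZero ((stalkGFunctor x).map_isZero hZ)
    exact Module.Free.of_subsingleton _ _

variable {X G}

lemma locallyFree_of_shortExact {S : ShortComplex (GModules X G)} (hS : S.ShortExact)
    (h₁ : locallyFree X G S.X₁) (h₂ : locallyProjective X G S.X₂) (h₃ : locallyFree X G S.X₃) :
    locallyFree X G S.X₂ := by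
  refine ⟨h₂.1, fun x => ?_⟩
  have := h₁.2 x
  have := h₃.2 x
  obtain ⟨e⟩ := nonempty_stalk_equiv_prod S hS x Module.Projective.of_free
  exact Module.Free.of_equiv e.symm

variable [IsIntegral X] [Finite G]

lemma locallyProjective_biprod {A B : GModules X G} (hA : locallyProjective X G A)
    (hB : locallyProjective X G B) : locallyProjective X G (A ⊞ B) := by
  rw [locallyProjective_iff] at hA hB ⊢
  refine ⟨hA.1.biprod hB.1, fun x => ?_⟩
  obtain ⟨e⟩ := nonempty_stalk_biprod_equiv_prod A B x (hB.2 x)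
  have := hA.2 x
  have := hB.2 x
  exact Module.Projective.of_equiv e.symm

lemma locallyFree_biprod {A B : GModules X G} (hA : locallyFree X G A)
    (hB : locallyFree X G B) : locallyFree X G (A ⊞ B) :=
  locallyFree_of_shortExact (ShortComplex.Splitting.ofHasBinaryBiproduct A B).shortExact hA
    (locallyProjective_biprod (locallyProjective_of_locallyFree A hA)
      (locallyProjective_of_locallyFree B hB)) hB

/-- Every locally projective module is a direct summand of a locally free module. -/
lemma exists_locallyFree_biprod {A : GModules X G} (hA : locallyProjective X G A) :
    ∃ B, locallyProjective X G B ∧ locallyFree X G (A ⊞ B) := by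
  have := Fintype.ofFinite G
  have hA' := (locallyProjective_iff A).1 hA
  let S : ShortComplex (GModules X G) :=
    ShortComplex.mk (kernel.ι (inducedCounit A)) (inducedCounit A) (kernel.condition _)
  have hS : S.ShortExact :=
    { exact := ShortComplex.exact_of_f_is_kernel _ (kernelIsKernel _)
      mono_f := inferInstanceAs (Mono (kernel.ι (inducedCounit A)))
      epi_g := inferInstanceAs (Epi (inducedCounit A)) }
  -- Coherence of the kernel is obtained through its local bases.
  have hB : HasLocalBases S.X₁.V := HasLocalBases.kernel _
    (hS.map_of_exact (Action.forget X.Modules G)) hA'.1.induced hA'.1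
  have hfree (x : X) := free_stalk_induced (G := G) hA'.1 x
  have hproj (x : X) : Module.Projective (StalkGroupRing X G x) ((stalkGFunctor x).obj S.X₁) := by
    obtain ⟨e⟩ := nonempty_stalk_equiv_prod S hS x (hA.2 x)
    have := hfree x
    have h1 : Module.Projective (StalkGroupRing X G x) ((stalkGFunctor x).obj S.X₁ ×
        (stalkGFunctor x).obj S.X₃) :=
      have : Module.Projective (StalkGroupRing X G x) ((stalkGFunctor x).obj S.X₂) :=
        Module.Projective.of_free
      Module.Projective.of_equiv e
    exact Module.Projective.of_split
      (LinearMap.inl (StalkGroupRing X G x) ((stalkGFunctor x).obj S.X₁)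
        ((stalkGFunctor x).obj S.X₃))
      (LinearMap.fst (StalkGroupRing X G x) _ _) (LinearMap.fst_comp_inl _ _ _)
  refine ⟨S.X₁, (locallyProjective_iff _).2 ⟨hB, hproj⟩,
    (locallyFree_iff _).2 ⟨hA'.1.biprod hB, fun x => ?_⟩⟩
  obtain ⟨e⟩ := nonempty_stalk_equiv_prod S hS x (hA.2 x)
  -- The sequence need not split globally; it is enough that `A ⊞ B` and the induced module have
  -- isomorphic stalks.
  obtain ⟨e'⟩ := nonempty_stalk_biprod_equiv_prod A S.X₁ x (hproj x)
  have := hfree x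
  exact Module.Free.of_equiv (e.trans ((LinearEquiv.prodComm _ _ _).trans e'.symm))

end LocallyProjective


/-! ### Swan's theorem for representations on lattices. -/

section Lattices

variable {R F G : Type u} [CommRing R] [IsDomain R] [IsLocalRing R] [IsPrincipalIdealRing R]
  [Field F] [Algebra R F] [FaithfulSMul R F] [Group G] [Fintype G]

/-- Projective lattices which are isomorphic over the fraction field are isomorphic. -/
lemma nonempty_asModule_equiv {P Q V W : Type u} [AddCommGroup P] [Module R P] [AddCommGroup Q]
    [Module R Q] [AddCommGroup V] [Module F V] [AddCommGroup W] [Module F W]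
    (ρ : Representation R G P) (σ : Representation R G Q) (ρ' : Representation F G V)
    (σ' : Representation F G W) (_ : Module.Finite (MonoidAlgebra R G) ρ.asModule)
    (_ : Module.Finite (MonoidAlgebra R G) σ.asModule)
    (_ : Module.Projective (MonoidAlgebra R G) ρ.asModule)
    (_ : Module.Projective (MonoidAlgebra R G) σ.asModule)
    (s : P →ₛₗ[algebraMap R F] V) (hs : ∀ g p, s (ρ g p) = ρ' g (s p))
    (hsinj : Function.Injective s)
    (hs' : ∀ v, ∃ r : R, r ≠ 0 ∧ ∃ p, s p = algebraMap R F r • v)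
    (t : Q →ₛₗ[algebraMap R F] W) (ht : ∀ g q, t (σ g q) = σ' g (t q))
    (htinj : Function.Injective t)
    (ht' : ∀ w, ∃ r : R, r ≠ 0 ∧ ∃ q, t q = algebraMap R F r • w)
    (e : σ'.asModule ≃ₗ[MonoidAlgebra F G] ρ'.asModule) :
    Nonempty (ρ.asModule ≃ₗ[MonoidAlgebra R G] σ.asModule) := by
  obtain ⟨i, hi, d, hd, h⟩ := exists_injective_of_generic_equiv (R := R) (F := F)
    (A := MonoidAlgebra R G) (B := MonoidAlgebra F G) (P := ρ.asModule) (Q := σ.asModule)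
    (V := ρ'.asModule) (W := σ'.asModule) (φ := MonoidAlgebra.mapRingHom G (algebraMap R F))
    (fun r => by simp) (asModuleMap s hs) (asModuleMap_injective s hs hsinj)
    (asModuleMap_surjective_up_to_denominators s hs hs') (asModuleMap t ht)
    (asModuleMap_injective t ht htinj) (asModuleMap_surjective_up_to_denominators t ht ht') e
  exact nonempty_linearEquiv_of_commensurable i hi d hd h

end Lattices

/-! ### Comparison of the two kernels. -/

section ClassGroup

variable {X : Scheme.{u}} {G : Type u} [Group G]

lemma toGenericStalk_stalkRep [IrreducibleSpace X] (P : GModules X G) (x : X) (g : G)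
    (m : P.V.presheaf.stalk x) :
    toGenericStalk P.V x (stalkRep P x g m) =
      stalkRep P (genericPoint X) g (toGenericStalk P.V x m) :=
  toGenericStalk_stalkMap _ _ _

lemma lfToK0_of (A : GModules X G) (hA : locallyFree X G A) :
    lfToK0 X G (K0.of A hA) = K0.of A (locallyProjective_of_locallyFree A hA) :=
  K0.map_of _ _ _ _ _

lemma fgProjective_generic_stalk [IrreducibleSpace X] {A : GModules X G}
    (hA : locallyProjective X G A) :
    fgProjective (FunctionFieldGroupRing X G) ((stalkGFunctor (genericPoint X)).obj A) :=
  ⟨finite_stalkG A hA.1 _, hA.2 _⟩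

lemma fgFree_generic_stalk [IrreducibleSpace X] {A : GModules X G} (hA : locallyFree X G A) :
    fgFree (FunctionFieldGroupRing X G) ((stalkGFunctor (genericPoint X)).obj A) :=
  ⟨finite_stalkG A hA.1 _, hA.2 _⟩

lemma K0ToFunctionField_of [IrreducibleSpace X] (A : GModules X G)
    (hA : locallyProjective X G A) :
    K0ToFunctionField X G (K0.of A hA) = K0.of _ (fgProjective_generic_stalk hA) :=
  K0.map_of _ _ _ _ _

lemma lfToFunctionField_of [IrreducibleSpace X] (A : GModules X G) (hA : locallyFree X G A) :
    lfToFunctionField X G (K0.of A hA) = K0.of _ (fgFree_generic_stalk hA) :=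
  K0.map_of _ _ _ _ _

lemma fgProjective_of_fgFree {R : Type u} [Ring R] {M : ModuleCat.{u} R} (h : fgFree R M) :
    fgProjective R M :=
  have := h.2
  ⟨h.1, Module.Projective.of_free⟩

/-- The canonical homomorphism from the Grothendieck group of free modules to the Grothendieck group
of projective modules. -/
noncomputable def freeToProjective (R : Type u) [Ring R] : K0 (fgFree R) →+ K0 (fgProjective R) :=
  K0.map (𝟭 _) (fun _ => fgProjective_of_fgFree) (fun _ hS => hS)

lemma freeToProjective_of {R : Type u} [Ring R] (M : ModuleCat.{u} R) (hM : fgFree R M) :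
    freeToProjective R (K0.of M hM) = K0.of M (fgProjective_of_fgFree hM) :=
  K0.map_of _ _ _ _ _

lemma isZero_fgFree (R : Type u) [Ring R] : ∃ Z : ModuleCat.{u} R, IsZero Z ∧ fgFree R Z :=
  ⟨ModuleCat.of R PUnit, ModuleCat.isZero_of_subsingleton _,
    inferInstanceAs (Module.Finite R PUnit.{u + 1}), inferInstanceAs (Module.Free R PUnit.{u + 1})⟩

variable [IsDedekindScheme X] [Finite G]

/-- Locally projective modules which are generically isomorphic have isomorphic stalks. -/
lemma nonempty_stalk_equiv_of_generic {P Q : GModules X G} (hP : locallyProjective X G P)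
    (hQ : locallyProjective X G Q)
    (e : (stalkGFunctor (genericPoint X)).obj Q ≃ₗ[FunctionFieldGroupRing X G]
      (stalkGFunctor (genericPoint X)).obj P) (x : X) :
    Nonempty ((stalkGFunctor x).obj P ≃ₗ[StalkGroupRing X G x] (stalkGFunctor x).obj Q) := by
  have := Fintype.ofFinite G
  have hP' := ((locallyProjective_iff P).1 hP).1
  have hQ' := ((locallyProjective_iff Q).1 hQ).1
  exact nonempty_asModule_equiv (stalkRep P x) (stalkRep Q x) (stalkRep P (genericPoint X))
    (stalkRep Q (genericPoint X)) (finite_stalkG P hP.1 x) (finite_stalkG Q hQ.1 x) (hP.2 x) (hQ.2 x)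
    (toGenericStalk P.V x) (toGenericStalk_stalkRep P x) (hP'.toGenericStalk_injective x)
    (hP'.exists_toGenericStalk_eq_smul x) (toGenericStalk Q.V x) (toGenericStalk_stalkRep Q x)
    (hQ'.toGenericStalk_injective x) (hQ'.exists_toGenericStalk_eq_smul x) e

lemma lfToK0_injective : Function.Injective (lfToK0 X G) :=
  K0.map_id_injective locallyProjective_of_locallyFree (exists_isZero_locallyFree X G)
    (fun _ _ => locallyFree_biprod) (fun _ _ => locallyProjective_biprod)
    (fun _ => exists_locallyFree_biprod)
    (fun _ hS h₁ h₂ h₃ => locallyFree_of_shortExact hS h₁ h₂ h₃) _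

/-- Passing to the generic stalk commutes with forgetting freeness: the square completed by
`freeToProjective` commutes on classes of objects, hence everywhere. -/
lemma K0ToFunctionField_lfToK0 (z : K0 (locallyFree X G)) (hz : lfToFunctionField X G z = 0) :
    K0ToFunctionField X G (lfToK0 X G z) = 0 := by
  have h : K0ToFunctionField X G (lfToK0 X G z) = freeToProjective _ (lfToFunctionField X G z) := by
    obtain ⟨A, B, hA, hB, rfl⟩ := K0.exists_sub (exists_isZero_locallyFree X G)
      (fun _ _ => locallyFree_biprod) z
    have h1 (A : GModules X G) (hA : locallyFree X G A) :
        K0ToFunctionField X G (lfToK0 X G (K0.of A hA)) =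
          freeToProjective _ (lfToFunctionField X G (K0.of A hA)) := by
      rw [lfToK0_of, K0ToFunctionField_of, lfToFunctionField_of]
      exact (freeToProjective_of _ (fgFree_generic_stalk hA)).symm
    simp only [map_sub, h1]
  rw [h, hz, map_zero]

/-- Every class which vanishes generically comes from a generically trivial class of locally free
modules. -/
lemma exists_lfToK0_eq (z : K0 (locallyProjective X G)) (hz : K0ToFunctionField X G z = 0) :
    ∃ w, lfToFunctionField X G w = 0 ∧ lfToK0 X G w = z := by
  obtain ⟨Z, hZ, hZ'⟩ := exists_isZero_locallyFree X G
  obtain ⟨P, Q, hP, hQ, rfl⟩ := K0.exists_sub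
    ⟨Z, hZ, locallyProjective_of_locallyFree Z hZ'⟩ (fun _ _ => locallyProjective_biprod) z
  -- Adding a complement of `Q` to both terms leaves the difference unchanged and makes the second
  -- term locally free.
  obtain ⟨Q', hQ', hL⟩ := exists_locallyFree_biprod hQ
  have hM := locallyProjective_biprod hP hQ'
  have hL' := locallyProjective_of_locallyFree _ hL
  have hsub : (K0.of P hP - K0.of Q hQ : K0 (locallyProjective X G)) =
      K0.of (P ⊞ Q') hM - K0.of (Q ⊞ Q') hL' := by
    rw [K0.of_biprod P Q' hP hQ', K0.of_biprod Q Q' hQ hQ']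
    abel
  rw [hsub] at hz ⊢
  rw [map_sub, K0ToFunctionField_of, K0ToFunctionField_of, sub_eq_zero] at hz
  obtain ⟨e⟩ := nonempty_linearEquiv_of_K0_eq (F := X.functionField) _ _ hz
  -- Swan's theorem makes the stalks isomorphic to those of the locally free module `Q ⊞ Q'`.
  have hM' : locallyFree X G (P ⊞ Q') := ⟨hM.1, fun x => by
    obtain ⟨e'⟩ := nonempty_stalk_equiv_of_generic hM hL' e.symm x
    have := hL.2 x
    exact Module.Free.of_equiv e'.symm⟩
  refine ⟨K0.of _ hM' - K0.of _ hL, ?_, ?_⟩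
  · rw [map_sub, lfToFunctionField_of, lfToFunctionField_of, sub_eq_zero]
    -- The generic isomorphism itself, rather than the equality in `K₀(FG)`, makes the difference
    -- vanish in `K₀^lf(FG)`.
    exact K0.of_iso (isZero_fgFree _) e.toModuleIso _ _
  · rw [map_sub, lfToK0_of, lfToK0_of]

end ClassGroup

end GaloisModule

theorem proposition2p4 (X : Scheme.{u}) [IsDedekindScheme X] (G : Type u) [Group G] [Finite G] :
    ∃ e : locallyFreeClassGroup X G ≃+ (K0ToFunctionField X G).ker,
      ∀ c : locallyFreeClassGroup X G,
        (e c : K0 (locallyProjective X G)) = lfToK0 X G (c : K0 (locallyFree X G)) := by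
  let f : locallyFreeClassGroup X G →+ (K0ToFunctionField X G).ker :=
    ((lfToK0 X G).comp (locallyFreeClassGroup X G).subtype).codRestrict _
      fun c => K0ToFunctionField_lfToK0 _ c.2
  refine ⟨AddEquiv.ofBijective f ⟨fun c d h => ?_, fun z => ?_⟩, fun c => rfl⟩
  · exact Subtype.ext (lfToK0_injective (congrArg Subtype.val h))
  · obtain ⟨w, hw, hwz⟩ := exists_lfToK0_eq z.1 z.2
    exact ⟨⟨w, hw⟩, Subtype.ext hwz⟩
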